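/- Let $B$ be a (not necessarily unital) C*-algebra and $C \subseteq B$ a standard AF diagonal subalgebra. That is, there are finite-dimensional C*-subalgebras $B_1 \subseteq B_2 \subseteq \cdots$ of $B$ with dense union, and for each $k$ a system of matrix units for $B_k \cong \bigoplus_s M_{d_k(s)}(\mathbb{C})$ such that every matrix unit of $B_k$ is a sum of matrix units of $B_{k+1}$; and $C = \overline{\bigcup_k C_k}$, where $C_k$ is the span of the diagonal matrix units of $B_k$. In particular, $B$ is an AF C*-algebra. Write $M_\infty(B) = \bigcup_n M_n(B)$, where $M_n(B)$ is identified with the upper left corner of $M_{n+1}(B)$, and likewise $M_\infty(C)$. An element $v$ normalises a set $E$ if $vEv^* \subseteq E$ and $v^*Ev \subseteq E$. Unitaries are taken in $M_N(B^+)$, with $B^+$ the unitization of $B$ (if $B$ is unital this amounts to taking unitaries in $M_N(B)$). * $K_0(B)$ is the Grothendieck group of the monoid of projections in $M_\infty(B)$ modulo unitary equivalence ($p \approx q$ if $zpz^* = q$ for a unitary $z$ of some $M_N(B^+)$ with $p,q \in M_N(B)$), with addition $[p]+[q]=[p\oplus q]$. * $Pi(B;C)$ is the set of partial isometries $v \in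 M_\infty(B)$ that normalise $M_\infty(C)$. For $v,w \in Pi(B;C)$, write $v \sim w$ if $zvy=w$ for unitaries $z,y$ of some $M_N(B^+)$, with $v,w \in M_N(B)$, that normalise $M_N(C)$. * The dimension distribution group $G(B;C)$ is the Grothendieck group of $Pi(B;C)/\!\sim$, that is, the abelian group generated by the classes $[v]$, $v \in Pi(B;C)$, subject to $[v]=[w]$ whenever $v \sim w$, and $[v\oplus w]=[v]+[w]$ whenever $v$, $w$ and $v \oplus w$ all belong to $Pi(B;C)$. Then $G(B;C) = K_0(B)$: there is a group isomorphism $G(B;C) \to K_0(B)$ that maps the class $[v]$ of each $v \in Pi(B;C)$ to $[v^*v] = [vv^*]$. -/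

import Mathlib

universe u

namespace DimDist

/-! ### Matrices of arbitrary finite size over a C*-algebra -/

/-- The elements of the algebraic stable algebra `M_∞(R) = ⋃ₙ Mₙ(R)`, each given with a size. -/
abbrev MInf (R : Type u) : Type u := Σ n : ℕ, Matrix (Fin n) (Fin n) R

/-- The corner embedding `M_n(R) → M_N(R)`, `v ↦ v ⊕ 0` (used for `n ≤ N`). -/
def pad {R : Type u} [Zero R] {n : ℕ} (N : ℕ) (v : Matrix (Fin n) (Fin n) R) :
    Matrix (Fin N) (Fin N) R :=
  Matrix.of fun i j =>
    if h : i.val < n ∧ j.val < n then v ⟨i.val, h.1⟩ ⟨j.val, h.2⟩ else 0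

/-- The block diagonal sum `v ⊕ w`. -/
def dsum {R : Type u} [Zero R] (v w : MInf R) : MInf R :=
  ⟨v.1 + w.1,
    Matrix.reindex finSumFinEquiv finSumFinEquiv (Matrix.fromBlocks v.2 0 0 w.2)⟩

/-- `v` normalises `E` if `v E v* ⊆ E` and `v* E v ⊆ E`. -/
def Normalizes {R : Type u} [Mul R] [Star R] (v : R) (E : Set R) : Prop :=
  (∀ x ∈ E, v * x * star v ∈ E) ∧ (∀ x ∈ E, star v * x * v ∈ E)

/-! ### Grothendieck groups -/

/-- The subgroup of relations in the definition of `Gr`. -/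
def grRelations {S : Type u} (r : S → S → Prop) (sum : S → S → S → Prop) :
    AddSubgroup (FreeAbelianGroup S) :=
  AddSubgroup.closure
    ({x | ∃ v w, r v w ∧ x = FreeAbelianGroup.of v - FreeAbelianGroup.of w} ∪
     {x | ∃ v w t, sum v w t ∧
        x = FreeAbelianGroup.of t - (FreeAbelianGroup.of v + FreeAbelianGroup.of w)})

/-- The Grothendieck group of the set `S / r` with the (possibly only partially defined) addition
`[v] + [w] = [t]` for `sum v w t`: the universal abelian group generated by the classes `[v]`,
subject to `[v] = [w]` if `r v w`, and `[t] = [v] + [w]` if `sum v w t`. If the addition is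
everywhere defined and makes `S / r` a commutative monoid, this is the Grothendieck group of that
monoid. -/
abbrev Gr {S : Type u} (r : S → S → Prop) (sum : S → S → S → Prop) : Type u :=
  FreeAbelianGroup S ⧸ grRelations r sum

/-- The class of a generator. -/
def Gr.mk {S : Type u} (r : S → S → Prop) (sum : S → S → S → Prop) (v : S) : Gr r sum :=
  QuotientAddGroup.mk (FreeAbelianGroup.of v)

section CStar

variable {B : Type u} [NonUnitalCStarAlgebra B]

/-! ### Unitaries of matrix algebras

`B` need not have a unit, so unitaries are taken in `M_N(B⁺)`, with `B⁺` the unitization. If `B` is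
unital then `B⁺ ≅ B × ℂ`, and these unitaries act on `M_N(B)` exactly as those of `M_N(B)` do. -/

/-- The embedding `M_N(B) ⊆ M_N(B⁺)`. -/
def emb {N : ℕ} (v : Matrix (Fin N) (Fin N) B) : Matrix (Fin N) (Fin N) (Unitization ℂ B) :=
  v.map (fun b => (b : Unitization ℂ B))

/-- `z ∈ M_N(B⁺)` is a unitary. -/
def IsUnitaryMat {N : ℕ} (z : Matrix (Fin N) (Fin N) (Unitization ℂ B)) : Prop :=
  z ∈ unitary (Matrix (Fin N) (Fin N) (Unitization ℂ B))

/-- `z ∈ M_N(B⁺)` is a unitary that normalises `M_N(C)`. -/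
def IsNormalizingUnitary (C : NonUnitalStarSubalgebra ℂ B) {N : ℕ}
    (z : Matrix (Fin N) (Fin N) (Unitization ℂ B)) : Prop :=
  IsUnitaryMat z ∧ Normalizes z (emb '' (C : Set B).matrix)

/-! ### The group `K₀(B)` -/

variable (B) in
/-- `Pr(B)`: the projections of `M_∞(B)`. -/
abbrev Pr : Type u := {p : MInf B // IsStarProjection p.2}

/-- Unitary equivalence of projections in `M_∞(B)`: `z p z* = q` for a unitary `z` of some matrix
algebra that is large enough to contain `p` and `q`. -/
def UnitaryEquiv (p q : Pr B) : Prop :=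
  ∃ N : ℕ, p.1.1 ≤ N ∧ q.1.1 ≤ N ∧ ∃ z : Matrix (Fin N) (Fin N) (Unitization ℂ B),
    IsUnitaryMat z ∧ z * emb (pad N p.1.2) * star z = emb (pad N q.1.2)

variable (B) in
/-- `K₀(B)`: the Grothendieck group of the projections of `M_∞(B)` modulo unitary equivalence,
with addition `[p] + [q] = [p ⊕ q]`. -/
abbrev K0 : Type u :=
  Gr (UnitaryEquiv (B := B)) (fun p q t => t.1 = dsum p.1 q.1)

/-- The class of a projection in `K₀(B)`. -/
def K0.mk (p : Pr B) : K0 B := Gr.mk _ _ p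

/-! ### The dimension distribution group `G(B; C)` -/

/-- `Pi(B; C)`: the partial isometries of `M_∞(B)` that normalise `M_∞(C)`. -/
abbrev NPi (C : NonUnitalStarSubalgebra ℂ B) : Type u :=
  {v : MInf B // (IsStarProjection (star v.2 * v.2) ∧ IsStarProjection (v.2 * star v.2)) ∧
    Normalizes v.2 (C : Set B).matrix}

/-- `v ∼ w`: `z v y = w` for normalising unitaries `z`, `y` of some matrix algebra that is large
enough to contain `v` and `w`. -/
def PiEquiv (C : NonUnitalStarSubalgebra ℂ B) (v w : NPi C) : Prop :=
  ∃ N : ℕ, v.1.1 ≤ N ∧ w.1.1 ≤ N ∧ ∃ z y : Matrix (Fin N) (Fin N) (Unitization ℂ B),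
    IsNormalizingUnitary C z ∧ IsNormalizingUnitary C y ∧
      z * emb (pad N v.1.2) * y = emb (pad N w.1.2)

/-- `G(B; C)`: the Grothendieck group of `Pi(B; C)/∼`, with addition `[v] + [w] = [v ⊕ w]` for
those `v`, `w` in `Pi(B; C)` for which `v ⊕ w` is in `Pi(B; C)`. -/
abbrev G (C : NonUnitalStarSubalgebra ℂ B) : Type u :=
  Gr (PiEquiv C) (fun v w t => t.1 = dsum v.1 w.1)

/-- The class of a normalising partial isometry in `G(B; C)`. -/
def G.mk (C : NonUnitalStarSubalgebra ℂ B) (v : NPi C) : G C := Gr.mk _ _ v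

/-- The initial projection `v* v`. -/
def NPi.initial {C : NonUnitalStarSubalgebra ℂ B} (v : NPi C) : Pr B :=
  ⟨⟨v.1.1, star v.1.2 * v.1.2⟩, v.2.1.1⟩

/-- The final projection `v v*`. -/
def NPi.final {C : NonUnitalStarSubalgebra ℂ B} (v : NPi C) : Pr B :=
  ⟨⟨v.1.1, v.1.2 * star v.1.2⟩, v.2.1.2⟩

/-! ### Standard AF diagonals -/

variable (B) in
/-- A system of matrix units in `B` for a finite-dimensional C*-subalgebra
`⨁ₛ M_{d s}(ℂ)`, where `s` runs over `Fin r`. -/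
structure MatrixUnits where
  r : ℕ
  d : Fin r → ℕ
  e : (s : Fin r) → Fin (d s) → Fin (d s) → B
  ne_zero : ∀ s i j, e s i j ≠ 0
  star_e : ∀ s i j, star (e s i j) = e s j i
  mul_same : ∀ s i j l, e s i j * e s j l = e s i l
  mul_index_ne : ∀ s i j k l, j ≠ k → e s i j * e s k l = 0
  mul_block_ne : ∀ s t i j k l, s ≠ t → e s i j * e t k l = 0

/-- The set of all the matrix units `e s i j`. -/
def MatrixUnits.units (E : MatrixUnits B) : Set B := {b | ∃ s i j, b = E.e s i j}

/-- The set of the diagonal matrix units `e s i i`. -/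
def MatrixUnits.diagUnits (E : MatrixUnits B) : Set B := {b | ∃ s i, b = E.e s i i}

/-- `C` is a standard AF diagonal (regular canonical masa) of `B`: there is a sequence of matrix
unit systems such that each matrix unit of level `k` is a sum of matrix units of level `k + 1`,
`B` is the closure of the union of the (increasing) finite-dimensional algebras `B_k` that they
span, and `C` is the closure of the union of the diagonal subalgebras `C_k`. In particular `B` is
an AF C*-algebra. -/
def IsStandardAFDiagonal (C : NonUnitalStarSubalgebra ℂ B) : Prop :=
  ∃ E : ℕ → MatrixUnits B,
    (∀ k, ∀ b ∈ (E k).units, ∃ F : Finset B, (F : Set B) ⊆ (E (k + 1)).units ∧ b = ∑ f ∈ F, f) ∧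
    closure (⋃ k, (Submodule.span ℂ (E k).units : Set B)) = Set.univ ∧
    (C : Set B) = closure (⋃ k, (Submodule.span ℂ (E k).diagUnits : Set B))

end CStar

end DimDist

/-! The map `[v] ↦ [v* v]` is well defined because `z v y = w` with unitaries gives `w* w = y* (v*
v) y`. The work lies in an inverse, which sends `[p]` to the class in `G(B; C)` of a projection `q`
over `C` that is Murray–von Neumann equivalent to `p` over `B`. Such a `q` exists: `p` is close to a
projection over some `B_k`, and that one is diagonalised by finite-dimensional linear algebra
(`exists_mvN_diagonal`). Two facts make the inverse work.

First, projections over `C` that are equivalent over `B` have equal classes in `G(B; C)`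
(`gcls_eq_of_mvN_top`). An equivalence over `C` dilates to a unitary over `C⁺`, which normalises
`M_N(C)`; so both projections may be moved into the diagonal algebra of one level and split there
into diagonal matrix units. The class of a diagonal unit depends only on its block, since the
unitary swapping two units of a block normalises `C`. It remains to count units in each block. A
partial isometry implementing the equivalence is approximated by a matrix over the level algebra; if
one count were larger, a scalar matrix with a nontrivial kernel would produce an element whose norm
contradicts the approximation (`card_block_le`).

Second, `[v] = [v* v]` for every normalising partial isometry `v` (`isRegular`). If `p` is a
projection over `C` commuting with `v* v`, then `v ∼ vp ⊕ (v - vp)` (`gcls_cut`), so `v` may be cut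
into corners by diagonal units of a level that approximates `v` within `1/2`. A partial isometry of
norm less than one is zero, and this gap makes approximate statements exact. Corners between
different blocks vanish. A corner within one block is moved by a swap to a partial isometry close to
a matrix commuting with `C`; by the gap it commutes with `C` itself, hence has entries in `C`
because `C` is its own relative commutant. For entries in `C` the unitary dilation over `C⁺` gives
`v ∼ v* v`. -/

namespace DimDist

/-! ### Perturbation of projections and the norm gap for partial isometries -/

section CStarPreliminaries

/-- Projections at distance less than one are unitarily equivalent. -/
theorem exists_unitary_conj_of_norm_sub_lt_one {A : Type*} [CStarAlgebra A] {p e : A}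
    (hp : IsStarProjection p) (he : IsStarProjection e) (h : ‖p - e‖ < 1) :
    ∃ z ∈ unitary A, z * p = e * z := by
  let : PartialOrder A := CStarAlgebra.spectralOrder A
  have : StarOrderedRing A := CStarAlgebra.spectralOrderedRing A
  have hpp : p * p = p := hp.isIdempotentElem
  have hee : e * e = e := he.isIdempotentElem
  have hps : star p = p := hp.isSelfAdjoint
  have hes : star e = e := he.isSelfAdjoint
  -- This is `e p + (1 - e)(1 - p)`, which intertwines `p` and `e`. As `1 - 2e` is unitary, `a` is
  -- within `‖p - e‖ < 1` of `1`, hence invertible; the unitary part of its polar decomposition is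
  -- the required `z`.
  set a : A := 1 - (1 - (e + e)) * (p - e) with ha
  have ha' : a = 1 + e * p + e * p - e - p := by
    rw [ha]
    simp only [sub_mul, mul_sub, add_mul, one_mul, hee]
    abel
  have hu : (1 - (e + e)) ∈ unitary A := by
    have hs : star (1 - (e + e)) = 1 - (e + e) := by simp [hes]
    have hm : (1 - (e + e)) * (1 - (e + e)) = 1 := by
      simp only [sub_mul, mul_sub, add_mul, mul_add, one_mul, mul_one, hee]; abel
    exact Unitary.mem_iff.2 ⟨by rw [hs, hm], by rw [hs, hm]⟩
  have haU : IsUnit a := by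
    apply isUnit_one_sub_of_norm_lt_one
    rwa [CStarRing.norm_mem_unitary_mul _ hu]
  have hap : a * p = e * a := by
    rw [ha']
    simp only [sub_mul, mul_sub, add_mul, mul_add, one_mul, mul_one, hee, hpp, mul_assoc,
      ← mul_assoc e e]
    abel
  have hpa : p * star a = star a * e := by
    have := congrArg star hap
    simpa [hps, hes] using this
  have hcomm : Commute (star a * a) p := by
    change star a * a * p = p * (star a * a)
    rw [mul_assoc, hap, ← mul_assoc, ← hpa, mul_assoc]
  have hnn : 0 ≤ star a * a := star_mul_self_nonneg a
  set k : A := CFC.sqrt (star a * a) with hk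
  have hkk : k * k = star a * a := CFC.sqrt_mul_sqrt_self _ hnn
  have hks : star k = k := (CFC.sqrt_nonneg (star a * a)).isSelfAdjoint
  have hkp : Commute k p := Commute.cfcₙ_nnreal hcomm _
  have hkU : IsUnit k := (CFC.isUnit_sqrt_iff _ hnn).2 (haU.star.mul haU)
  obtain ⟨κ, hκ⟩ := hkU
  obtain ⟨α, hα⟩ := haU
  have hκs : star (↑κ⁻¹ : A) = ↑κ⁻¹ := by
    have : star κ = κ := Units.ext (by simpa [hκ] using hks)
    rw [← Units.coe_star_inv, this]
  have hκp : p * (↑κ⁻¹ : A) = ↑κ⁻¹ * p := by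
    have : Commute (↑κ : A) p := by rw [hκ]; exact hkp
    exact (this.units_inv_left).symm
  refine ⟨a * ↑κ⁻¹, ?_, ?_⟩
  · have h1 : star (a * ↑κ⁻¹) * (a * ↑κ⁻¹) = 1 := by
      rw [star_mul, hκs, mul_assoc, ← mul_assoc (star a), ← hkk, ← hκ]
      simp
    have hU : IsUnit (a * ↑κ⁻¹) := by rw [← hα]; exact (α * κ⁻¹).isUnit
    refine Unitary.mem_iff.2 ⟨h1, ?_⟩
    obtain ⟨ω, hω⟩ := hU
    rw [← hω] at h1 ⊢
    have := congrArg (· * (↑ω⁻¹ : A)) h1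
    simp only [mul_assoc, Units.mul_inv, mul_one, one_mul] at this
    rw [this, Units.mul_inv]
  · rw [mul_assoc, ← hκp, ← mul_assoc, hap, mul_assoc]

/-- Projections at distance less than one in a non-unital C*-algebra are Murray–von Neumann
equivalent. -/
theorem exists_partialIsometry_of_norm_sub_lt_one {A : Type*} [NonUnitalCStarAlgebra A] {p e : A}
    (hp : IsStarProjection p) (he : IsStarProjection e) (h : ‖p - e‖ < 1) :
    ∃ v : A, star v * v = p ∧ v * star v = e := by
  have hp' : IsStarProjection (p : Unitization ℂ A) :=
    hp.map (Unitization.inrNonUnitalStarAlgHom ℂ A)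
  have he' : IsStarProjection (e : Unitization ℂ A) :=
    he.map (Unitization.inrNonUnitalStarAlgHom ℂ A)
  obtain ⟨z, hz, hzp⟩ := exists_unitary_conj_of_norm_sub_lt_one hp' he'
    (by rw [← Unitization.inr_sub, Unitization.norm_inr]; exact h)
  have hz1 : star z * z = 1 := (Unitary.mem_iff.1 hz).1
  have hz2 : z * star z = 1 := (Unitary.mem_iff.1 hz).2
  -- The algebra is an ideal of its unitization, so `z p` already lies in it.
  have hv : ((z * p).snd : Unitization ℂ A) = z * p := by
    ext <;> simp
  refine ⟨(z * p).snd, ?_, ?_⟩ <;> apply Unitization.inr_injective (R := ℂ)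
  · rw [Unitization.inr_mul, Unitization.inr_star, hv, star_mul, mul_assoc, ← mul_assoc (star z),
      hz1, one_mul, hp'.isSelfAdjoint.star_eq, hp'.isIdempotentElem.eq]
  · rw [Unitization.inr_mul, Unitization.inr_star, hv, star_mul, hp'.isSelfAdjoint.star_eq,
      mul_assoc, ← mul_assoc (p : Unitization ℂ A), hp'.isIdempotentElem.eq, ← mul_assoc, hzp,
      mul_assoc, hz2, mul_one]

/-- A projection that is close to a closed star subalgebra is close to a projection in it. -/
theorem exists_projection_mem_of_norm_sub_lt {A : Type*} [NonUnitalCStarAlgebra A]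
    (S : NonUnitalStarSubalgebra ℂ A) (hS : IsClosed (S : Set A)) {p x : A}
    (hp : IsStarProjection p) (hx : x ∈ S) (h : ‖p - x‖ < 1 / 32) :
    ∃ e ∈ S, IsStarProjection e ∧ ‖p - e‖ < 1 := by
  -- The real part of `x` is at least as close to the self-adjoint `p`.
  wlog hsa : IsSelfAdjoint x generalizing x
  · refine this (x := (1 / 2 : ℂ) • (x + star x)) ?_ ?_ ?_
    · exact SMulMemClass.smul_mem _ (add_mem hx (star_mem hx))
    · have h1 : p - (1 / 2 : ℂ) • (x + star x) = (1 / 2 : ℂ) • ((p - x) + star (p - x)) := by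
        rw [star_sub, hp.isSelfAdjoint.star_eq]
        module
      rw [h1, norm_smul]
      have h2 := norm_add_le (p - x) (star (p - x))
      rw [norm_star] at h2
      have h3 : ‖(1 / 2 : ℂ)‖ = 1 / 2 := by norm_num
      rw [h3]
      linarith
    · rw [IsSelfAdjoint, star_smul, star_add, star_star, add_comm]
      congr 1
      simp
  have hpn : ‖p‖ ≤ 1 := hp.norm_le
  have hxn : ‖x‖ ≤ 1 + 1 / 32 := by
    have h1 : x = p - (p - x) := by abel
    rw [h1]
    exact (norm_sub_le _ _).trans (by linarith)
  have hy : ‖x * x - x‖ < 1 / 10 := by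
    have h1 : x * x - x = (p - x) - (p - x) * x - p * (p - x) := by
      rw [sub_mul, mul_sub, hp.isIdempotentElem.eq]; abel
    rw [h1]
    have h2 := norm_sub_le ((p - x) - (p - x) * x) (p * (p - x))
    have h3 := norm_sub_le (p - x) ((p - x) * x)
    have h4 := norm_mul_le (p - x) x
    have h5 := norm_mul_le p (p - x)
    have h6 : ‖p - x‖ * ‖x‖ ≤ (1 / 32) * (1 + 1 / 32) := by gcongr
    have h7 : ‖p‖ * ‖p - x‖ ≤ 1 * (1 / 32) := by gcongr
    linarith
  have hspec : ∀ t ∈ quasispectrum ℝ x, |t * t - t| < 1 / 10 := by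
    intro t ht
    have h1 : cfcₙ (fun t : ℝ => t * t - t) x = x * x - x := by
      rw [cfcₙ_sub .., cfcₙ_mul .., cfcₙ_id' ..]
    have h2 := (norm_cfcₙ_le_iff (fun t : ℝ => t * t - t) x (‖x * x - x‖)).1 (by rw [h1]) t ht
    exact lt_of_le_of_lt h2 hy
  -- The bound `|t² - t| < 1/10` excludes `[1/4, 3/4]` from the quasispectrum, and `f` interpolates
  -- linearly across that gap. So `f` takes only the values `0` and `1` there and moves each point
  -- by at most `1/4`.
  let f : ℝ → ℝ := fun t => max 0 (min 1 (2 * t - 1 / 2))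
  have hf : Continuous f := by fun_prop
  have hf0 : f 0 = 0 := by norm_num [f]
  have hcase : ∀ t ∈ quasispectrum ℝ x,
      (f t = 0 ∧ |t| ≤ 1 / 4) ∨ (f t = 1 ∧ |1 - t| ≤ 1 / 4) := by
    intro t ht
    obtain ⟨h1, h2⟩ := abs_lt.1 (hspec t ht)
    by_cases h3 : t ≤ 1 / 4
    · left
      refine ⟨max_eq_left ((min_le_right _ _).trans (by linarith)), abs_le.2 ⟨?_, h3⟩⟩
      nlinarith
    · push Not at h3
      have h4 : 3 / 4 < t := by
        by_contra h4
        push Not at h4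
        nlinarith
      right
      refine ⟨?_, abs_le.2 ⟨?_, by linarith⟩⟩
      · have : min (1 : ℝ) (2 * t - 1 / 2) = 1 := min_eq_left (by linarith)
        change max 0 (min (1 : ℝ) (2 * t - 1 / 2)) = 1
        rw [this]
        norm_num
      · nlinarith
  have := hS
  refine ⟨cfcₙ f x, cfcₙ_mem f hx, ?_, ?_⟩
  · refine isStarProjection_iff_quasispectrum_subset_and_isSelfAdjoint.2 ⟨?_, cfcₙ_predicate f x⟩
    rw [cfcₙ_map_quasispectrum f x hf.continuousOn hf0 hsa]
    rintro _ ⟨t, ht, rfl⟩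
    rcases hcase t ht with h1 | h1
    · left; exact h1.1
    · right; exact h1.1
  · have h1 : ‖cfcₙ f x - x‖ ≤ 1 / 4 := by
      have h2 : cfcₙ f x - x = cfcₙ (fun t => f t - t) x := by
        rw [cfcₙ_sub f (fun t => t) x hf.continuousOn hf0 (by fun_prop) rfl, cfcₙ_id' ..]
      rw [h2]
      refine norm_cfcₙ_le fun t ht => ?_
      rcases hcase t ht with h3 | h3
      · rw [h3.1, zero_sub, norm_neg]; exact h3.2
      · rw [h3.1]; exact h3.2
    have h2 : p - cfcₙ f x = (p - x) - (cfcₙ f x - x) := by abel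
    rw [h2]
    exact (norm_sub_le _ _).trans_lt (by linarith)

/-- A partial isometry of norm less than one vanishes. -/
theorem eq_zero_of_isStarProjection_of_norm_lt_one {A : Type*} [NonUnitalCStarAlgebra A] {x : A}
    (hx : IsStarProjection (star x * x)) (h : ‖x‖ < 1) : x = 0 := by
  have h1 : ‖star x * x‖ = ‖x‖ * ‖x‖ := CStarRing.norm_star_mul_self
  have h2 : ‖star x * x‖ = ‖star x * x‖ * ‖star x * x‖ := by
    have h3 : ‖star (star x * x) * (star x * x)‖ = ‖star x * x‖ * ‖star x * x‖ :=
      CStarRing.norm_star_mul_self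
    rwa [hx.isSelfAdjoint.star_eq, hx.isIdempotentElem.eq] at h3
  rw [h1] at h2
  have h3 : 0 ≤ ‖x‖ := norm_nonneg x
  by_contra hne
  have h4 : 0 < ‖x‖ := norm_pos_iff.2 hne
  have h5 : ‖x‖ * ‖x‖ < 1 := by nlinarith
  have h6 : 0 < ‖x‖ * ‖x‖ := mul_pos h4 h4
  nlinarith

/-- `x x* x = x` for a partial isometry `x`. -/
theorem mul_star_mul_self_of_isStarProjection {A : Type*} [NonUnitalCStarAlgebra A] {x : A}
    (hx : IsStarProjection (star x * x)) : x * star x * x = x := by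
  have h : star (x * star x * x - x) * (x * star x * x - x) = 0 := by
    have h1 : star x * x * (star x * x) = star x * x := hx.isIdempotentElem
    simp only [star_sub, star_mul, star_star, sub_mul, mul_sub]
    have h2 : star x * (x * star x) * (x * star x * x) = star x * x := by
      calc _ = (star x * x * (star x * x)) * (star x * x) := by simp only [mul_assoc]
        _ = _ := by rw [h1, h1]
    have h3 : star x * (x * star x * x) = star x * x := by
      rw [← h1]; simp only [mul_assoc]
    have h4 : star x * (x * star x) * x = star x * x := by
      rw [← h1]; simp only [mul_assoc]
    rw [h2, h3, h4]; abel
  exact sub_eq_zero.1 (CStarRing.star_mul_self_eq_zero_iff _ |>.1 h)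

end CStarPreliminaries

/-! ### Corner embeddings and 2 × 2 block matrices -/

section Blocks

variable {R : Type u}

/-- The embedding of `m × n` matrices as upper left corners of `M × N` matrices. -/
def rpad [Zero R] {m n : ℕ} (M N : ℕ) (v : Matrix (Fin m) (Fin n) R) :
    Matrix (Fin M) (Fin N) R :=
  Matrix.of fun i j =>
    if h : i.val < m ∧ j.val < n then v ⟨i.val, h.1⟩ ⟨j.val, h.2⟩ else 0

theorem pad_eq_rpad [Zero R] {n : ℕ} (N : ℕ) (v : Matrix (Fin n) (Fin n) R) :
    pad N v = rpad N N v := rfl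

theorem rpad_self [Zero R] {m n : ℕ} (v : Matrix (Fin m) (Fin n) R) : rpad m n v = v := by
  ext i j
  simp [rpad]

theorem rpad_mem [Zero R] {S : Set R} (h0 : (0 : R) ∈ S) {m n : ℕ} (M N : ℕ)
    {v : Matrix (Fin m) (Fin n) R} (hv : ∀ i j, v i j ∈ S) (i : Fin M) (j : Fin N) :
    rpad M N v i j ∈ S := by
  unfold rpad
  simp only [Matrix.of_apply]
  split_ifs
  · exact hv _ _
  · exact h0

theorem rpad_mul [NonUnitalNonAssocSemiring R] {l m n L M N : ℕ} (h : m ≤ M)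
    (v : Matrix (Fin l) (Fin m) R) (w : Matrix (Fin m) (Fin n) R) :
    rpad L M v * rpad M N w = rpad L N (v * w) := by
  ext i k
  rw [Matrix.mul_apply]
  by_cases hik : i.val < l ∧ k.val < n
  · have h1 : rpad L N (v * w) i k = ∑ j : Fin m, v ⟨i, hik.1⟩ j * w j ⟨k, hik.2⟩ := by
      simp [rpad, hik, Matrix.mul_apply]
    rw [h1]
    symm
    refine Fintype.sum_of_injective (Fin.castLE h) (Fin.castLE_injective h) _ _ ?_ ?_
    · intro j hj
      have : ¬ j.val < m := fun hjm => hj ⟨⟨j.val, hjm⟩, rfl⟩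
      simp [rpad, this]
    · intro j
      simp [rpad, hik.1, hik.2]
  · have h1 : rpad L N (v * w) i k = 0 := by simp [rpad, hik]
    rw [h1]
    refine Finset.sum_eq_zero fun j _ => ?_
    by_cases hi : i.val < l
    · have hk : ¬ k.val < n := fun hk => hik ⟨hi, hk⟩
      simp [rpad, hk]
    · simp [rpad, hi]

theorem conjTranspose_rpad [AddMonoid R] [StarAddMonoid R] {m n M N : ℕ}
    (v : Matrix (Fin m) (Fin n) R) :
    (rpad M N v).conjTranspose = rpad N M v.conjTranspose := by
  ext i j
  simp only [rpad, Matrix.conjTranspose_apply, Matrix.of_apply]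
  by_cases h : j.val < m ∧ i.val < n
  · rw [dif_pos h, dif_pos h.symm]
  · rw [dif_neg h, dif_neg (fun h' => h h'.symm), star_zero]

theorem star_pad [AddMonoid R] [StarAddMonoid R] {n N : ℕ} (v : Matrix (Fin n) (Fin n) R) :
    star (pad N v) = pad N (star v) := conjTranspose_rpad v

theorem pad_mul [NonUnitalNonAssocSemiring R] {n N : ℕ} (h : n ≤ N)
    (v w : Matrix (Fin n) (Fin n) R) : pad N v * pad N w = pad N (v * w) := rpad_mul h v w

theorem pad_pad [Zero R] {n N M : ℕ} (h : n ≤ N) (v : Matrix (Fin n) (Fin n) R) :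
    pad M (pad N v) = pad M v := by
  ext i j
  simp only [pad, Matrix.of_apply]
  by_cases hij : i.val < n ∧ j.val < n
  · rw [dif_pos hij, dif_pos ⟨hij.1.trans_le h, hij.2.trans_le h⟩, dif_pos hij]
  · rw [dif_neg hij]
    split_ifs <;> rfl

/-- The square matrix with four blocks of equal size. -/
def blk {n : ℕ} (a b c d : Matrix (Fin n) (Fin n) R) : Matrix (Fin (n + n)) (Fin (n + n)) R :=
  Matrix.reindex finSumFinEquiv finSumFinEquiv (Matrix.fromBlocks a b c d)

theorem blk_mul [NonUnitalNonAssocSemiring R] {n : ℕ}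
    (a b c d a' b' c' d' : Matrix (Fin n) (Fin n) R) :
    blk a b c d * blk a' b' c' d' =
      blk (a * a' + b * c') (a * b' + b * d') (c * a' + d * c') (c * b' + d * d') := by
  simp only [blk, Matrix.reindex_apply, Matrix.submatrix_mul_equiv, Matrix.fromBlocks_multiply]

theorem star_blk [Star R] {n : ℕ} (a b c d : Matrix (Fin n) (Fin n) R) :
    star (blk a b c d) = blk (star a) (star c) (star b) (star d) := by
  simp only [blk, Matrix.star_eq_conjTranspose, Matrix.conjTranspose_reindex,
    Matrix.fromBlocks_conjTranspose]

theorem blk_one [Zero R] [One R] {n : ℕ} : blk (1 : Matrix (Fin n) (Fin n) R) 0 0 1 = 1 := by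
  simp [blk, Matrix.fromBlocks_one]

theorem blk_map {R' : Type*} {n : ℕ} (f : R → R') (a b c d : Matrix (Fin n) (Fin n) R) :
    (blk a b c d).map f = blk (a.map f) (b.map f) (c.map f) (d.map f) := by
  simp only [blk, Matrix.reindex_apply, ← Matrix.submatrix_map, Matrix.fromBlocks_map]

theorem blk_mem {S : Set R} {n : ℕ} {a b c d : Matrix (Fin n) (Fin n) R}
    (ha : ∀ i j, a i j ∈ S) (hb : ∀ i j, b i j ∈ S) (hc : ∀ i j, c i j ∈ S)
    (hd : ∀ i j, d i j ∈ S) (i j : Fin (n + n)) : blk a b c d i j ∈ S := by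
  simp only [blk, Matrix.reindex_apply, Matrix.submatrix_apply]
  rcases finSumFinEquiv.symm i with i | i <;> rcases finSumFinEquiv.symm j with j | j
  · exact ha _ _
  · exact hb _ _
  · exact hc _ _
  · exact hd _ _

theorem pad_eq_blk [Zero R] {n : ℕ} (v : Matrix (Fin n) (Fin n) R) :
    pad (n + n) v = blk v 0 0 0 := by
  ext i j
  simp only [blk, Matrix.reindex_apply, Matrix.submatrix_apply]
  refine Fin.addCases (fun i => ?_) (fun i => ?_) i <;>
    refine Fin.addCases (fun j => ?_) (fun j => ?_) j <;>
    simp [pad, -Fin.natAdd_eq_addNat]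

/-- The unitary dilation of a partial isometry. -/
theorem blk_dilation_mem_unitary [Ring R] [StarRing R] {n : ℕ} {a : Matrix (Fin n) (Fin n) R}
    (h : a * star a * a = a) :
    blk a (1 - a * star a) (1 - star a * a) (star a) ∈
      unitary (Matrix (Fin (n + n)) (Fin (n + n)) R) := by
  have h' : star a * a * star a = star a := by
    have := congrArg star h
    simpa [mul_assoc] using this
  have h1 : a * (star a * a) = a := by rw [← mul_assoc, h]
  have h1' : star a * (a * star a) = star a := by rw [← mul_assoc, h']
  refine Unitary.mem_iff.2 ⟨?_, ?_⟩
  · rw [star_blk, blk_mul, ← blk_one]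
    simp only [star_sub, star_one, star_mul, star_star, mul_sub, sub_mul, mul_one, one_mul,
      mul_assoc, h1, h1']
    congr 1 <;> abel
  · rw [star_blk, blk_mul, ← blk_one]
    simp only [star_sub, star_one, star_mul, star_star, mul_sub, sub_mul, mul_one, one_mul,
      mul_assoc, h1, h1']
    congr 1 <;> abel

/-- The self-adjoint unitary attached to a projection that splits it off. -/
theorem blk_projection_mem_unitary [Ring R] [StarRing R] {n : ℕ} {p : Matrix (Fin n) (Fin n) R}
    (hp : IsStarProjection p) :
    blk p (1 - p) (1 - p) p ∈ unitary (Matrix (Fin (n + n)) (Fin (n + n)) R) := by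
  have h1 : p * p = p := hp.isIdempotentElem
  have h2 : star p = p := hp.isSelfAdjoint
  have h3 : star (blk p (1 - p) (1 - p) p) = blk p (1 - p) (1 - p) p := by
    rw [star_blk]; simp [h2]
  have h4 : blk p (1 - p) (1 - p) p * blk p (1 - p) (1 - p) p = 1 := by
    rw [blk_mul, ← blk_one]
    simp only [mul_sub, sub_mul, mul_one, one_mul, h1]
    congr 1 <;> abel
  exact Unitary.mem_iff.2 ⟨by rw [h3, h4], by rw [h3, h4]⟩

end Blocks

/-! ### Matrices over the unitization -/

section Embedding

variable {B : Type u} [NonUnitalCStarAlgebra B] {n : ℕ}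

theorem emb_mul (v w : Matrix (Fin n) (Fin n) B) : emb (v * w) = emb v * emb w := by
  refine Matrix.ext fun i j => ?_
  have h := map_sum (Unitization.inrNonUnitalAlgHom ℂ B) (fun k => v i k * w k j) Finset.univ
  have h' : ∀ b : B, Unitization.inrNonUnitalAlgHom ℂ B b = (b : Unitization ℂ B) := fun _ => rfl
  simp only [h', Unitization.inr_mul] at h
  simpa only [emb, Matrix.mul_apply, Matrix.map_apply] using h

theorem emb_star (v : Matrix (Fin n) (Fin n) B) : emb (star v) = star (emb v) := by
  ext i j : 1
  simp [emb, Matrix.star_apply]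

theorem emb_injective : Function.Injective (emb (B := B) (N := n)) :=
  Matrix.map_injective Unitization.inr_injective

theorem emb_zero : emb (0 : Matrix (Fin n) (Fin n) B) = 0 := by
  ext i j : 1
  simp [emb]

theorem emb_sub (v w : Matrix (Fin n) (Fin n) B) : emb (v - w) = emb v - emb w := by
  ext i j : 1
  simp [emb]

theorem emb_blk (a b c d : Matrix (Fin n) (Fin n) B) :
    emb (blk a b c d) = blk (emb a) (emb b) (emb c) (emb d) := blk_map _ _ _ _ _

theorem isStarProjection_emb {p : Matrix (Fin n) (Fin n) B} (hp : IsStarProjection p) :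
    IsStarProjection (emb p) := by
  constructor
  · rw [IsIdempotentElem, ← emb_mul, hp.isIdempotentElem.eq]
  · rw [IsSelfAdjoint, ← emb_star, hp.isSelfAdjoint.star_eq]

/-- `M_N(B)` is an ideal of `M_N(B⁺)`, so the scalar parts of the product vanish and its second
components determine it. -/
theorem mul_emb_eq (z : Matrix (Fin n) (Fin n) (Unitization ℂ B)) (x : Matrix (Fin n) (Fin n) B) :
    z * emb x = emb ((z * emb x).map fun a => a.snd) := by
  ext i j : 1
  refine Unitization.ext ?_ ?_
  · rw [Matrix.mul_apply]
    have := map_sum (Unitization.fstHom ℂ B) (fun k => z i k * emb x k j) Finset.univ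
    simp only [Unitization.fstHom_apply] at this
    rw [this]
    simp [emb]
  · simp [emb]

/-- The entries of `z` lie in the unitization of `S`. -/
def EntriesIn (S : NonUnitalStarSubalgebra ℂ B)
    (z : Matrix (Fin n) (Fin n) (Unitization ℂ B)) : Prop :=
  ∀ i j, z i j ∈ {a : Unitization ℂ B | a.snd ∈ S}

variable {S : NonUnitalStarSubalgebra ℂ B}

theorem entriesIn_one : EntriesIn S (1 : Matrix (Fin n) (Fin n) (Unitization ℂ B)) := by
  intro i j
  by_cases h : i = j
  · subst h; simp
  · simp [Matrix.one_apply_ne h]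

theorem entriesIn_emb {v : Matrix (Fin n) (Fin n) B} (hv : ∀ i j, v i j ∈ S) :
    EntriesIn S (emb v) := fun i j => by simpa [emb] using hv i j

theorem EntriesIn.sub {z y : Matrix (Fin n) (Fin n) (Unitization ℂ B)} (hz : EntriesIn S z)
    (hy : EntriesIn S y) : EntriesIn S (z - y) := fun i j => by
  exact sub_mem (H := S) (hz i j) (hy i j)

theorem EntriesIn.star {z : Matrix (Fin n) (Fin n) (Unitization ℂ B)} (hz : EntriesIn S z) :
    EntriesIn S (star z) := fun i j => by
  exact star_mem (s := S) (hz j i)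

theorem entriesIn_blk {a b c d : Matrix (Fin n) (Fin n) (Unitization ℂ B)} (ha : EntriesIn S a)
    (hb : EntriesIn S b) (hc : EntriesIn S c) (hd : EntriesIn S d) : EntriesIn S (blk a b c d) :=
  blk_mem ha hb hc hd

theorem EntriesIn.mul_emb {z : Matrix (Fin n) (Fin n) (Unitization ℂ B)} (hz : EntriesIn S z)
    {x : Matrix (Fin n) (Fin n) B} (hx : ∀ i j, x i j ∈ S) :
    ∃ y : Matrix (Fin n) (Fin n) B, (∀ i j, y i j ∈ S) ∧ z * emb x = emb y := by
  refine ⟨_, fun i j => ?_, mul_emb_eq z x⟩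
  have := map_sum (Unitization.sndHom (S := ℂ) (R := ℂ) (A := B))
    (fun k => z i k * emb x k j) Finset.univ
  simp only [Unitization.sndHom_apply] at this
  rw [Matrix.map_apply, Matrix.mul_apply, this]
  refine sum_mem fun k _ => ?_
  simp only [emb, Matrix.map_apply, Unitization.snd_mul, Unitization.fst_inr, Unitization.snd_inr,
    zero_smul, add_zero]
  exact add_mem (SMulMemClass.smul_mem _ (hx _ _)) (mul_mem (hz i k) (hx _ _))

/-- `S` is an ideal of its unitization, which settles multiplication by `z` on the left;
multiplication by `z*` on the right follows by taking adjoints. -/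
theorem EntriesIn.conj_mem {z : Matrix (Fin n) (Fin n) (Unitization ℂ B)} (hz : EntriesIn S z)
    {x : Matrix (Fin n) (Fin n) (Unitization ℂ B)} (hx : x ∈ emb '' (S : Set B).matrix) :
    z * x * Star.star z ∈ emb '' (S : Set B).matrix := by
  obtain ⟨x, hx, rfl⟩ := hx
  obtain ⟨y, hy, hy'⟩ := hz.mul_emb hx
  obtain ⟨w, hw, hw'⟩ := hz.mul_emb (x := Star.star y) (fun i j => star_mem (hy j i))
  refine ⟨Star.star w, fun i j => star_mem (hw j i), ?_⟩
  rw [emb_star, ← hw', hy', star_mul, emb_star, star_star]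

/-- Unitaries with entries in the unitization of `C` normalise the matrices over `C`. -/
theorem EntriesIn.isNormalizingUnitary {z : Matrix (Fin n) (Fin n) (Unitization ℂ B)}
    (hz : EntriesIn S z) (hu : IsUnitaryMat z) : IsNormalizingUnitary S z := by
  refine ⟨hu, fun x hx => hz.conj_mem hx, fun x hx => ?_⟩
  simpa using hz.star.conj_mem hx

end Embedding

attribute [local instance] CStarAlgebra.spectralOrder CStarAlgebra.spectralOrderedRing

/-! ### Murray–von Neumann equivalence of matrices of different sizes -/

section MurrayVonNeumann

variable {B : Type u} [NonUnitalCStarAlgebra B] {l m n : ℕ}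

theorem Matrix.mul_star_mul_self {v : Matrix (Fin n) (Fin n) B}
    (hv : IsStarProjection (star v * v)) : v * star v * v = v :=
  mul_star_mul_self_of_isStarProjection (A := CStarMatrix (Fin n) (Fin n) B) hv

/-- Murray–von Neumann equivalence by a rectangular matrix with entries in `S`. -/
def MvN (S : NonUnitalStarSubalgebra ℂ B) (p : Matrix (Fin n) (Fin n) B)
    (q : Matrix (Fin m) (Fin m) B) : Prop :=
  ∃ v : Matrix (Fin m) (Fin n) B, (∀ i j, v i j ∈ S) ∧ v.conjTranspose * v = p ∧
    v * v.conjTranspose = q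

variable {S : NonUnitalStarSubalgebra ℂ B} {p : Matrix (Fin n) (Fin n) B}
  {q : Matrix (Fin m) (Fin m) B} {r : Matrix (Fin l) (Fin l) B}

theorem matrix_mul_mem {v : Matrix (Fin l) (Fin m) B} {w : Matrix (Fin m) (Fin n) B}
    (hv : ∀ i j, v i j ∈ S) (hw : ∀ i j, w i j ∈ S) (i : Fin l) (j : Fin n) :
    (v * w) i j ∈ S := by
  rw [Matrix.mul_apply]
  exact sum_mem fun k _ => mul_mem (hv _ _) (hw _ _)

theorem MvN.symm (h : MvN S p q) : MvN S q p := by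
  obtain ⟨v, hv, h1, h2⟩ := h
  exact ⟨v.conjTranspose, fun i j => star_mem (hv j i), by simpa using h2, by simpa using h1⟩

theorem MvN.mono {T : NonUnitalStarSubalgebra ℂ B} (hST : S ≤ T) (h : MvN S p q) : MvN T p q := by
  obtain ⟨v, hv, h⟩ := h
  exact ⟨v, fun i j => hST (hv i j), h⟩

theorem MvN.trans (hp : p * p = p) (hr : r * r = r) (h : MvN S p q) (h' : MvN S q r) :
    MvN S p r := by
  obtain ⟨v, hv, h1, h2⟩ := h
  obtain ⟨w, hw, h3, h4⟩ := h'
  refine ⟨w * v, matrix_mul_mem hw hv, ?_, ?_⟩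
  · rw [Matrix.conjTranspose_mul, Matrix.mul_assoc, ← Matrix.mul_assoc w.conjTranspose, h3, ← h2,
      Matrix.mul_assoc v, h1, ← Matrix.mul_assoc, h1, hp]
  · rw [Matrix.conjTranspose_mul, Matrix.mul_assoc, ← Matrix.mul_assoc v, h2, ← h3,
      Matrix.mul_assoc, h4, ← Matrix.mul_assoc, h4, hr]

theorem isStarProjection_pad (hp : IsStarProjection p) {N : ℕ} (hN : n ≤ N) :
    IsStarProjection (pad N p) := by
  constructor
  · rw [IsIdempotentElem, pad_mul hN, hp.isIdempotentElem.eq]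
  · rw [IsSelfAdjoint, star_pad, hp.isSelfAdjoint.star_eq]

theorem mvN_pad (hp : IsStarProjection p) (hpS : ∀ i j, p i j ∈ S) {N : ℕ} (hN : n ≤ N) :
    MvN S p (pad N p) := by
  have h1 : p.conjTranspose = p := hp.isSelfAdjoint
  have h2 : p * p = p := hp.isIdempotentElem
  refine ⟨rpad N n p, rpad_mem (zero_mem S) _ _ hpS, ?_, ?_⟩
  · rw [conjTranspose_rpad, rpad_mul hN, h1, h2, rpad_self]
  · rw [conjTranspose_rpad, rpad_mul le_rfl, h1, h2, pad_eq_rpad]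

theorem mvN_refl (hp : IsStarProjection p) (hpS : ∀ i j, p i j ∈ S) : MvN S p p :=
  ⟨p, hpS, by rw [← Matrix.star_eq_conjTranspose, hp.isSelfAdjoint.star_eq,
    hp.isIdempotentElem.eq], by rw [← Matrix.star_eq_conjTranspose, hp.isSelfAdjoint.star_eq,
    hp.isIdempotentElem.eq]⟩

/-- Murray–von Neumann equivalent projections are unitarily equivalent in a larger matrix algebra,
by a unitary with entries in the unitization of the same algebra. -/
theorem MvN.exists_unitary (hp : IsStarProjection p) (h : MvN S p q) :
    ∃ N : ℕ, n ≤ N ∧ m ≤ N ∧ ∃ z : Matrix (Fin N) (Fin N) (Unitization ℂ B),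
      IsUnitaryMat z ∧ EntriesIn S z ∧ z * emb (pad N p) * star z = emb (pad N q) := by
  obtain ⟨v, hv, h1, h2⟩ := h
  -- Size `N` makes the rectangular `v` square; doubling it leaves room for the unitary dilation.
  set N := max n m
  have hn : n ≤ N := le_max_left _ _
  have hm : m ≤ N := le_max_right _ _
  refine ⟨N + N, by omega, by omega, ?_⟩
  set V : Matrix (Fin N) (Fin N) B := rpad N N v with hV
  have hVS : ∀ i j, V i j ∈ S := rpad_mem (zero_mem S) _ _ hv
  have hVP : star V * V = pad N p := by
    rw [hV, Matrix.star_eq_conjTranspose, conjTranspose_rpad, rpad_mul hm, h1, pad_eq_rpad]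
  have hVQ : V * star V = pad N q := by
    rw [hV, Matrix.star_eq_conjTranspose, conjTranspose_rpad, rpad_mul hn, h2, pad_eq_rpad]
  have hVV : V * star V * V = V :=
    Matrix.mul_star_mul_self (by rw [hVP]; exact isStarProjection_pad hp hn)
  have hE : emb V * star (emb V) * emb V = emb V := by
    rw [← emb_star, ← emb_mul, ← emb_mul, hVV]
  have hEs : EntriesIn S (star (emb V)) := (entriesIn_emb hVS).star
  refine ⟨_, blk_dilation_mem_unitary hE, ?_, ?_⟩
  · refine entriesIn_blk (entriesIn_emb hVS) (entriesIn_one.sub ?_) (entriesIn_one.sub ?_) hEs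
    · rw [← emb_star, ← emb_mul]
      exact entriesIn_emb (matrix_mul_mem hVS fun i j => star_mem (hVS j i))
    · rw [← emb_star, ← emb_mul]
      exact entriesIn_emb (matrix_mul_mem (fun i j => star_mem (hVS j i)) hVS)
  · rw [← pad_pad hn, ← pad_pad hm, ← hVP, ← hVQ, pad_eq_blk, pad_eq_blk, emb_blk, emb_blk,
      star_blk, blk_mul, blk_mul]
    have hE' : emb V * (star (emb V) * emb V) = emb V := by rw [← mul_assoc, hE]
    simp only [emb_zero, emb_mul, emb_star, mul_zero, zero_mul, add_zero, star_sub, star_one,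
      star_mul, star_star, mul_sub, sub_mul, one_mul, mul_one, mul_assoc, hE', sub_self]

/-- Although `z` lives over the unitization, `z p` has entries in `B` and is the partial isometry
that is needed. -/
theorem mvN_of_unitary {N : ℕ} (hp : IsStarProjection p) (hq : IsStarProjection q) (hn : n ≤ N)
    (hm : m ≤ N) {z : Matrix (Fin N) (Fin N) (Unitization ℂ B)} (hz : IsUnitaryMat z)
    (h : z * emb (pad N p) * star z = emb (pad N q)) : MvN ⊤ p q := by
  have hP := isStarProjection_pad hp hn
  have hQ := isStarProjection_pad hq hm
  have htop : ∀ {a b : ℕ} (v : Matrix (Fin a) (Fin b) B) (i : Fin a) (j : Fin b),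
      v i j ∈ (⊤ : NonUnitalStarSubalgebra ℂ B) := fun _ _ _ => NonUnitalStarAlgebra.mem_top
  have hPe := isStarProjection_emb hP
  have hmid : MvN ⊤ (pad N p) (pad N q) := by
    refine ⟨(z * emb (pad N p)).map fun a => a.snd, htop _, ?_, ?_⟩
    · apply emb_injective
      rw [← Matrix.star_eq_conjTranspose, emb_mul, emb_star, ← mul_emb_eq, star_mul,
        hPe.isSelfAdjoint.star_eq, mul_assoc, ← mul_assoc (star z), (Unitary.mem_iff.1 hz).1,
        one_mul, hPe.isIdempotentElem.eq]
    · apply emb_injective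
      rw [← Matrix.star_eq_conjTranspose, emb_mul, emb_star, ← mul_emb_eq, star_mul,
        hPe.isSelfAdjoint.star_eq, mul_assoc, ← mul_assoc (emb _), hPe.isIdempotentElem.eq,
        ← mul_assoc, h]
  have h1 := MvN.trans hp.isIdempotentElem hQ.isIdempotentElem (mvN_pad hp (htop p) hn) hmid
  exact h1.trans hp.isIdempotentElem hq.isIdempotentElem (mvN_pad hq (htop q) hm).symm

/-- The block diagonal matrix with two given blocks. -/
def dsumMat (v : Matrix (Fin m) (Fin n) B) {m' n' : ℕ} (w : Matrix (Fin m') (Fin n') B) :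
    Matrix (Fin (m + m')) (Fin (n + n')) B :=
  Matrix.reindex finSumFinEquiv finSumFinEquiv (Matrix.fromBlocks v 0 0 w)

theorem dsumMat_mul {l' m' n' : ℕ} (v : Matrix (Fin l) (Fin m) B) (w : Matrix (Fin m) (Fin n) B)
    (v' : Matrix (Fin l') (Fin m') B) (w' : Matrix (Fin m') (Fin n') B) :
    dsumMat v v' * dsumMat w w' = dsumMat (v * w) (v' * w') := by
  simp only [dsumMat, Matrix.reindex_apply, Matrix.submatrix_mul_equiv,
    Matrix.fromBlocks_multiply, Matrix.mul_zero, Matrix.zero_mul, add_zero, zero_add]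

theorem conjTranspose_dsumMat {m' n' : ℕ} (v : Matrix (Fin m) (Fin n) B)
    (w : Matrix (Fin m') (Fin n') B) :
    (dsumMat v w).conjTranspose = dsumMat v.conjTranspose w.conjTranspose := by
  simp only [dsumMat, Matrix.conjTranspose_reindex, Matrix.fromBlocks_conjTranspose,
    Matrix.conjTranspose_zero]

theorem dsumMat_mem {m' n' : ℕ} {v : Matrix (Fin m) (Fin n) B} {w : Matrix (Fin m') (Fin n') B}
    (hv : ∀ i j, v i j ∈ S) (hw : ∀ i j, w i j ∈ S) (i : Fin (m + m')) (j : Fin (n + n')) :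
    dsumMat v w i j ∈ S := by
  simp only [dsumMat, Matrix.reindex_apply, Matrix.submatrix_apply]
  rcases finSumFinEquiv.symm i with i | i <;> rcases finSumFinEquiv.symm j with j | j
  · exact hv _ _
  · exact zero_mem S
  · exact zero_mem S
  · exact hw _ _

theorem isStarProjection_dsumMat {n' : ℕ} {p' : Matrix (Fin n') (Fin n') B}
    (hp : IsStarProjection p) (hp' : IsStarProjection p') : IsStarProjection (dsumMat p p') := by
  constructor
  · rw [IsIdempotentElem, dsumMat_mul, hp.isIdempotentElem.eq, hp'.isIdempotentElem.eq]
  · rw [IsSelfAdjoint, Matrix.star_eq_conjTranspose, conjTranspose_dsumMat,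
      ← Matrix.star_eq_conjTranspose, ← Matrix.star_eq_conjTranspose, hp.isSelfAdjoint.star_eq,
      hp'.isSelfAdjoint.star_eq]

/-- Direct sums of Murray–von Neumann equivalent matrices are equivalent. -/
theorem MvN.dsum {n' m' : ℕ} {p' : Matrix (Fin n') (Fin n') B} {q' : Matrix (Fin m') (Fin m') B}
    (h : MvN S p q) (h' : MvN S p' q') :
    MvN S (dsumMat p p') (dsumMat q q') := by
  obtain ⟨v, hv, h1, h2⟩ := h
  obtain ⟨w, hw, h3, h4⟩ := h'
  refine ⟨dsumMat v w, dsumMat_mem hv hw, ?_, ?_⟩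
  · rw [conjTranspose_dsumMat, dsumMat_mul, h1, h3]
  · rw [conjTranspose_dsumMat, dsumMat_mul, h2, h4]

/-- The sum of two orthogonal projections is equivalent to their direct sum. -/
theorem mvN_add_dsum {p' : Matrix (Fin n) (Fin n) B} (hp : IsStarProjection p)
    (hp' : IsStarProjection p') (hpS : ∀ i j, p i j ∈ S) (hpS' : ∀ i j, p' i j ∈ S)
    (h : p * p' = 0) : MvN S (p + p') (dsumMat p p') := by
  have h1 : p.conjTranspose = p := hp.isSelfAdjoint
  have h2 : p * p = p := hp.isIdempotentElem
  have h3 : p'.conjTranspose = p' := hp'.isSelfAdjoint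
  have h4 : p' * p' = p' := hp'.isIdempotentElem
  have h5 : p' * p = 0 := by
    have := congrArg Matrix.conjTranspose h
    simpa [h1, h3] using this
  have hadd : IsStarProjection (p + p') := hp.add hp' h
  have h6 : MvN S (pad (n + n) (p + p')) (dsumMat p p') := by
    -- The column with entries `p` and `p'`: one product with its adjoint is `p + p'` in the corner,
    -- the other has off-diagonal blocks `p p'` and `p' p`, both zero.
    refine ⟨blk p 0 p' 0, blk_mem (S := (S : Set B)) hpS (fun _ _ => zero_mem S) hpS'
      (fun _ _ => zero_mem S), ?_, ?_⟩
    · rw [← Matrix.star_eq_conjTranspose, star_blk, blk_mul, pad_eq_blk]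
      simp only [Matrix.star_eq_conjTranspose, h1, h2, h3, h4, star_zero, mul_zero, zero_mul,
        add_zero]
    · rw [← Matrix.star_eq_conjTranspose, star_blk, blk_mul]
      simp only [Matrix.star_eq_conjTranspose, h1, h2, h3, h4, h, h5, star_zero, mul_zero, add_zero]
      rfl
  exact (mvN_pad hadd (fun i j => add_mem (hpS i j) (hpS' i j)) (by omega)).trans
    hadd.isIdempotentElem (isStarProjection_dsumMat hp hp').isIdempotentElem h6

end MurrayVonNeumann

/-! ### Matrix units, the algebras they span, and refinement -/

namespace MatrixUnits

variable {B : Type u} [NonUnitalCStarAlgebra B] (E : MatrixUnits B)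

/-- The index set of the diagonal matrix units. -/
abbrev Idx : Type := Σ s : Fin E.r, Fin (E.d s)

/-- The diagonal matrix units. -/
def dg (a : E.Idx) : B := E.e a.1 a.2 a.2

theorem dg_mem_diagUnits (a : E.Idx) : E.dg a ∈ E.diagUnits := ⟨a.1, a.2, rfl⟩

theorem diagUnits_subset : E.diagUnits ⊆ E.units := by
  rintro _ ⟨s, i, rfl⟩
  exact ⟨s, i, i, rfl⟩

theorem dg_mem_units (a : E.Idx) : E.dg a ∈ E.units := E.diagUnits_subset (E.dg_mem_diagUnits a)

theorem star_dg (a : E.Idx) : star (E.dg a) = E.dg a := E.star_e _ _ _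

theorem dg_ne_zero (a : E.Idx) : E.dg a ≠ 0 := E.ne_zero _ _ _

theorem dg_mul_self (a : E.Idx) : E.dg a * E.dg a = E.dg a := E.mul_same _ _ _ _

theorem dg_mul_ne {a b : E.Idx} (h : a ≠ b) : E.dg a * E.dg b = 0 := by
  obtain ⟨s, i⟩ := a
  obtain ⟨t, j⟩ := b
  by_cases hst : s = t
  · subst hst
    exact E.mul_index_ne _ _ _ _ _ (fun hij : i = j => h (by rw [hij]))
  · exact E.mul_block_ne _ _ _ _ _ _ hst

theorem isStarProjection_dg (a : E.Idx) : IsStarProjection (E.dg a) :=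
  ⟨E.dg_mul_self a, E.star_dg a⟩

theorem e_mul_dg (s : Fin E.r) (i j : Fin (E.d s)) (a : E.Idx) :
    E.e s i j * E.dg a = if (⟨s, j⟩ : E.Idx) = a then E.e s i j else 0 := by
  split_ifs with h
  · subst h; exact E.mul_same _ _ _ _
  · obtain ⟨t, k⟩ := a
    by_cases hst : s = t
    · subst hst
      exact E.mul_index_ne _ _ _ _ _ (fun hij => h (by rw [hij]))
    · exact E.mul_block_ne _ _ _ _ _ _ hst

/-- The unit of the algebra spanned by the matrix units. -/
def one : B := ∑ a : E.Idx, E.dg a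

theorem star_one : star E.one = E.one := by
  simp [one, star_sum, star_dg]

theorem mul_one_of_mem_units {b : B} (hb : b ∈ E.units) : b * E.one = b := by
  obtain ⟨s, i, j, rfl⟩ := hb
  simp [one, Finset.mul_sum, e_mul_dg]

theorem star_mem_units {b : B} (hb : b ∈ E.units) : star b ∈ E.units := by
  obtain ⟨s, i, j, rfl⟩ := hb
  exact ⟨s, j, i, E.star_e _ _ _⟩

theorem mul_mem_units {b c : B} (hb : b ∈ E.units) (hc : c ∈ E.units) :
    b * c = 0 ∨ b * c ∈ E.units := by
  obtain ⟨s, i, j, rfl⟩ := hb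
  obtain ⟨t, k, l, rfl⟩ := hc
  by_cases hst : s = t
  · subst hst
    by_cases hjk : j = k
    · subst hjk
      exact Or.inr ⟨s, i, l, E.mul_same _ _ _ _⟩
    · exact Or.inl (E.mul_index_ne _ _ _ _ _ hjk)
  · exact Or.inl (E.mul_block_ne _ _ _ _ _ _ hst)

/-- The finite-dimensional algebra spanned by the matrix units. -/
def alg : NonUnitalStarSubalgebra ℂ B where
  carrier := Submodule.span ℂ E.units
  add_mem' := fun ha hb => Submodule.add_mem _ ha hb
  zero_mem' := Submodule.zero_mem _
  smul_mem' := fun c _ hx => Submodule.smul_mem _ c hx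
  mul_mem' := by
    intro a b ha hb
    induction ha using Submodule.span_induction with
    | mem x hx =>
      induction hb using Submodule.span_induction with
      | mem y hy =>
        rcases E.mul_mem_units hx hy with h | h
        · rw [h]; exact Submodule.zero_mem _
        · exact Submodule.subset_span h
      | zero => rw [mul_zero]; exact Submodule.zero_mem _
      | add y z _ _ hy hz => rw [mul_add]; exact Submodule.add_mem _ hy hz
      | smul c y _ hy => rw [mul_smul_comm]; exact Submodule.smul_mem _ _ hy
    | zero => rw [zero_mul]; exact Submodule.zero_mem _
    | add y z _ _ hy hz => rw [add_mul]; exact Submodule.add_mem _ hy hz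
    | smul c y _ hy => rw [smul_mul_assoc]; exact Submodule.smul_mem _ _ hy
  star_mem' := by
    intro a ha
    induction ha using Submodule.span_induction with
    | mem x hx => exact Submodule.subset_span (E.star_mem_units hx)
    | zero => rw [star_zero]; exact Submodule.zero_mem _
    | add y z _ _ hy hz => rw [star_add]; exact Submodule.add_mem _ hy hz
    | smul c y _ hy => rw [star_smul]; exact Submodule.smul_mem _ _ hy

theorem coe_alg : (E.alg : Set B) = Submodule.span ℂ E.units := rfl

theorem units_mem_alg {b : B} (hb : b ∈ E.units) : b ∈ E.alg := Submodule.subset_span hb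

theorem finite_units : E.units.Finite := by
  have : E.units = Set.range fun x : (Σ s : Fin E.r, Fin (E.d s) × Fin (E.d s)) =>
      E.e x.1 x.2.1 x.2.2 := by
    ext b
    constructor
    · rintro ⟨s, i, j, rfl⟩; exact ⟨⟨s, i, j⟩, rfl⟩
    · rintro ⟨⟨s, i, j⟩, rfl⟩; exact ⟨s, i, j, rfl⟩
  rw [this]
  exact Set.finite_range _

instance finiteDimensional_span : FiniteDimensional ℂ (Submodule.span ℂ E.units) :=
  FiniteDimensional.span_of_finite ℂ E.finite_units

theorem isClosed_alg : IsClosed (E.alg : Set B) :=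
  Submodule.closed_of_finiteDimensional (Submodule.span ℂ E.units)

theorem one_mem_alg : E.one ∈ E.alg := sum_mem fun a _ => E.units_mem_alg (E.dg_mem_units a)

theorem alg_mul_one {b : B} (hb : b ∈ E.alg) : b * E.one = b := by
  change b ∈ Submodule.span ℂ E.units at hb
  induction hb using Submodule.span_induction with
  | mem x hx => exact E.mul_one_of_mem_units hx
  | zero => rw [zero_mul]
  | add y z _ _ hy hz => rw [add_mul, hy, hz]
  | smul c y _ hy => rw [smul_mul_assoc, hy]

theorem one_mul_alg {b : B} (hb : b ∈ E.alg) : E.one * b = b := by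
  have := congrArg star (E.alg_mul_one (star_mem hb))
  simpa [E.star_one] using this

theorem isStarProjection_one : IsStarProjection E.one :=
  ⟨E.alg_mul_one E.one_mem_alg, E.star_one⟩

/-- The coefficients of an element of the spanned algebra. -/
theorem exists_coeff {x : B} (hx : x ∈ E.alg) (s : Fin E.r) :
    ∃ c : Fin (E.d s) → Fin (E.d s) → ℂ, ∀ j l, x * E.e s j l = ∑ i, c i j • E.e s i l := by
  change x ∈ Submodule.span ℂ E.units at hx
  induction hx using Submodule.span_induction with
  | mem x hx =>
    obtain ⟨t, a, b, rfl⟩ := hx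
    by_cases hts : t = s
    · subst hts
      refine ⟨fun i j => if i = a ∧ b = j then 1 else 0, fun j l => ?_⟩
      by_cases hbj : b = j
      · subst hbj
        simp [E.mul_same]
      · simp [hbj, E.mul_index_ne _ _ _ _ _ hbj]
    · exact ⟨0, fun j l => by simp [E.mul_block_ne _ _ _ _ _ _ hts]⟩
  | zero => exact ⟨0, fun j l => by simp⟩
  | add y z _ _ hy hz =>
    obtain ⟨c, hc⟩ := hy
    obtain ⟨c', hc'⟩ := hz
    refine ⟨c + c', fun j l => ?_⟩
    simp [add_mul, hc, hc', add_smul, Finset.sum_add_distrib]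
  | smul r y _ hy =>
    obtain ⟨c, hc⟩ := hy
    refine ⟨r • c, fun j l => ?_⟩
    simp [smul_mul_assoc, hc, Finset.smul_sum, mul_smul]

theorem exists_smul_of_mem_alg {x : B} (hx : x ∈ E.alg) (s : Fin E.r) (i j : Fin (E.d s)) :
    ∃ c : ℂ, E.e s i i * x * E.e s j j = c • E.e s i j := by
  obtain ⟨c, hc⟩ := E.exists_coeff hx s
  refine ⟨c i j, ?_⟩
  rw [mul_assoc, hc, Finset.mul_sum, Finset.sum_eq_single i]
  · rw [mul_smul_comm, E.mul_same]
  · intro k _ hk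
    rw [mul_smul_comm, E.mul_index_ne _ _ _ _ _ (Ne.symm hk), smul_zero]
  · simp

theorem mul_mul_eq_zero_of_ne {x : B} (hx : x ∈ E.alg) {s t : Fin E.r} (hst : s ≠ t)
    (i k : Fin (E.d s)) (j l : Fin (E.d t)) : E.e s i k * x * E.e t j l = 0 := by
  obtain ⟨c, hc⟩ := E.exists_coeff hx t
  rw [mul_assoc, hc, Finset.mul_sum]
  exact Finset.sum_eq_zero fun k _ => by
    rw [mul_smul_comm, E.mul_block_ne _ _ _ _ _ _ hst, smul_zero]

/-- The diagonal matrix units, as a system of matrix units with blocks of size one. -/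
noncomputable def diag : MatrixUnits B where
  r := Fintype.card E.Idx
  d := fun _ => 1
  e := fun s _ _ => E.dg ((Fintype.equivFin E.Idx).symm s)
  ne_zero := fun _ _ _ => E.dg_ne_zero _
  star_e := fun _ _ _ => E.star_dg _
  mul_same := fun _ _ _ _ => E.dg_mul_self _
  mul_index_ne := fun _ _ j k _ h => (h (Subsingleton.elim j k)).elim
  mul_block_ne := fun _ _ _ _ _ _ h => E.dg_mul_ne fun h' => h ((Equiv.injective _) h')

theorem units_diag : E.diag.units = E.diagUnits := by
  ext b
  constructor
  · rintro ⟨s, i, j, rfl⟩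
    exact E.dg_mem_diagUnits _
  · rintro ⟨s, i, rfl⟩
    refine ⟨Fintype.equivFin E.Idx ⟨s, i⟩, (0 : Fin 1), (0 : Fin 1), ?_⟩
    change E.dg ⟨s, i⟩ = E.dg ((Fintype.equivFin E.Idx).symm (Fintype.equivFin E.Idx ⟨s, i⟩))
    rw [Equiv.symm_apply_apply]

theorem coe_alg_diag : (E.diag.alg : Set B) = Submodule.span ℂ E.diagUnits := by
  rw [coe_alg, units_diag]

theorem alg_diag_le : E.diag.alg ≤ E.alg := by
  intro b hb
  have hb' : b ∈ (E.diag.alg : Set B) := hb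
  rw [coe_alg_diag] at hb'
  exact Submodule.span_mono E.diagUnits_subset hb'

theorem dg_mem_alg_diag (a : E.Idx) : E.dg a ∈ E.diag.alg := by
  have : E.dg a ∈ (E.diag.alg : Set B) := by
    rw [coe_alg_diag]
    exact Submodule.subset_span (E.dg_mem_diagUnits a)
  exact this

/-- The matrix units of `E` are sums of those of `E'`, and multiplied by diagonal matrix units of
`E'` they become matrix units of `E'`. -/
structure Refines (E E' : MatrixUnits B) : Prop where
  mem_alg : ∀ b ∈ E.units, b ∈ E'.alg
  mul_dg : ∀ b ∈ E.units, ∀ a, b * E'.dg a = 0 ∨ b * E'.dg a ∈ E'.units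

theorem norm_le_one_of_mem_units {b : B} (hb : b ∈ E.units) : ‖b‖ ≤ 1 := by
  obtain ⟨s, i, j, rfl⟩ := hb
  have h1 : ‖star (E.e s i j) * E.e s i j‖ = ‖E.e s i j‖ * ‖E.e s i j‖ :=
    CStarRing.norm_star_mul_self
  rw [E.star_e, E.mul_same] at h1
  have h2 : ‖E.e s j j‖ ≤ 1 := (E.isStarProjection_dg ⟨s, j⟩).norm_le
  nlinarith [norm_nonneg (E.e s i j)]

theorem norm_dg (a : E.Idx) : ‖E.dg a‖ = 1 := by
  have h1 : ‖star (E.dg a) * E.dg a‖ = ‖E.dg a‖ * ‖E.dg a‖ := CStarRing.norm_star_mul_self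
  rw [E.star_dg, E.dg_mul_self] at h1
  have h2 : ‖E.dg a‖ ≠ 0 := norm_ne_zero_iff.2 (E.dg_ne_zero a)
  exact (mul_left_cancel₀ h2 (by rw [mul_one]; exact h1)).symm

/-- Only the summands in the column of `a` survive. If there are `c` of them, then `(b dg a)* (b dg
a) = c • dg a`, so the norm bound forces `c ≤ 1`. This turns the hypothesis about sums into the
statement that coarse units permute fine ones, from which they normalise the diagonal. -/
theorem sum_mul_dg_mem {b : B} (hb : ‖b‖ ≤ 1) {F : Finset B} (hF : (F : Set B) ⊆ E.units)
    (hbF : b = ∑ f ∈ F, f) (a : E.Idx) : b * E.dg a = 0 ∨ b * E.dg a ∈ E.units := by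
  classical
  set F' := F.filter fun f => f * E.dg a = f with hF'
  have h1 : b * E.dg a = ∑ f ∈ F', f := by
    rw [hbF, Finset.sum_mul, hF', Finset.sum_filter]
    refine Finset.sum_congr rfl fun f hf => ?_
    split_ifs with h
    · exact h
    · obtain ⟨s, i, j, rfl⟩ := hF hf
      rw [E.e_mul_dg] at h ⊢
      by_cases hja : (⟨s, j⟩ : E.Idx) = a
      · rw [if_pos hja] at h; exact (h rfl).elim
      · rw [if_neg hja]
  have h2 : ∀ f ∈ F', ∀ g ∈ F', star f * g = if f = g then E.dg a else 0 := by
    intro f hf g hg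
    rw [hF', Finset.mem_filter] at hf hg
    obtain ⟨hf, hf'⟩ := hf
    obtain ⟨hg, hg'⟩ := hg
    obtain ⟨s, i, j, rfl⟩ := hF hf
    obtain ⟨t, k, l, rfl⟩ := hF hg
    rw [E.e_mul_dg] at hf' hg'
    have ha : (⟨s, j⟩ : E.Idx) = a := by
      by_contra h
      rw [if_neg h] at hf'
      exact E.ne_zero _ _ _ hf'.symm
    have ha' : (⟨t, l⟩ : E.Idx) = a := by
      by_contra h
      rw [if_neg h] at hg'
      exact E.ne_zero _ _ _ hg'.symm
    subst ha
    obtain ⟨rfl, hlj⟩ := Sigma.mk.inj_iff.1 ha'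
    obtain rfl := eq_of_heq hlj
    rw [E.star_e]
    by_cases hik : i = k
    · subst hik
      rw [if_pos rfl, E.mul_same]; rfl
    · rw [E.mul_index_ne _ _ _ _ _ hik, if_neg]
      intro h
      have h3 := congrArg (fun y => E.e t i i * y) h
      simp only [E.mul_same, E.mul_index_ne _ _ _ _ _ hik] at h3
      exact E.ne_zero _ _ _ h3
  have h3 : star (b * E.dg a) * (b * E.dg a) = (F'.card : ℂ) • E.dg a := by
    rw [h1, star_sum, Finset.sum_mul_sum]
    have : ∀ f ∈ F', ∑ g ∈ F', star f * g = E.dg a := by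
      intro f hf
      rw [Finset.sum_congr rfl (h2 f hf)]
      simp [hf]
    rw [Finset.sum_congr rfl this, Finset.sum_const, ← Nat.cast_smul_eq_nsmul ℂ]
  have h4 : (F'.card : ℝ) ≤ 1 := by
    have h5 : ‖star (b * E.dg a) * (b * E.dg a)‖ = ‖b * E.dg a‖ * ‖b * E.dg a‖ :=
      CStarRing.norm_star_mul_self
    rw [h3, norm_smul, E.norm_dg, mul_one] at h5
    have h6 : ‖b * E.dg a‖ ≤ 1 := by
      refine (norm_mul_le _ _).trans ?_
      rw [E.norm_dg, mul_one]
      exact hb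
    have h7 : ‖(F'.card : ℂ)‖ = F'.card := by simp
    rw [h7] at h5
    nlinarith [norm_nonneg (b * E.dg a)]
  have h5 : F'.card ≤ 1 := by exact_mod_cast h4
  rw [h1]
  rcases Nat.le_one_iff_eq_zero_or_eq_one.1 h5 with h6 | h6
  · left
    rw [Finset.card_eq_zero.1 h6, Finset.sum_empty]
  · right
    obtain ⟨f, hf⟩ := Finset.card_eq_one.1 h6
    rw [hf, Finset.sum_singleton]
    have hfF : f ∈ F' := by rw [hf]; exact Finset.mem_singleton_self f
    exact hF (Finset.mem_filter.1 hfF).1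

variable {E} {E' E'' : MatrixUnits B}

theorem refines_of_forall_eq_sum
    (h : ∀ b ∈ E.units, ∃ F : Finset B, (F : Set B) ⊆ E'.units ∧ b = ∑ f ∈ F, f) :
    Refines E E' where
  mem_alg := by
    intro b hb
    obtain ⟨F, hF, rfl⟩ := h b hb
    exact sum_mem fun f hf => E'.units_mem_alg (hF hf)
  mul_dg := by
    intro b hb a
    obtain ⟨F, hF, hbF⟩ := h b hb
    exact E'.sum_mul_dg_mem (E.norm_le_one_of_mem_units hb) hF hbF a

theorem Refines.refl : Refines E E where
  mem_alg := fun _ hb => E.units_mem_alg hb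
  mul_dg := fun _ hb a => E.mul_mem_units hb (E.dg_mem_units a)

/-- A nonzero product `x` is a fine matrix unit ending in column `b`. As `dg a` is a projection, `x*
x = dg b * x`; the left side is `dg b ≠ 0`, whereas the right side vanishes if `x` is off the
diagonal. -/
theorem Refines.dg_mul_dg (h : Refines E E') (a : E.Idx) (b : E'.Idx) :
    E.dg a * E'.dg b = 0 ∨ E.dg a * E'.dg b = E'.dg b := by
  rcases h.mul_dg _ (E.dg_mem_units a) b with h1 | ⟨s, i, j, h1⟩
  · exact Or.inl h1
  · right
    have h2 : E.dg a * E'.dg b * E'.dg b = E.dg a * E'.dg b := by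
      rw [mul_assoc, E'.dg_mul_self]
    rw [h1, E'.e_mul_dg] at h2
    have h3 : (⟨s, j⟩ : E'.Idx) = b := by
      by_contra h3
      rw [if_neg h3] at h2
      exact E'.ne_zero _ _ _ h2.symm
    subst h3
    have h4 : star (E.dg a * E'.dg ⟨s, j⟩) * (E.dg a * E'.dg ⟨s, j⟩)
        = E'.dg ⟨s, j⟩ * (E.dg a * E'.dg ⟨s, j⟩) := by
      rw [star_mul, E.star_dg, E'.star_dg, mul_assoc, ← mul_assoc (E.dg a), E.dg_mul_self]
    rw [h1, E'.star_e, E'.mul_same] at h4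
    by_cases hij : j = i
    · rw [h1, ← hij]; rfl
    · exfalso
      have h5 : E'.dg ⟨s, j⟩ * E'.e s i j = 0 := E'.mul_index_ne _ _ _ _ _ hij
      rw [h5] at h4
      exact E'.ne_zero _ _ _ h4

theorem Refines.commute_dg (h : Refines E E') (a : E.Idx) (b : E'.Idx) :
    E.dg a * E'.dg b = E'.dg b * E.dg a := by
  have h1 : star (E.dg a * E'.dg b) = E'.dg b * E.dg a := by
    rw [star_mul, E.star_dg, E'.star_dg]
  rw [← h1]
  rcases h.dg_mul_dg a b with h2 | h2
  · rw [h2, star_zero]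
  · rw [h2, E'.star_dg]

theorem Refines.alg_le (h : Refines E E') : E.alg ≤ E'.alg := by
  intro b hb
  exact (Submodule.span_le (p := Submodule.span ℂ E'.units)).2 (fun x hx => h.mem_alg x hx) hb

theorem Refines.dg_mem (h : Refines E E') (a : E.Idx) : E.dg a ∈ E'.diag.alg := by
  have h1 : E.dg a = ∑ b : E'.Idx, E.dg a * E'.dg b := by
    rw [← Finset.mul_sum]
    exact (E'.alg_mul_one (h.mem_alg _ (E.dg_mem_units a))).symm
  rw [h1]
  refine sum_mem fun b _ => ?_
  rcases h.dg_mul_dg a b with h2 | h2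
  · rw [h2]; exact zero_mem _
  · rw [h2]; exact E'.dg_mem_alg_diag b

theorem Refines.alg_diag_le (h : Refines E E') : E.diag.alg ≤ E'.diag.alg := by
  intro b hb
  refine (Submodule.span_le (p := Submodule.span ℂ E'.diag.units)).2 (fun x hx => ?_) hb
  rw [units_diag] at hx
  obtain ⟨s, i, rfl⟩ := hx
  exact h.dg_mem ⟨s, i⟩

theorem Refines.trans (h : Refines E E') (h' : Refines E' E'') : Refines E E'' where
  mem_alg := fun b hb => h'.alg_le (h.mem_alg b hb)
  mul_dg := by
    intro b hb a
    have h1 : E'.one * E''.dg a = ∑ y : E'.Idx, E'.dg y * E''.dg a := Finset.sum_mul _ _ _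
    have h2 : b * E''.dg a = b * (E'.one * E''.dg a) := by
      rw [← mul_assoc, E'.alg_mul_one (h.mem_alg b hb)]
    -- Either a diagonal unit of the middle level lies above `dg a`, and `b * dg a` factors through
    -- `b * dg y`, or the middle unit annihilates `dg a`, and then so does `b`.
    by_cases hy : ∃ y : E'.Idx, E'.dg y * E''.dg a = E''.dg a
    · obtain ⟨y, hy⟩ := hy
      rw [← hy, ← mul_assoc]
      rcases h.mul_dg b hb y with h3 | h3
      · left; rw [h3, zero_mul]
      · exact h'.mul_dg _ h3 a
    · left
      push Not at hy
      rw [h2, h1, Finset.sum_eq_zero, mul_zero]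
      intro y _
      exact (h'.dg_mul_dg y a).resolve_right (hy y)

theorem Refines.conj_dg_mem (h : Refines E E') {b : B} (hb : b ∈ E.units) (a : E'.Idx) :
    b * E'.dg a * star b ∈ E'.diag.alg := by
  have h1 : b * E'.dg a * star b = (b * E'.dg a) * star (b * E'.dg a) := by
    rw [star_mul, E'.star_dg, mul_assoc, mul_assoc, ← mul_assoc (E'.dg a), E'.dg_mul_self]
  rw [h1]
  rcases h.mul_dg b hb a with h2 | ⟨s, i, j, h2⟩
  · rw [h2, zero_mul]; exact zero_mem _
  · rw [h2, E'.star_e, E'.mul_same]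
    exact E'.dg_mem_alg_diag ⟨s, i⟩

theorem Refines.conj_mem (h : Refines E E') {b x : B} (hb : b ∈ E.units)
    (hx : x ∈ E'.diag.alg) : b * x * star b ∈ E'.diag.alg := by
  change x ∈ Submodule.span ℂ E'.diag.units at hx
  rw [units_diag] at hx
  induction hx using Submodule.span_induction with
  | mem x hx =>
    obtain ⟨s, i, rfl⟩ := hx
    exact h.conj_dg_mem hb ⟨s, i⟩
  | zero => rw [mul_zero, zero_mul]; exact zero_mem _
  | add y z _ _ hy hz => rw [mul_add, add_mul]; exact add_mem hy hz
  | smul c y _ hy => rw [mul_smul_comm, smul_mul_assoc]; exact SMulMemClass.smul_mem _ hy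

end MatrixUnits

/-! ### Approximation of matrices and projections by those of a finite level -/

section Approximation

variable {B : Type u} [NonUnitalCStarAlgebra B] {n : ℕ}

/-- Matrices whose entries lie in the closure of an increasing union are approximated in norm. -/
theorem exists_matrix_approx {T : ℕ → NonUnitalStarSubalgebra ℂ B} (hT : Monotone T)
    (v : Matrix (Fin n) (Fin n) B) (hv : ∀ i j, v i j ∈ closure (⋃ k, (T k : Set B))) {ε : ℝ}
    (hε : 0 < ε) :
    ∃ k, ∃ w : Matrix (Fin n) (Fin n) B, (∀ i j, w i j ∈ T k) ∧
      ‖CStarMatrix.ofMatrix (v - w)‖ < ε := by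
  have hmem : v ∈ closure {w : Matrix (Fin n) (Fin n) B | ∀ i j, w i j ∈ ⋃ k, (T k : Set B)} := by
    have h1 : {w : Fin n → Fin n → B | ∀ i j, w i j ∈ ⋃ k, (T k : Set B)} =
        Set.univ.pi fun _ : Fin n => Set.univ.pi fun _ : Fin n => ⋃ k, (T k : Set B) := by
      ext w; simp [Set.mem_pi]
    have h2 : (v : Fin n → Fin n → B) ∈
        closure {w : Fin n → Fin n → B | ∀ i j, w i j ∈ ⋃ k, (T k : Set B)} := by
      rw [h1, closure_pi_set]
      simp only [closure_pi_set]
      intro i _ j _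
      exact hv i j
    exact h2
  -- The C*-norm induces the product topology on matrices, so entrywise density becomes norm
  -- density.
  have hcont : Continuous fun w : Matrix (Fin n) (Fin n) B => ‖CStarMatrix.ofMatrix (v - w)‖ := by
    have h1 : Continuous (CStarMatrix.ofMatrixL (m := Fin n) (n := Fin n) (A := B)) :=
      ContinuousLinearEquiv.continuous _
    have h2 : Continuous fun w : Matrix (Fin n) (Fin n) B => CStarMatrix.ofMatrixL (v - w) :=
      h1.comp (continuous_const.sub continuous_id)
    exact h2.norm
  have hopen : IsOpen {w : Matrix (Fin n) (Fin n) B | ‖CStarMatrix.ofMatrix (v - w)‖ < ε} :=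
    isOpen_lt hcont continuous_const
  obtain ⟨w, hw1, hw2⟩ := mem_closure_iff.1 hmem _ hopen (by
    change ‖CStarMatrix.ofMatrix (v - v)‖ < ε
    rw [sub_self, CStarMatrix.of_zero, norm_zero]
    exact hε)
  have hk : ∀ i j, ∃ k, w i j ∈ T k := fun i j => by simpa using hw2 i j
  choose k hk using hk
  refine ⟨Finset.univ.sup fun x : Fin n × Fin n => k x.1 x.2, w, fun i j => ?_, hw1⟩
  exact hT (Finset.le_sup (f := fun x : Fin n × Fin n => k x.1 x.2) (Finset.mem_univ (i, j)))
    (hk i j)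

/-- Matrices with entries in a star subalgebra. -/
def matrixSubalgebra (T : NonUnitalStarSubalgebra ℂ B) (n : ℕ) :
    NonUnitalStarSubalgebra ℂ (CStarMatrix (Fin n) (Fin n) B) where
  carrier := {w | ∀ i j, w i j ∈ T}
  add_mem' := fun ha hb i j => add_mem (ha i j) (hb i j)
  zero_mem' := fun _ _ => zero_mem T
  smul_mem' := fun _ _ hx i j => SMulMemClass.smul_mem _ (hx i j)
  mul_mem' := fun ha hb => matrix_mul_mem ha hb
  star_mem' := fun ha i j => star_mem (s := T) (ha j i)

theorem isClosed_matrixSubalgebra {T : NonUnitalStarSubalgebra ℂ B} (hT : IsClosed (T : Set B))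
    (n : ℕ) : IsClosed (matrixSubalgebra T n : Set (CStarMatrix (Fin n) (Fin n) B)) := by
  have h1 : (matrixSubalgebra T n : Set (CStarMatrix (Fin n) (Fin n) B)) =
      ⋂ i, ⋂ j, {w | w i j ∈ T} := by
    ext w
    simp only [Set.mem_iInter]
    exact Iff.rfl
  rw [h1]
  refine isClosed_iInter fun i => isClosed_iInter fun j => ?_
  have h2 : Continuous fun w : CStarMatrix (Fin n) (Fin n) B => w i j := by
    have h3 : Continuous fun w : CStarMatrix (Fin n) (Fin n) B => w i := continuous_apply i
    exact (continuous_apply j).comp h3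
  exact hT.preimage h2

/-- A projection over an inductive limit of closed subalgebras is Murray–von Neumann equivalent to
one over a member of the sequence, when the limit is the whole algebra. -/
theorem exists_mvN_of_dense {T : ℕ → NonUnitalStarSubalgebra ℂ B} (hT : Monotone T)
    (hc : ∀ k, IsClosed (T k : Set B)) (hd : closure (⋃ k, (T k : Set B)) = Set.univ)
    {p : Matrix (Fin n) (Fin n) B} (hp : IsStarProjection p) :
    ∃ k, ∃ e : Matrix (Fin n) (Fin n) B, IsStarProjection e ∧ (∀ i j, e i j ∈ T k) ∧
      MvN ⊤ p e := by
  obtain ⟨k, x, hx, hpx⟩ := exists_matrix_approx hT p (fun i j => by rw [hd]; trivial)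
    (ε := 1 / 32) (by norm_num)
  obtain ⟨e, he, hep, hpe⟩ := exists_projection_mem_of_norm_sub_lt
    (A := CStarMatrix (Fin n) (Fin n) B) (matrixSubalgebra (T k) n)
    (isClosed_matrixSubalgebra (hc k) n) (p := CStarMatrix.ofMatrix p)
    (x := CStarMatrix.ofMatrix x) hp hx hpx
  obtain ⟨v, hv1, hv2⟩ := exists_partialIsometry_of_norm_sub_lt_one
    (A := CStarMatrix (Fin n) (Fin n) B) (p := CStarMatrix.ofMatrix p) hp hep hpe
  exact ⟨k, e, hep, he, v, fun _ _ => NonUnitalStarAlgebra.mem_top, hv1, hv2⟩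

/-- The version of `exists_mvN_of_dense` for a closed subalgebra. -/
theorem exists_mvN_of_closure {S : NonUnitalStarSubalgebra ℂ B}
    {T : ℕ → NonUnitalStarSubalgebra ℂ B} (hT : Monotone T)
    (hc : ∀ k, IsClosed (T k : Set B)) (hd : (S : Set B) = closure (⋃ k, (T k : Set B)))
    {p : Matrix (Fin n) (Fin n) B} (hp : IsStarProjection p) (hpS : ∀ i j, p i j ∈ S) :
    ∃ k, ∃ e : Matrix (Fin n) (Fin n) B, IsStarProjection e ∧ (∀ i j, e i j ∈ T k) ∧
      MvN S p e := by
  have hS : IsClosed (S : Set B) := by rw [hd]; exact isClosed_closure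
  have hTS : ∀ k, T k ≤ S := by
    intro k x hx
    have : x ∈ (S : Set B) := by
      rw [hd]
      exact subset_closure (Set.mem_iUnion.2 ⟨k, hx⟩)
    exact this
  -- The closed subalgebra `S` is treated as an ambient C*-algebra in which the union is dense; the
  -- resulting projection and partial isometry are then mapped back to `B`.
  let ι : S →⋆ₙₐ[ℂ] B := NonUnitalStarSubalgebraClass.subtype S
  let T' : ℕ → NonUnitalStarSubalgebra ℂ S := fun k => (T k).comap ι
  have hT' : Monotone T' := fun k l hkl x hx => hT hkl hx
  have hc' : ∀ k, IsClosed (T' k : Set S) := fun k => (hc k).preimage continuous_subtype_val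
  have hd' : closure (⋃ k, (T' k : Set S)) = Set.univ := by
    rw [Set.eq_univ_iff_forall]
    intro x
    rw [closure_subtype]
    have h1 : (Subtype.val '' ⋃ k, (T' k : Set S)) = ⋃ k, (T k : Set B) := by
      ext y
      simp only [Set.mem_image, Set.mem_iUnion]
      constructor
      · rintro ⟨x, ⟨k, hx⟩, rfl⟩; exact ⟨k, hx⟩
      · rintro ⟨k, hy⟩; exact ⟨⟨y, hTS k hy⟩, ⟨k, hy⟩, rfl⟩
    rw [h1, ← hd]
    exact x.2
  let p' : Matrix (Fin n) (Fin n) S := Matrix.of fun i j => ⟨p i j, hpS i j⟩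
  have hval : ∀ {a b c : ℕ} (x : Matrix (Fin a) (Fin b) S) (y : Matrix (Fin b) (Fin c) S),
      (x * y).map Subtype.val = x.map Subtype.val * y.map (Subtype.val : S → B) := by
    intro a b c x y
    refine Matrix.ext fun i j => ?_
    simp [Matrix.mul_apply]
  have hstar : ∀ {a b : ℕ} (x : Matrix (Fin a) (Fin b) S),
      (x.conjTranspose).map (Subtype.val : S → B) = (x.map Subtype.val).conjTranspose := by
    intro a b x
    rfl
  have hinj : ∀ {a b : ℕ} {x y : Matrix (Fin a) (Fin b) S},
      x.map (Subtype.val : S → B) = y.map Subtype.val → x = y := fun h =>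
    Matrix.map_injective Subtype.val_injective h
  have hp' : IsStarProjection p' := by
    constructor
    · apply hinj
      rw [hval]
      exact hp.isIdempotentElem
    · apply hinj
      exact hp.isSelfAdjoint
  obtain ⟨k, e, he, heT, v, -, hv1, hv2⟩ := exists_mvN_of_dense hT' hc' hd' hp'
  refine ⟨k, e.map Subtype.val, ?_, fun i j => heT i j, v.map Subtype.val, fun i j => (v i j).2,
    ?_, ?_⟩
  · constructor
    · rw [IsIdempotentElem, ← hval, he.isIdempotentElem.eq]
    · rw [IsSelfAdjoint, Matrix.star_eq_conjTranspose, ← hstar, ← Matrix.star_eq_conjTranspose,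
        he.isSelfAdjoint.star_eq]
  · rw [← hstar, ← hval, hv1]; rfl
  · rw [← hstar, ← hval, hv2]

end Approximation

/-! ### The diagonal `C`: normalised by matrix units, commutative, its own relative commutant -/

/-- The sequence `E` of systems of matrix units exhibits `C` as a standard AF diagonal of `B`. -/
structure IsAFSystem {B : Type u} [NonUnitalCStarAlgebra B] (C : NonUnitalStarSubalgebra ℂ B)
    (E : ℕ → MatrixUnits B) : Prop where
  refines_succ : ∀ k, (E k).Refines (E (k + 1))
  dense : closure (⋃ k, ((E k).alg : Set B)) = Set.univ
  coe_eq : (C : Set B) = closure (⋃ k, ((E k).diag.alg : Set B))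

theorem IsStandardAFDiagonal.exists_isAFSystem {B : Type u} [NonUnitalCStarAlgebra B]
    {C : NonUnitalStarSubalgebra ℂ B} (h : IsStandardAFDiagonal C) : ∃ E, IsAFSystem C E := by
  obtain ⟨E, h1, h2, h3⟩ := h
  refine ⟨E, fun k => MatrixUnits.refines_of_forall_eq_sum (h1 k), h2, ?_⟩
  rw [h3]
  simp only [MatrixUnits.coe_alg_diag]

namespace IsAFSystem

variable {B : Type u} [NonUnitalCStarAlgebra B] {C : NonUnitalStarSubalgebra ℂ B}
  {E : ℕ → MatrixUnits B}

theorem refines (h : IsAFSystem C E) {k l : ℕ} (hkl : k ≤ l) : (E k).Refines (E l) := by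
  induction hkl with
  | refl => exact .refl
  | step _ ih => exact ih.trans (h.refines_succ _)

theorem monotone_alg (h : IsAFSystem C E) : Monotone fun k => (E k).alg :=
  fun _ _ hkl => (h.refines hkl).alg_le

theorem monotone_alg_diag (h : IsAFSystem C E) : Monotone fun k => (E k).diag.alg :=
  fun _ _ hkl => (h.refines hkl).alg_diag_le

theorem isClosed (h : IsAFSystem C E) : IsClosed (C : Set B) := by
  rw [h.coe_eq]; exact isClosed_closure

theorem alg_diag_le (h : IsAFSystem C E) (k : ℕ) : (E k).diag.alg ≤ C := by
  intro x hx
  have : x ∈ (C : Set B) := by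
    rw [h.coe_eq]
    exact subset_closure (Set.mem_iUnion.2 ⟨k, hx⟩)
  exact this

theorem dg_mem (h : IsAFSystem C E) (k : ℕ) (a : (E k).Idx) : (E k).dg a ∈ C :=
  h.alg_diag_le k ((E k).dg_mem_alg_diag a)

theorem one_mem (h : IsAFSystem C E) (k : ℕ) : (E k).one ∈ C := sum_mem fun a _ => h.dg_mem k a

/-- Closed conditions that hold for all elements of high enough levels hold on `C`. -/
theorem induction_on (h : IsAFSystem C E) {P : B → Prop} (hP : IsClosed {x | P x}) (k : ℕ)
    (hk : ∀ l, k ≤ l → ∀ x ∈ (E l).diag.alg, P x) {x : B} (hx : x ∈ C) : P x := by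
  have hx' : x ∈ closure (⋃ k, ((E k).diag.alg : Set B)) := by rw [← h.coe_eq]; exact hx
  refine closure_minimal ?_ hP hx'
  intro y hy
  obtain ⟨m, hm⟩ := Set.mem_iUnion.1 hy
  exact hk (max k m) (le_max_left _ _) y (h.monotone_alg_diag (le_max_right k m) hm)

/-- The matrix units normalise `C`. -/
theorem conj_mem (h : IsAFSystem C E) {k : ℕ} {b x : B} (hb : b ∈ (E k).units) (hx : x ∈ C) :
    b * x * star b ∈ C := by
  refine h.induction_on (P := fun x => b * x * star b ∈ C) ?_ k ?_ hx
  · exact h.isClosed.preimage (by fun_prop)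
  · intro l hl x hx
    exact h.alg_diag_le l ((h.refines hl).conj_mem hb hx)

/-- To commute with `C` it is enough to commute with the diagonal matrix units. -/
theorem commute_of_forall_dg (h : IsAFSystem C E) {b : B} (k : ℕ)
    (hb : ∀ l, k ≤ l → ∀ a, b * (E l).dg a = (E l).dg a * b) {x : B} (hx : x ∈ C) :
    b * x = x * b := by
  refine h.induction_on (P := fun x => b * x = x * b) ?_ k ?_ hx
  · exact isClosed_eq (by fun_prop) (by fun_prop)
  · intro l hl x hx
    change x ∈ Submodule.span ℂ (E l).diag.units at hx
    rw [MatrixUnits.units_diag] at hx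
    induction hx using Submodule.span_induction with
    | mem x hx =>
      obtain ⟨s, i, rfl⟩ := hx
      exact hb l hl ⟨s, i⟩
    | zero => rw [mul_zero, zero_mul]
    | add y z _ _ hy hz => rw [mul_add, add_mul, hy, hz]
    | smul c y _ hy => rw [mul_smul_comm, smul_mul_assoc, hy]

theorem dg_commute (h : IsAFSystem C E) {k : ℕ} (a : (E k).Idx) {x : B} (hx : x ∈ C) :
    (E k).dg a * x = x * (E k).dg a :=
  h.commute_of_forall_dg k (fun _ hl b => (h.refines hl).commute_dg a b) hx

/-- `C` is commutative. -/
theorem mul_comm (h : IsAFSystem C E) {x y : B} (hx : x ∈ C) (hy : y ∈ C) : x * y = y * x :=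
  h.commute_of_forall_dg 0 (fun _ _ a => (h.dg_commute a hx).symm) hy

end IsAFSystem

/-- Compression to the diagonal is a contraction. -/
theorem MatrixUnits.norm_sum_dg_mul_dg_le {B : Type u} [NonUnitalCStarAlgebra B]
    (E : MatrixUnits B) (a : B) : ‖∑ i, E.dg i * a * E.dg i‖ ≤ ‖a‖ := by
  set T := ∑ i, E.dg i * a * E.dg i with hT
  have hstar : star T * T = ∑ i, E.dg i * star a * E.dg i * a * E.dg i := by
    rw [hT, star_sum, Finset.sum_mul_sum]
    refine Finset.sum_congr rfl fun i _ => ?_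
    rw [Finset.sum_eq_single i]
    · simp only [star_mul, E.star_dg, mul_assoc]
      rw [← mul_assoc (E.dg i) (E.dg i), E.dg_mul_self]
    · intro j _ hj
      simp only [star_mul, E.star_dg, mul_assoc]
      rw [← mul_assoc (E.dg i) (E.dg j), E.dg_mul_ne (Ne.symm hj)]
      simp
    · simp
  -- The diagonal units are orthogonal, so `T* T` has no cross terms; these bounds add up to `T* T ≤
  -- ‖a‖² • one`.
  have hterm : ∀ i, E.dg i * star a * E.dg i * a * E.dg i ≤ (‖a‖ * ‖a‖) • E.dg i := by
    intro i
    have hsa : IsSelfAdjoint (star a * E.dg i * a) := by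
      rw [IsSelfAdjoint, star_mul, star_mul, star_star, E.star_dg, mul_assoc]
    have h1 := CStarAlgebra.star_left_conjugate_le_norm_smul (a := E.dg i) hsa
    rw [E.star_dg, E.dg_mul_self] at h1
    have h2 : ‖star a * E.dg i * a‖ ≤ ‖a‖ * ‖a‖ := by
      refine (norm_mul_le _ _).trans ?_
      gcongr
      refine (norm_mul_le _ _).trans ?_
      rw [norm_star, E.norm_dg, mul_one]
    have h3 : ‖star a * E.dg i * a‖ • E.dg i ≤ (‖a‖ * ‖a‖) • E.dg i :=
      smul_le_smul_of_nonneg_right h2 (E.isStarProjection_dg i).nonneg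
    refine le_trans (le_of_eq ?_) (h1.trans h3)
    simp only [mul_assoc]
  have h1 : star T * T ≤ (‖a‖ * ‖a‖) • E.one := by
    rw [hstar, one, Finset.smul_sum]
    exact Finset.sum_le_sum fun i _ => hterm i
  have h2 : ‖star T * T‖ ≤ ‖a‖ * ‖a‖ := by
    refine (CStarAlgebra.norm_le_norm_of_nonneg_of_le (star_mul_self_nonneg T) h1).trans ?_
    rw [norm_smul, Real.norm_of_nonneg (by positivity)]
    exact mul_le_of_le_one_right (by positivity) E.isStarProjection_one.norm_le
  rw [CStarRing.norm_star_mul_self] at h2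
  exact (mul_self_le_mul_self_iff (norm_nonneg T) (norm_nonneg a)).2 h2

/-- `C` is its own relative commutant. -/
theorem IsAFSystem.mem_of_commute {B : Type u} [NonUnitalCStarAlgebra B]
    {C : NonUnitalStarSubalgebra ℂ B} {E : ℕ → MatrixUnits B} (h : IsAFSystem C E) {b : B}
    (hb : ∀ x ∈ C, b * x = x * b) : b ∈ C := by
  have hcl : b ∈ closure (C : Set B) := by
    rw [Metric.mem_closure_iff]
    intro ε hε
    have hbd : b ∈ closure (⋃ k, ((E k).alg : Set B)) := by rw [h.dense]; trivial
    obtain ⟨c, hc, hbc⟩ := Metric.mem_closure_iff.1 hbd (ε / 3) (by positivity)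
    obtain ⟨k, hk⟩ := Set.mem_iUnion.1 hc
    rw [dist_eq_norm] at hbc
    -- The diagonal compression of `c` lies in `C`. Since `b` commutes with the diagonal units, its
    -- own compression is `b * one`, so the error splits into three terms, each bounded by `‖b - c‖
    -- < ε / 3`.
    refine ⟨∑ i, (E k).dg i * c * (E k).dg i, ?_, ?_⟩
    · refine sum_mem fun i _ => ?_
      obtain ⟨r, hr⟩ := (E k).exists_smul_of_mem_alg hk i.1 i.2 i.2
      rw [MatrixUnits.dg, hr]
      exact SMulMemClass.smul_mem _ (h.dg_mem k i)
    · have h1 : ∑ i, (E k).dg i * b * (E k).dg i = b * (E k).one := by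
        rw [MatrixUnits.one, Finset.mul_sum]
        refine Finset.sum_congr rfl fun i _ => ?_
        rw [← hb _ (h.dg_mem k i), mul_assoc, (E k).dg_mul_self]
      have h2 : b - ∑ i, (E k).dg i * c * (E k).dg i =
          (b - c) - (b - c) * (E k).one + ∑ i, (E k).dg i * (b - c) * (E k).dg i := by
        simp only [mul_sub, sub_mul, Finset.sum_sub_distrib, h1, (E k).alg_mul_one hk]
        abel
      rw [dist_eq_norm, h2]
      have h3 := (E k).norm_sum_dg_mul_dg_le (b - c)
      have h4 : ‖(b - c) * (E k).one‖ ≤ ‖b - c‖ :=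
        (norm_mul_le _ _).trans
          (mul_le_of_le_one_right (norm_nonneg _) (E k).isStarProjection_one.norm_le)
      have h5 := norm_add_le ((b - c) - (b - c) * (E k).one)
        (∑ i, (E k).dg i * (b - c) * (E k).dg i)
      have h6 := norm_sub_le (b - c) ((b - c) * (E k).one)
      linarith
  rwa [h.isClosed.closure_eq] at hcl

/-! ### Diagonalising projections over a finite level -/

namespace MatrixUnits

variable {B : Type u} [NonUnitalCStarAlgebra B] (E : MatrixUnits B) {N : ℕ}

theorem star_mul_sum_smul {s : Fin E.r} (j : Fin (E.d s)) (c : Fin (E.d s) → ℂ) :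
    star (∑ k, c k • E.e s k j) * (∑ k, c k • E.e s k j) =
      ((∑ k, ‖c k‖ ^ 2 : ℝ) : ℂ) • E.e s j j := by
  rw [star_sum, Finset.sum_mul_sum]
  have h1 : ∀ k, ∑ l, star (c k • E.e s k j) * (c l • E.e s l j) =
      ((‖c k‖ ^ 2 : ℝ) : ℂ) • E.e s j j := by
    intro k
    rw [Finset.sum_eq_single k]
    · rw [star_smul, E.star_e, smul_mul_smul_comm, E.mul_same]
      congr 1
      rw [Complex.ofReal_pow, ← Complex.conj_mul']
      rfl
    · intro l _ hl
      rw [star_smul, E.star_e, smul_mul_smul_comm, E.mul_index_ne _ _ _ _ _ (Ne.symm hl),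
        smul_zero]
    · simp
  rw [Finset.sum_congr rfl fun k _ => h1 k, ← Finset.sum_smul]
  push_cast
  rfl

/-- The range of a nonzero projection contains a column that is a partial isometry with initial
projection a diagonal matrix unit. -/
theorem exists_column {e : Matrix (Fin N) (Fin N) B} (he : e * e = e)
    (heE : ∀ i j, e i j ∈ E.alg) (h0 : e ≠ 0) :
    ∃ (a : E.Idx) (y : Matrix (Fin N) (Fin 1) B), (∀ i j, y i j ∈ E.alg) ∧ e * y = y ∧
      y.conjTranspose * y = Matrix.diagonal (fun _ => E.dg a) ∧
      ∀ i j, y i j * E.dg a = y i j := by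
  obtain ⟨i₀, b, hb⟩ : ∃ i b, e i b ≠ 0 := by
    by_contra hcon
    push Not at hcon
    exact h0 (Matrix.ext hcon)
  obtain ⟨a, ha⟩ : ∃ a, e i₀ b * E.dg a ≠ 0 := by
    by_contra hcon
    push Not at hcon
    apply hb
    rw [← E.alg_mul_one (heE i₀ b), one, Finset.mul_sum]
    exact Finset.sum_eq_zero fun a _ => hcon a
  obtain ⟨s, j⟩ := a
  have hc : ∀ i, ∃ c : Fin (E.d s) → ℂ, e i b * E.e s j j = ∑ k, c k • E.e s k j := by
    intro i
    obtain ⟨c, hc⟩ := E.exists_coeff (heE i b) s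
    exact ⟨fun k => c k j, hc j j⟩
  choose c hc using hc
  -- Column `b` of `e`, cut down by `e s j j`, is fixed by `e` and has `y* y = lam • e s j j`. It is
  -- nonzero by the choice of `b` and `j`, so `lam > 0`, and scaling by `1 / √lam` gives a partial
  -- isometry.
  set lam : ℝ := ∑ i, ∑ k, ‖c i k‖ ^ 2 with hlam
  have hlam0 : 0 < lam := by
    have hnn : 0 ≤ lam := Finset.sum_nonneg fun i _ => Finset.sum_nonneg fun k _ => by positivity
    refine lt_of_le_of_ne hnn fun heq => ha ?_
    have h1 := (Finset.sum_eq_zero_iff_of_nonneg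
      (fun i _ => Finset.sum_nonneg fun k _ => by positivity)).1 heq.symm i₀ (Finset.mem_univ _)
    have h2 := (Finset.sum_eq_zero_iff_of_nonneg (fun k _ => by positivity)).1 h1
    change e i₀ b * E.e s j j = 0
    rw [hc i₀]
    refine Finset.sum_eq_zero fun k _ => ?_
    have h3 : c i₀ k = 0 := by simpa using h2 k (Finset.mem_univ _)
    rw [h3, zero_smul]
  set μ : ℂ := (((Real.sqrt lam)⁻¹ : ℝ) : ℂ) with hμ
  have hμs : star μ = μ := Complex.conj_ofReal _
  have hμμ : μ * μ * (lam : ℂ) = 1 := by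
    rw [hμ, ← Complex.ofReal_mul, ← Complex.ofReal_mul, ← Complex.ofReal_one]
    congr 1
    rw [← mul_inv, Real.mul_self_sqrt hlam0.le, inv_mul_cancel₀ hlam0.ne']
  refine ⟨⟨s, j⟩, Matrix.of fun i _ => μ • (e i b * E.e s j j), ?_, ?_, ?_, ?_⟩
  · intro i _
    exact SMulMemClass.smul_mem _ (mul_mem (heE i b) (E.units_mem_alg ⟨s, j, j, rfl⟩))
  · refine Matrix.ext fun i t => ?_
    rw [Matrix.mul_apply]
    simp only [Matrix.of_apply, mul_smul_comm, ← mul_assoc]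
    rw [← Finset.smul_sum, ← Finset.sum_mul, ← Matrix.mul_apply, he]
  · refine Matrix.ext fun t t' => ?_
    rw [Subsingleton.elim t' t, Matrix.diagonal_apply_eq, Matrix.mul_apply]
    simp only [Matrix.conjTranspose_apply, Matrix.of_apply, star_smul, smul_mul_smul_comm, hμs]
    rw [← Finset.smul_sum]
    have h1 : ∀ i, star (e i b * E.e s j j) * (e i b * E.e s j j) =
        ((∑ k, ‖c i k‖ ^ 2 : ℝ) : ℂ) • E.e s j j := by
      intro i
      rw [hc i, E.star_mul_sum_smul]
    rw [Finset.sum_congr rfl fun i _ => h1 i, ← Finset.sum_smul, ← Complex.ofReal_sum, smul_smul,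
      hμμ, one_smul]
    rfl
  · intro i t
    simp only [Matrix.of_apply, smul_mul_assoc, mul_assoc]
    congr 2
    exact E.mul_same _ _ _ _

/-- The matrices over the spanned algebra that are fixed by left multiplication by `e`. -/
def fixedBy (e : Matrix (Fin N) (Fin N) B) : Submodule ℂ (Matrix (Fin N) (Fin N) B) where
  carrier := {x | (∀ i j, x i j ∈ E.alg) ∧ e * x = x}
  add_mem' := fun ha hb => ⟨fun i j => add_mem (ha.1 i j) (hb.1 i j), by
    rw [Matrix.mul_add, ha.2, hb.2]⟩
  zero_mem' := ⟨fun _ _ => zero_mem _, Matrix.mul_zero _⟩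
  smul_mem' := fun c _ hx => ⟨fun i j => SMulMemClass.smul_mem _ (hx.1 i j), by
    rw [Matrix.mul_smul, hx.2]⟩

instance finiteDimensional_fixedBy (e : Matrix (Fin N) (Fin N) B) :
    FiniteDimensional ℂ (E.fixedBy e) := by
  let f : E.fixedBy e →ₗ[ℂ] (Fin N → Fin N → Submodule.span ℂ E.units) :=
    { toFun := fun x i j => ⟨x.1 i j, x.2.1 i j⟩
      map_add' := fun _ _ => rfl
      map_smul' := fun _ _ => rfl }
  refine FiniteDimensional.of_injective f fun x y hxy => ?_
  refine Subtype.ext (Matrix.ext fun i j => ?_)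
  exact congrArg Subtype.val (congrFun (congrFun hxy i) j)

/-- A projection over a finite-dimensional algebra is the range projection of a partial isometry
whose initial projection is a diagonal matrix of diagonal matrix units. -/
theorem exists_diagonalization {e : Matrix (Fin N) (Fin N) B} (he : IsStarProjection e)
    (heE : ∀ i j, e i j ∈ E.alg) :
    ∃ (a : ℕ) (c : Fin a → E.Idx) (u : Matrix (Fin N) (Fin a) B), (∀ i j, u i j ∈ E.alg) ∧
      u * u.conjTranspose = e ∧ u.conjTranspose * u = Matrix.diagonal (fun t => E.dg (c t)) ∧
      ∀ i t, u i t * E.dg (c t) = u i t := by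
  -- A nonzero `e` contains a projection `g = y y*` given by one column `y`. Passing to `e - g`
  -- lowers the dimension strictly, because `g` is fixed by `e` and not by `e - g`; `y` is then put
  -- in front of the columns obtained for `e - g`.
  induction hn : Module.finrank ℂ (E.fixedBy e) using Nat.strong_induction_on generalizing e with
  | _ n ih =>
    by_cases h0 : e = 0
    · refine ⟨0, Fin.elim0, Matrix.of fun _ t => t.elim0, fun _ t => t.elim0, ?_, ?_,
        fun _ t => t.elim0⟩
      · rw [h0]
        refine Matrix.ext fun i j => ?_
        simp [Matrix.mul_apply]
      · exact Matrix.ext fun t => t.elim0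
    · have hee : e * e = e := he.isIdempotentElem
      have hes : e.conjTranspose = e := he.isSelfAdjoint
      obtain ⟨a, y, hyE, hey, hyy, hya⟩ := E.exists_column hee heE h0
      have hyD : y * Matrix.diagonal (fun _ : Fin 1 => E.dg a) = y := by
        refine Matrix.ext fun i t => ?_
        rw [Matrix.mul_diagonal]
        exact hya i t
      set g : Matrix (Fin N) (Fin N) B := y * y.conjTranspose with hg
      have hgs : g.conjTranspose = g := by simp [hg]
      have hgy : g * y = y := by rw [hg, Matrix.mul_assoc, hyy, hyD]
      have hgg : g * g = g := by
        conv_lhs => rhs; rw [hg]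
        rw [← Matrix.mul_assoc, hgy]
      have heg : e * g = g := by rw [hg, ← Matrix.mul_assoc, hey]
      have hge : g * e = g := by
        have := congrArg Matrix.conjTranspose heg
        simpa [hgs, hes] using this
      have hgE : ∀ i j, g i j ∈ E.alg := matrix_mul_mem hyE fun i j => star_mem (hyE j i)
      have he' : IsStarProjection (e - g) := by
        constructor
        · rw [IsIdempotentElem, Matrix.mul_sub, Matrix.sub_mul, Matrix.sub_mul, hee, hge, heg, hgg,
            sub_self, sub_zero]
        · rw [IsSelfAdjoint, star_sub, Matrix.star_eq_conjTranspose, Matrix.star_eq_conjTranspose,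
            hes, hgs]
      have hy0 : y ≠ 0 := by
        rintro rfl
        have h1 := congrFun (congrFun hyy 0) 0
        rw [Matrix.mul_zero, Matrix.diagonal_apply_eq] at h1
        exact E.dg_ne_zero a h1.symm
      have hlt : E.fixedBy (e - g) < E.fixedBy e := by
        refine lt_of_le_of_ne ?_ ?_
        · rintro x ⟨hx1, hx2⟩
          refine ⟨hx1, ?_⟩
          rw [← hx2, ← Matrix.mul_assoc, Matrix.mul_sub, hee, heg]
        · intro heq
          have h1 : g ∈ E.fixedBy e := ⟨hgE, heg⟩
          rw [← heq] at h1
          have h2 := h1.2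
          rw [Matrix.sub_mul, heg, hgg, sub_self] at h2
          apply hy0
          rw [← hgy, ← h2, Matrix.zero_mul]
      obtain ⟨a', c, u, huE, huu, huc, hud⟩ := ih _
        (hn ▸ Submodule.finrank_lt_finrank_of_lt hlt) he'
        (fun i j => sub_mem (heE i j) (hgE i j)) rfl
      have huD : u * Matrix.diagonal (fun t => E.dg (c t)) = u := by
        refine Matrix.ext fun i t => ?_
        rw [Matrix.mul_diagonal]
        exact hud i t
      have hyu : y.conjTranspose * u = 0 := by
        have h1 : (e - g) * u = u := by rw [← huu, Matrix.mul_assoc, huc, huD]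
        have h2 : y.conjTranspose * (e - g) = 0 := by
          have h3 : (e - g) * y = 0 := by rw [Matrix.sub_mul, hey, hgy, sub_self]
          have h4 := congrArg Matrix.conjTranspose h3
          simpa [hes, hgs] using h4
        rw [← h1, ← Matrix.mul_assoc, h2, Matrix.zero_mul]
      have huy : u.conjTranspose * y = 0 := by
        have := congrArg Matrix.conjTranspose hyu
        simpa using this
      refine ⟨a' + 1, Fin.cons a c, Matrix.of fun i => Fin.cons (y i 0) (u i), ?_, ?_, ?_, ?_⟩
      · intro i t
        refine Fin.cases ?_ (fun t => ?_) t
        · simpa using hyE i 0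
        · simpa using huE i t
      · refine Matrix.ext fun i j => ?_
        have h1 : e i j = g i j + (e - g) i j := by simp
        rw [h1, ← huu, hg, Matrix.mul_apply, Matrix.mul_apply, Matrix.mul_apply,
          Fin.sum_univ_succ]
        simp
      · refine Matrix.ext fun t t' => ?_
        rw [Matrix.mul_apply]
        refine Fin.cases ?_ (fun t => ?_) t <;> refine Fin.cases ?_ (fun t' => ?_) t'
        · have := congrFun (congrFun hyy 0) 0
          rw [Matrix.mul_apply] at this
          simpa using this
        · have := congrFun (congrFun hyu 0) t'
          rw [Matrix.mul_apply] at this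
          rw [Matrix.diagonal_apply_ne _ (Fin.succ_ne_zero t').symm]
          simpa using this
        · have := congrFun (congrFun huy t) 0
          rw [Matrix.mul_apply] at this
          rw [Matrix.diagonal_apply_ne _ (Fin.succ_ne_zero t)]
          simpa using this
        · have := congrFun (congrFun huc t) t'
          rw [Matrix.mul_apply] at this
          simpa [Matrix.diagonal_apply] using this
      · intro i t
        refine Fin.cases ?_ (fun t => ?_) t
        · simpa using hya i 0
        · simpa using hud i t

end MatrixUnits

/-! ### Universal property of the Grothendieck group -/

section Grothendieck

variable {S : Type u} {r : S → S → Prop} {sum : S → S → S → Prop}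

theorem Gr.mk_eq_of_rel {v w : S} (h : r v w) : Gr.mk r sum v = Gr.mk r sum w := by
  refine (QuotientAddGroup.eq_iff_sub_mem).2 (AddSubgroup.subset_closure (Or.inl ⟨v, w, h, rfl⟩))

theorem Gr.mk_eq_add {v w t : S} (h : sum v w t) :
    Gr.mk r sum t = Gr.mk r sum v + Gr.mk r sum w := by
  refine (QuotientAddGroup.eq_iff_sub_mem).2
    (AddSubgroup.subset_closure (Or.inr ⟨v, w, t, h, rfl⟩))

/-- The universal property of `Gr`. -/
noncomputable def Gr.lift {A : Type*} [AddCommGroup A] (f : S → A) (h1 : ∀ v w, r v w → f v = f w)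
    (h2 : ∀ v w t, sum v w t → f t = f v + f w) : Gr r sum →+ A :=
  QuotientAddGroup.lift _ (FreeAbelianGroup.lift f) (by
    rw [grRelations, AddSubgroup.closure_le]
    rintro x (⟨v, w, h, rfl⟩ | ⟨v, w, t, h, rfl⟩)
    · simp [h1 v w h]
    · simp [h2 v w t h])

theorem Gr.lift_mk {A : Type*} [AddCommGroup A] (f : S → A) (h1 : ∀ v w, r v w → f v = f w)
    (h2 : ∀ v w t, sum v w t → f t = f v + f w) (v : S) :
    Gr.lift f h1 h2 (Gr.mk r sum v) = f v := by
  change FreeAbelianGroup.lift f (FreeAbelianGroup.of v) = f v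
  simp

theorem Gr.hom_ext {A : Type*} [AddCommGroup A] {f g : Gr r sum →+ A}
    (h : ∀ v, f (Gr.mk r sum v) = g (Gr.mk r sum v)) : f = g := by
  refine QuotientAddGroup.addMonoidHom_ext _ ?_
  refine FreeAbelianGroup.lift_ext _ _ fun v => ?_
  exact h v

end Grothendieck

/-! ### Classes of normalising partial isometries and the cutting lemma -/

section NormalizingPartialIsometries

variable {B : Type u} [NonUnitalCStarAlgebra B] {n m : ℕ}

/-- The matrices over a star subalgebra. -/
def matAlg (C : NonUnitalStarSubalgebra ℂ B) (n : ℕ) :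
    NonUnitalStarSubalgebra ℂ (Matrix (Fin n) (Fin n) B) where
  carrier := (C : Set B).matrix
  add_mem' := fun ha hb i j => add_mem (ha i j) (hb i j)
  zero_mem' := fun _ _ => zero_mem C
  smul_mem' := fun _ _ hx i j => SMulMemClass.smul_mem _ (hx i j)
  mul_mem' := fun ha hb => matrix_mul_mem ha hb
  star_mem' := fun ha i j => star_mem (s := C) (ha j i)

/-- `v` is a partial isometry that normalises the matrices over `C`. -/
def IsNPi (C : NonUnitalStarSubalgebra ℂ B) (v : Matrix (Fin n) (Fin n) B) : Prop :=
  (IsStarProjection (star v * v) ∧ IsStarProjection (v * star v)) ∧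
    Normalizes v (C : Set B).matrix

variable (C : NonUnitalStarSubalgebra ℂ B)

open Classical in
/-- The class in `G(B; C)` of a normalising partial isometry, and zero for other matrices. -/
noncomputable def gcls (v : Matrix (Fin n) (Fin n) B) : G C :=
  if h : IsNPi C v then G.mk C ⟨⟨n, v⟩, h⟩ else 0

variable {C}

theorem gcls_eq {v : Matrix (Fin n) (Fin n) B} (h : IsNPi C v) :
    gcls C v = G.mk C ⟨⟨n, v⟩, h⟩ := dif_pos h

theorem pad_self (v : Matrix (Fin n) (Fin n) B) : pad n v = v := rpad_self v

theorem gcls_eq_of_unitary {v : Matrix (Fin n) (Fin n) B} {w : Matrix (Fin m) (Fin m) B}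
    (hv : IsNPi C v) (hw : IsNPi C w) {N : ℕ} (hn : n ≤ N) (hm : m ≤ N)
    {z y : Matrix (Fin N) (Fin N) (Unitization ℂ B)} (hz : IsNormalizingUnitary C z)
    (hy : IsNormalizingUnitary C y) (h : z * emb (pad N v) * y = emb (pad N w)) :
    gcls C v = gcls C w := by
  rw [gcls_eq hv, gcls_eq hw]
  exact Gr.mk_eq_of_rel ⟨N, hn, hm, z, y, hz, hy, h⟩

theorem gcls_dsumMat {v : Matrix (Fin n) (Fin n) B} {w : Matrix (Fin m) (Fin m) B}
    (hv : IsNPi C v) (hw : IsNPi C w) (hvw : IsNPi C (dsumMat v w)) :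
    gcls C (dsumMat v w) = gcls C v + gcls C w := by
  rw [gcls_eq hv, gcls_eq hw, gcls_eq hvw]
  exact Gr.mk_eq_add rfl

theorem IsNormalizingUnitary.star {z : Matrix (Fin n) (Fin n) (Unitization ℂ B)}
    (hz : IsNormalizingUnitary C z) : IsNormalizingUnitary C (star z) := by
  refine ⟨Unitary.star_mem hz.1, ?_, ?_⟩
  · simpa using hz.2.2
  · simpa using hz.2.1

theorem isNormalizingUnitary_one :
    IsNormalizingUnitary C (1 : Matrix (Fin n) (Fin n) (Unitization ℂ B)) :=
  entriesIn_one.isNormalizingUnitary (one_mem _)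

theorem isNPi_of_mem {v : Matrix (Fin n) (Fin n) B} (hv : ∀ i j, v i j ∈ C)
    (h1 : IsStarProjection (star v * v)) (h2 : IsStarProjection (v * star v)) : IsNPi C v :=
  ⟨⟨h1, h2⟩, fun _ hx => mul_mem (s := matAlg C n) (mul_mem (s := matAlg C n) hv hx)
    (star_mem (s := matAlg C n) hv), fun _ hx => mul_mem (s := matAlg C n)
      (mul_mem (s := matAlg C n) (star_mem (s := matAlg C n) hv) hx) hv⟩

theorem isNPi_of_projection {p : Matrix (Fin n) (Fin n) B} (hp : IsStarProjection p)
    (hpC : ∀ i j, p i j ∈ C) : IsNPi C p := by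
  have h1 : star p * p = p := by rw [hp.isSelfAdjoint.star_eq, hp.isIdempotentElem.eq]
  have h2 : p * star p = p := by rw [hp.isSelfAdjoint.star_eq, hp.isIdempotentElem.eq]
  exact isNPi_of_mem hpC (by rwa [h1]) (by rwa [h2])

/-- The unitary that dilates an equivalence over `C` has entries in the unitization of `C`, so it
normalises the matrices over `C`. -/
theorem gcls_eq_of_mvN {p : Matrix (Fin n) (Fin n) B} {q : Matrix (Fin m) (Fin m) B}
    (hp : IsStarProjection p) (hpC : ∀ i j, p i j ∈ C) (hq : IsStarProjection q)
    (hqC : ∀ i j, q i j ∈ C) (h : MvN C p q) : gcls C p = gcls C q := by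
  obtain ⟨N, hn, hm, z, hz, hzC, hzp⟩ := h.exists_unitary hp
  have hzN := hzC.isNormalizingUnitary hz
  exact gcls_eq_of_unitary (isNPi_of_projection hp hpC) (isNPi_of_projection hq hqC) hn hm hzN
    hzN.star hzp

theorem gcls_add_of_orthogonal {p q : Matrix (Fin n) (Fin n) B} (hp : IsStarProjection p)
    (hpC : ∀ i j, p i j ∈ C) (hq : IsStarProjection q) (hqC : ∀ i j, q i j ∈ C) (h : p * q = 0) :
    gcls C (p + q) = gcls C p + gcls C q := by
  have h1 := isStarProjection_dsumMat hp hq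
  have h2 := dsumMat_mem hpC hqC
  rw [← gcls_dsumMat (isNPi_of_projection hp hpC) (isNPi_of_projection hq hqC)
    (isNPi_of_projection h1 h2)]
  exact gcls_eq_of_mvN (hp.add hq h) (fun i j => add_mem (hpC i j) (hqC i j)) h1 h2
    (mvN_add_dsum hp hq hpC hqC h)

theorem gcls_zero : gcls C (0 : Matrix (Fin n) (Fin n) B) = 0 := by
  have h0 : IsStarProjection (0 : Matrix (Fin n) (Fin n) B) := .zero _
  have h := gcls_add_of_orthogonal (C := C) h0 (fun _ _ => zero_mem C) h0 (fun _ _ => zero_mem C)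
    (Matrix.mul_zero 0)
  rw [add_zero] at h
  exact left_eq_add.1 h

theorem isStarProjection_sum {ι : Type*} (s : Finset ι) {g : ι → Matrix (Fin n) (Fin n) B}
    (hg : ∀ i, IsStarProjection (g i)) (ho : ∀ i j, i ≠ j → g i * g j = 0) :
    IsStarProjection (∑ i ∈ s, g i) := by
  classical
  induction s using Finset.induction_on with
  | empty => rw [Finset.sum_empty]; exact .zero _
  | insert a s ha ih =>
    rw [Finset.sum_insert ha]
    refine (hg a).add ih ?_
    rw [Finset.mul_sum]
    exact Finset.sum_eq_zero fun i hi => ho a i (fun h => ha (h ▸ hi))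

theorem gcls_sum {ι : Type*} (s : Finset ι) {g : ι → Matrix (Fin n) (Fin n) B}
    (hg : ∀ i, IsStarProjection (g i)) (hgC : ∀ t i j, g t i j ∈ C)
    (ho : ∀ i j, i ≠ j → g i * g j = 0) : gcls C (∑ i ∈ s, g i) = ∑ i ∈ s, gcls C (g i) := by
  classical
  induction s using Finset.induction_on with
  | empty => rw [Finset.sum_empty, Finset.sum_empty, gcls_zero]
  | insert a s ha ih =>
    rw [Finset.sum_insert ha, Finset.sum_insert ha, ← ih]
    refine gcls_add_of_orthogonal (hg a) (hgC a) (isStarProjection_sum s hg ho) ?_ ?_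
    · exact sum_mem (S := matAlg C n) fun i _ => hgC i
    · rw [Finset.mul_sum]
      exact Finset.sum_eq_zero fun i hi => ho a i (fun h => ha (h ▸ hi))

/-- A partial isometry with entries in `C` has the class of its initial projection. -/
theorem gcls_eq_gcls_star_mul_self {v : Matrix (Fin n) (Fin n) B} (hv : ∀ i j, v i j ∈ C)
    (h : IsNPi C v) : gcls C v = gcls C (star v * v) := by
  have hvv : v * star v * v = v := Matrix.mul_star_mul_self h.1.1
  have hE : emb v * star (emb v) * emb v = emb v := by
    rw [← emb_star, ← emb_mul, ← emb_mul, hvv]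
  have hz := blk_dilation_mem_unitary hE
  have hzC : EntriesIn C (blk (emb v) (1 - emb v * star (emb v)) (1 - star (emb v) * emb v)
      (star (emb v))) := by
    refine entriesIn_blk (entriesIn_emb hv) (entriesIn_one.sub ?_) (entriesIn_one.sub ?_)
      (entriesIn_emb hv).star
    · rw [← emb_star, ← emb_mul]
      exact entriesIn_emb (mul_mem (s := matAlg C n) hv (star_mem (s := matAlg C n) hv))
    · rw [← emb_star, ← emb_mul]
      exact entriesIn_emb (mul_mem (s := matAlg C n) (star_mem (s := matAlg C n) hv) hv)
  have hp : IsNPi C (star v * v) := isNPi_of_projection h.1.1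
    (mul_mem (s := matAlg C n) (star_mem (s := matAlg C n) hv) hv)
  symm
  -- Left multiplication by the dilation of `v` takes `v* v ⊕ 0` to `v ⊕ 0`: the lower block is `(1
  -- - v* v) v* v = 0`.
  refine gcls_eq_of_unitary hp h (N := n + n) (by omega) (by omega)
    (hzC.isNormalizingUnitary hz) isNormalizingUnitary_one ?_
  rw [mul_one, pad_eq_blk, pad_eq_blk, emb_blk, emb_blk, blk_mul]
  have hE' : emb v * (star (emb v) * emb v) = emb v := by rw [← mul_assoc, hE]
  simp only [emb_zero, emb_mul, emb_star, mul_zero, add_zero, sub_mul, one_mul, mul_assoc, hE',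
    sub_self]

theorem exists_eq_blk (x : Matrix (Fin (n + n)) (Fin (n + n)) B) (hx : ∀ i j, x i j ∈ C) :
    ∃ a ∈ matAlg C n, ∃ b ∈ matAlg C n, ∃ c ∈ matAlg C n, ∃ d ∈ matAlg C n, x = blk a b c d := by
  set x' := Matrix.reindex finSumFinEquiv.symm finSumFinEquiv.symm x
  refine ⟨x'.toBlocks₁₁, fun i j => hx _ _, x'.toBlocks₁₂, fun i j => hx _ _, x'.toBlocks₂₁,
    fun i j => hx _ _, x'.toBlocks₂₂, fun i j => hx _ _, ?_⟩
  rw [blk, Matrix.fromBlocks_toBlocks]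
  simp [x']

/-- A normalising partial isometry splits along a projection over `C` that commutes with its
initial projection. -/
theorem gcls_cut {v p : Matrix (Fin n) (Fin n) B} (hv : IsNPi C v) (hp : IsStarProjection p)
    (hpC : ∀ i j, p i j ∈ C) (hc : star v * v * p = p * (star v * v)) :
    IsNPi C (v * p) ∧ IsNPi C (v - v * p) ∧ gcls C v = gcls C (v * p) + gcls C (v - v * p) := by
  have hpp : p * p = p := hp.isIdempotentElem
  have hps : star p = p := hp.isSelfAdjoint
  have hpp' : ∀ x, p * (p * x) = p * x := fun x => by rw [← mul_assoc, hpp]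
  have hvv : v * star v * v = v := Matrix.mul_star_mul_self hv.1.1
  have hvv2 : ∀ x, v * (star v * (v * x)) = v * x := fun x => by
    rw [← mul_assoc, ← mul_assoc, hvv]
  have hc' : ∀ x, p * (star v * (v * x)) = star v * (v * (p * x)) := fun x => by
    simpa only [mul_assoc] using (congrArg (· * x) hc).symm
  have hcc : p * (star v * v) = star v * (v * p) := by rw [← hc, mul_assoc]
  have hvs : star v * (v * star v) = star v := by
    have := congrArg star hvv
    simpa [mul_assoc] using this
  have hC1 : ∀ x ∈ matAlg C n, v * x * star v ∈ matAlg C n := hv.2.1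
  have hC2 : ∀ x ∈ matAlg C n, star v * x * v ∈ matAlg C n := hv.2.2
  have hpC' : p ∈ matAlg C n := hpC
  -- `v p v*` is the final projection of `v p`, and left multiplication by it has the same effect on
  -- `v` as right multiplication by `p`.
  have hq : IsStarProjection (v * p * star v) := by
    constructor
    · rw [IsIdempotentElem]
      simp only [mul_assoc, hc', hpp', hvv2]
    · rw [IsSelfAdjoint]
      simp only [star_mul, star_star, hps, mul_assoc]
  have i11 : IsStarProjection (star (v * p) * (v * p)) := by
    have h1 : star (v * p) * (v * p) = star v * v * p := by
      simp only [star_mul, hps, mul_assoc, hc', hpp]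
    rw [h1]
    exact hv.1.1.mul hp hc
  have i12 : IsStarProjection (v * p * star (v * p)) := by
    have h1 : v * p * star (v * p) = v * p * star v := by
      simp only [star_mul, hps, mul_assoc, hpp']
    rw [h1]
    exact hq
  have i21 : IsStarProjection (star (v - v * p) * (v - v * p)) := by
    have h1 : star (v - v * p) * (v - v * p) = star v * v - star v * v * p := by
      simp only [star_sub, star_mul, hps, mul_sub, sub_mul, mul_assoc, hcc, hc', hpp, sub_self,
        sub_zero]
    rw [h1]
    refine (hv.1.1.mul hp hc).sub_of_mul_eq_left hv.1.1 ?_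
    simp only [mul_assoc, hcc, hvv2]
  have i22 : IsStarProjection ((v - v * p) * star (v - v * p)) := by
    have h1 : (v - v * p) * star (v - v * p) = v * star v - v * p * star v := by
      simp only [star_sub, star_mul, hps, mul_sub, sub_mul, mul_assoc, hpp', sub_self,
        sub_zero]
    rw [h1]
    refine hq.sub_of_mul_eq_left hv.1.2 ?_
    simp only [mul_assoc, hvs]
  -- For the direct sum to normalise, mixed products of the two pieces must also land over `C`. Each
  -- has the form `v x' v*`, or is obtained from `v* x v` by multiplying with `p`.
  have n11 : ∀ x ∈ matAlg C n, v * p * x * star (v * p) ∈ matAlg C n := fun x hx => by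
    have : v * p * x * star (v * p) = v * (p * x * p) * star v := by
      simp only [star_mul, hps, mul_assoc]
    rw [this]
    exact hC1 _ (mul_mem (mul_mem hpC' hx) hpC')
  have n12 : ∀ x ∈ matAlg C n, v * p * x * star (v - v * p) ∈ matAlg C n := fun x hx => by
    have : v * p * x * star (v - v * p) = v * (p * x - p * x * p) * star v := by
      simp only [star_sub, star_mul, hps, mul_assoc, mul_sub, sub_mul]
    rw [this]
    exact hC1 _ (sub_mem (mul_mem hpC' hx) (mul_mem (mul_mem hpC' hx) hpC'))
  have n21 : ∀ x ∈ matAlg C n, (v - v * p) * x * star (v * p) ∈ matAlg C n := fun x hx => by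
    have : (v - v * p) * x * star (v * p) = v * (x * p - p * x * p) * star v := by
      simp only [star_mul, hps, mul_assoc, mul_sub, sub_mul]
    rw [this]
    exact hC1 _ (sub_mem (mul_mem hx hpC') (mul_mem (mul_mem hpC' hx) hpC'))
  have n22 : ∀ x ∈ matAlg C n, (v - v * p) * x * star (v - v * p) ∈ matAlg C n := fun x hx => by
    have : (v - v * p) * x * star (v - v * p) =
        v * (x - p * x - (x * p - p * x * p)) * star v := by
      simp only [star_sub, star_mul, hps, mul_assoc, mul_sub, sub_mul]
    rw [this]
    exact hC1 _ (sub_mem (sub_mem hx (mul_mem hpC' hx))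
      (sub_mem (mul_mem hx hpC') (mul_mem (mul_mem hpC' hx) hpC')))
  have m11 : ∀ x ∈ matAlg C n, star (v * p) * x * (v * p) ∈ matAlg C n := fun x hx => by
    have : star (v * p) * x * (v * p) = p * (star v * x * v) * p := by
      simp only [star_mul, hps, mul_assoc]
    rw [this]
    exact mul_mem (mul_mem hpC' (hC2 x hx)) hpC'
  have m12 : ∀ x ∈ matAlg C n, star (v * p) * x * (v - v * p) ∈ matAlg C n := fun x hx => by
    have : star (v * p) * x * (v - v * p) =
        p * (star v * x * v) - p * (star v * x * v) * p := by
      simp only [star_mul, hps, mul_assoc, mul_sub]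
    rw [this]
    exact sub_mem (mul_mem hpC' (hC2 x hx)) (mul_mem (mul_mem hpC' (hC2 x hx)) hpC')
  have m21 : ∀ x ∈ matAlg C n, star (v - v * p) * x * (v * p) ∈ matAlg C n := fun x hx => by
    have : star (v - v * p) * x * (v * p) =
        (star v * x * v) * p - p * (star v * x * v) * p := by
      simp only [star_sub, star_mul, hps, mul_assoc, sub_mul]
    rw [this]
    exact sub_mem (mul_mem (hC2 x hx) hpC') (mul_mem (mul_mem hpC' (hC2 x hx)) hpC')
  have m22 : ∀ x ∈ matAlg C n, star (v - v * p) * x * (v - v * p) ∈ matAlg C n := fun x hx => by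
    have : star (v - v * p) * x * (v - v * p) =
        (star v * x * v) - p * (star v * x * v) -
          ((star v * x * v) * p - p * (star v * x * v) * p) := by
      simp only [star_sub, star_mul, hps, mul_assoc, sub_mul, mul_sub]
    rw [this]
    exact sub_mem (sub_mem (hC2 x hx) (mul_mem hpC' (hC2 x hx)))
      (sub_mem (mul_mem (hC2 x hx) hpC') (mul_mem (mul_mem hpC' (hC2 x hx)) hpC'))
  have hN1 : IsNPi C (v * p) := ⟨⟨i11, i12⟩, n11, m11⟩
  have hN2 : IsNPi C (v - v * p) := ⟨⟨i21, i22⟩, n22, m22⟩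
  have hD : IsNPi C (dsumMat (v * p) (v - v * p)) := by
    refine ⟨⟨?_, ?_⟩, ?_, ?_⟩
    · rw [Matrix.star_eq_conjTranspose, conjTranspose_dsumMat, dsumMat_mul]
      exact isStarProjection_dsumMat i11 i21
    · rw [Matrix.star_eq_conjTranspose, conjTranspose_dsumMat, dsumMat_mul]
      exact isStarProjection_dsumMat i12 i22
    · intro x hx
      obtain ⟨a, ha, b, hb, c, hc, d, hd, rfl⟩ := exists_eq_blk x hx
      change blk (v * p) 0 0 (v - v * p) * blk a b c d * star (blk (v * p) 0 0 (v - v * p)) ∈ _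
      rw [star_blk, blk_mul, blk_mul]
      simp only [zero_mul, mul_zero, add_zero, zero_add, star_zero]
      exact blk_mem (S := (C : Set B)) (n11 a ha) (n12 b hb) (n21 c hc) (n22 d hd)
    · intro x hx
      obtain ⟨a, ha, b, hb, c, hc, d, hd, rfl⟩ := exists_eq_blk x hx
      change star (blk (v * p) 0 0 (v - v * p)) * blk a b c d * (blk (v * p) 0 0 (v - v * p)) ∈ _
      rw [star_blk, blk_mul, blk_mul]
      simp only [zero_mul, mul_zero, add_zero, zero_add, star_zero]
      exact blk_mem (S := (C : Set B)) (m11 a ha) (m12 b hb) (m21 c hc) (m22 d hd)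
  refine ⟨hN1, hN2, ?_⟩
  rw [← gcls_dsumMat hN1 hN2 hD]
  have hqC : ∀ i j, (v * p * star v) i j ∈ C := hC1 p hpC'
  have hZ : EntriesIn C (blk (emb (v * p * star v)) (1 - emb (v * p * star v))
      (1 - emb (v * p * star v)) (emb (v * p * star v))) :=
    entriesIn_blk (entriesIn_emb hqC) (entriesIn_one.sub (entriesIn_emb hqC))
      (entriesIn_one.sub (entriesIn_emb hqC)) (entriesIn_emb hqC)
  have hY : EntriesIn C (blk (emb p) (1 - emb p) (1 - emb p) (emb p)) :=
    entriesIn_blk (entriesIn_emb hpC) (entriesIn_one.sub (entriesIn_emb hpC))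
      (entriesIn_one.sub (entriesIn_emb hpC)) (entriesIn_emb hpC)
  -- With `q = v p v*` the product has blocks `q v p`, `q v (1 - p)`, `(1 - q) v p`, `(1 - q) v (1 -
  -- p)`. Since `q v = v p`, they are `v p`, `0`, `0`, `v - v p`.
  refine gcls_eq_of_unitary hv hD (N := n + n) (by omega) le_rfl
    (hZ.isNormalizingUnitary (blk_projection_mem_unitary (isStarProjection_emb hq)))
    (hY.isNormalizingUnitary (blk_projection_mem_unitary (isStarProjection_emb hp))) ?_
  rw [pad_self, pad_eq_blk, emb_blk, blk_mul, blk_mul]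
  change _ = emb (blk (v * p) 0 0 (v - v * p))
  rw [emb_blk]
  have e1 : v * (p * (star v * v)) = v * p := by rw [hcc, hvv2]
  simp only [emb_zero, mul_zero, add_zero, zero_mul, mul_sub, sub_mul, one_mul, mul_one,
    ← emb_mul, ← emb_sub, mul_assoc, e1, hpp, sub_self, sub_zero]

end NormalizingPartialIsometries

/-! ### Swaps of diagonal matrix units as normalising unitaries -/

section Swap

variable {B : Type u} [NonUnitalCStarAlgebra B] {n : ℕ}

/-- The unitary that exchanges two diagonal matrix units of the same block. -/
def MatrixUnits.swap (E : MatrixUnits B) (s : Fin E.r) (i j : Fin (E.d s)) : Unitization ℂ B :=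
  1 - E.e s i i - E.e s j j + E.e s j i + E.e s i j

theorem MatrixUnits.star_swap (E : MatrixUnits B) (s : Fin E.r) (i j : Fin (E.d s)) :
    star (E.swap s i j) = E.swap s i j := by
  simp only [swap, star_add, star_sub, _root_.star_one, ← Unitization.inr_star, E.star_e]
  abel

theorem MatrixUnits.swap_mul_swap (E : MatrixUnits B) (s : Fin E.r) {i j : Fin (E.d s)}
    (hij : i ≠ j) : E.swap s i j * E.swap s i j = 1 := by
  have h1 : ∀ a b, E.e s a i * E.e s j b = 0 := fun a b => E.mul_index_ne _ _ _ _ _ hij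
  have h2 : ∀ a b, E.e s a j * E.e s i b = 0 := fun a b => E.mul_index_ne _ _ _ _ _ hij.symm
  simp only [swap, add_mul, sub_mul, mul_add, mul_sub, one_mul, mul_one, ← Unitization.inr_mul,
    E.mul_same, h1, h2, Unitization.inr_zero]
  abel

/-- As `x` commutes with the diagonal units, all cross terms vanish. What remains is `x` cut by `1 -
e_ii - e_jj` together with two conjugates of `x` by matrix units, which normalise `C`. -/
theorem IsAFSystem.swap_conj_mem {C : NonUnitalStarSubalgebra ℂ B} {E : ℕ → MatrixUnits B}
    (h : IsAFSystem C E) {k : ℕ} (s : Fin (E k).r) {i j : Fin ((E k).d s)} (hij : i ≠ j) {x : B}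
    (hx : x ∈ C) :
    ∃ y ∈ C, (E k).swap s i j * (x : Unitization ℂ B) * (E k).swap s i j = y := by
  have hpx : (E k).e s i i * x = x * (E k).e s i i := h.dg_commute ⟨s, i⟩ hx
  have hqx : (E k).e s j j * x = x * (E k).e s j j := h.dg_commute ⟨s, j⟩ hx
  have h1 : ∀ a b, (E k).e s a i * (E k).e s j b = 0 :=
    fun a b => (E k).mul_index_ne _ _ _ _ _ hij
  have h2 : ∀ a b, (E k).e s a j * (E k).e s i b = 0 :=
    fun a b => (E k).mul_index_ne _ _ _ _ _ hij.symm
  refine ⟨x - x * (E k).e s i i - x * (E k).e s j j + (E k).e s j i * x * (E k).e s i j +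
    (E k).e s i j * x * (E k).e s j i, ?_, ?_⟩
  · have hi : (E k).e s i i ∈ C := h.dg_mem k ⟨s, i⟩
    have hj : (E k).e s j j ∈ C := h.dg_mem k ⟨s, j⟩
    have hc1 := h.conj_mem (b := (E k).e s j i) ⟨s, j, i, rfl⟩ hx
    have hc2 := h.conj_mem (b := (E k).e s i j) ⟨s, i, j, rfl⟩ hx
    rw [(E k).star_e] at hc1 hc2
    exact add_mem (add_mem (sub_mem (sub_mem hx (mul_mem hx hi)) (mul_mem hx hj)) hc1) hc2
  · have pa : ∀ b, (E k).e s i i * x * (E k).e s i b = x * (E k).e s i b := fun b => by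
      rw [hpx, mul_assoc, (E k).mul_same]
    have pb : ∀ b, (E k).e s i i * x * (E k).e s j b = 0 := fun b => by
      rw [hpx, mul_assoc, h1, mul_zero]
    have qa : ∀ b, (E k).e s j j * x * (E k).e s j b = x * (E k).e s j b := fun b => by
      rw [hqx, mul_assoc, (E k).mul_same]
    have qb : ∀ b, (E k).e s j j * x * (E k).e s i b = 0 := fun b => by
      rw [hqx, mul_assoc, h2, mul_zero]
    have wp : (E k).e s j i * x * (E k).e s i i = (E k).e s j i * x := by
      rw [mul_assoc, ← hpx, ← mul_assoc, (E k).mul_same]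
    have wq : ∀ b, (E k).e s j i * x * (E k).e s j b = 0 := fun b => by
      rw [← (E k).mul_same s j j b, mul_assoc, ← mul_assoc x, ← hqx, ← mul_assoc, ← mul_assoc, h1,
        zero_mul, zero_mul]
    have vq : (E k).e s i j * x * (E k).e s j j = (E k).e s i j * x := by
      rw [mul_assoc, ← hqx, ← mul_assoc, (E k).mul_same]
    have vp : ∀ b, (E k).e s i j * x * (E k).e s i b = 0 := fun b => by
      rw [← (E k).mul_same s i i b, mul_assoc, ← mul_assoc x, ← hpx, ← mul_assoc, ← mul_assoc, h2,
        zero_mul, zero_mul]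
    simp only [MatrixUnits.swap, add_mul, sub_mul, mul_add, mul_sub, one_mul, mul_one,
      ← Unitization.inr_mul, ← Unitization.inr_add, ← Unitization.inr_sub, pa, pb, qa, qb, wp, wq,
      vp, vq]
    simp only [hpx, hqx]
    congr 1
    abel

/-- The diagonal matrix of swaps is a normalising unitary. -/
theorem IsAFSystem.isNormalizingUnitary_swap {C : NonUnitalStarSubalgebra ℂ B}
    {E : ℕ → MatrixUnits B} (h : IsAFSystem C E) {k : ℕ} (s : Fin (E k).r)
    {i j : Fin ((E k).d s)} (hij : i ≠ j) :
    IsNormalizingUnitary C (Matrix.diagonal fun _ : Fin n => (E k).swap s i j) := by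
  have hs : star (Matrix.diagonal fun _ : Fin n => (E k).swap s i j) =
      Matrix.diagonal fun _ : Fin n => (E k).swap s i j := by
    rw [Matrix.star_eq_conjTranspose, Matrix.diagonal_conjTranspose]
    congr 1
    funext _
    exact (E k).star_swap s i j
  have hm : (Matrix.diagonal fun _ : Fin n => (E k).swap s i j) *
      (Matrix.diagonal fun _ : Fin n => (E k).swap s i j) = 1 := by
    rw [Matrix.diagonal_mul_diagonal, ← Matrix.diagonal_one]
    congr 1
    funext _
    exact (E k).swap_mul_swap s hij
  have hconj : ∀ x ∈ emb '' (C : Set B).matrix (m := Fin n) (n := Fin n),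
      (Matrix.diagonal fun _ : Fin n => (E k).swap s i j) * x *
        (Matrix.diagonal fun _ : Fin n => (E k).swap s i j) ∈ emb '' (C : Set B).matrix := by
    rintro _ ⟨x, hx, rfl⟩
    have hy : ∀ a b, ∃ y ∈ C,
        (E k).swap s i j * (x a b : Unitization ℂ B) * (E k).swap s i j = y :=
      fun a b => h.swap_conj_mem s hij (hx a b)
    choose y hyC hy using hy
    refine ⟨Matrix.of y, hyC, ?_⟩
    refine Matrix.ext fun a b => ?_
    rw [Matrix.mul_diagonal, Matrix.diagonal_mul]
    exact (hy a b).symm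
  refine ⟨Unitary.mem_iff.2 ⟨by rw [hs, hm], by rw [hs, hm]⟩, ?_, ?_⟩
  · rw [hs]; exact hconj
  · rw [hs]; exact hconj

end Swap

/-! ### Approximate unit, and initial projections over `C` -/

section InitialProjection

variable {B : Type u} [NonUnitalCStarAlgebra B] {n : ℕ} {C : NonUnitalStarSubalgebra ℂ B}
  {E : ℕ → MatrixUnits B}

-- The units of the levels form an approximate unit: each eventually fixes any given element of the
-- dense union.
open Filter Topology in
theorem IsAFSystem.tendsto_one_mul (h : IsAFSystem C E) (b : B) :
    Tendsto (fun k => (E k).one * b) atTop (𝓝 b) := by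
  rw [Metric.tendsto_atTop]
  intro ε hε
  have hbd : b ∈ closure (⋃ k, ((E k).alg : Set B)) := by rw [h.dense]; trivial
  obtain ⟨c, hc, hbc⟩ := Metric.mem_closure_iff.1 hbd (ε / 2) (by positivity)
  obtain ⟨k₀, hk₀⟩ := Set.mem_iUnion.1 hc
  refine ⟨k₀, fun k hk => ?_⟩
  have h1 : (E k).one * c = c := (E k).one_mul_alg (h.monotone_alg hk hk₀)
  have h2 : (E k).one * b - b = (E k).one * (b - c) - (b - c) := by
    rw [mul_sub, h1]; abel
  rw [dist_eq_norm] at hbc ⊢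
  rw [h2]
  have h3 := norm_sub_le ((E k).one * (b - c)) (b - c)
  have h4 : ‖(E k).one * (b - c)‖ ≤ ‖b - c‖ :=
    (norm_mul_le _ _).trans
      (mul_le_of_le_one_left (norm_nonneg _) (E k).isStarProjection_one.norm_le)
  linarith

/-- The scalar matrix with diagonal entry `x`. -/
def sc (n : ℕ) (x : B) : Matrix (Fin n) (Fin n) B := Matrix.diagonal fun _ => x

theorem sc_mul_apply (x : B) (v : Matrix (Fin n) (Fin n) B) (i j : Fin n) :
    (sc n x * v) i j = x * v i j := Matrix.diagonal_mul _ _ _ _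

theorem mul_sc_apply (x : B) (v : Matrix (Fin n) (Fin n) B) (i j : Fin n) :
    (v * sc n x) i j = v i j * x := Matrix.mul_diagonal _ _ _ _

theorem sc_mul_sc (x y : B) : sc n x * sc n y = sc n (x * y) := Matrix.diagonal_mul_diagonal _ _

theorem star_sc (x : B) : star (sc n x) = sc n (star x) := by
  rw [sc, Matrix.star_eq_conjTranspose, Matrix.diagonal_conjTranspose]; rfl

theorem sc_add (x y : B) : sc n (x + y) = sc n x + sc n y := (Matrix.diagonal_add _ _).symm

theorem sc_zero : sc n (0 : B) = 0 := Matrix.diagonal_zero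

theorem isStarProjection_sc {x : B} (hx : IsStarProjection x) : IsStarProjection (sc n x) :=
  ⟨by rw [IsIdempotentElem, sc_mul_sc, hx.isIdempotentElem.eq],
    by rw [IsSelfAdjoint, star_sc, hx.isSelfAdjoint.star_eq]⟩

theorem sc_mem {x : B} (hx : x ∈ C) : ∀ i j, sc n x i j ∈ C := by
  intro i j
  by_cases hij : i = j
  · subst hij; simpa [sc] using hx
  · rw [sc, Matrix.diagonal_apply_ne _ hij]; exact zero_mem C

theorem IsAFSystem.sc_commute (h : IsAFSystem C E) {x : B} (hx : x ∈ C)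
    {v : Matrix (Fin n) (Fin n) B} (hv : v ∈ matAlg C n) : sc n x * v = v * sc n x := by
  refine Matrix.ext fun i j => ?_
  rw [sc_mul_apply, mul_sc_apply, h.mul_comm hx (hv i j)]

/-- The initial projection of a normalising partial isometry has entries in `C`. -/
theorem IsAFSystem.star_mul_self_mem (h : IsAFSystem C E) {v : Matrix (Fin n) (Fin n) B}
    (hv : IsNPi C v) : star v * v ∈ matAlg C n := by
  intro i j
  -- Without a unit in `C`, the normalising property does not apply to `v* 1 v` directly; `v* v` is
  -- obtained as the limit of `v* (one k) v`.
  have h1 : ∀ k, (star v * (sc n (E k).one * v)) i j =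
      ∑ a, star (v a i) * ((E k).one * v a j) := by
    intro k
    rw [Matrix.mul_apply]
    refine Finset.sum_congr rfl fun a _ => ?_
    rw [sc_mul_apply, Matrix.star_apply]
  have h2 : (star v * v) i j = ∑ a, star (v a i) * v a j := by
    rw [Matrix.mul_apply]; rfl
  have h3 : Filter.Tendsto (fun k => (star v * (sc n (E k).one * v)) i j) Filter.atTop
      (nhds ((star v * v) i j)) := by
    simp only [h1, h2]
    refine tendsto_finsetSum _ fun a _ => ?_
    exact (h.tendsto_one_mul (v a j)).const_mul _
  refine h.isClosed.mem_of_tendsto h3 (Filter.Eventually.of_forall fun k => ?_)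
  have h4 := hv.2.2 (sc n (E k).one) (sc_mem (h.one_mem k))
  rw [mul_assoc] at h4
  exact h4 i j

theorem IsNPi.star {v : Matrix (Fin n) (Fin n) B} (hv : IsNPi C v) : IsNPi C (star v) := by
  refine ⟨⟨?_, ?_⟩, ?_, ?_⟩
  · rw [star_star]; exact hv.1.2
  · rw [star_star]; exact hv.1.1
  · rw [star_star]; exact hv.2.2
  · rw [star_star]; exact hv.2.1

theorem IsAFSystem.mul_star_self_mem (h : IsAFSystem C E) {v : Matrix (Fin n) (Fin n) B}
    (hv : IsNPi C v) : v * star v ∈ matAlg C n := by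
  simpa using h.star_mul_self_mem hv.star

theorem IsAFSystem.isNPi_mul_sc (h : IsAFSystem C E) {v : Matrix (Fin n) (Fin n) B}
    (hv : IsNPi C v) {x : B} (hx : IsStarProjection x) (hxC : x ∈ C) : IsNPi C (v * sc n x) :=
  (gcls_cut hv (isStarProjection_sc hx) (sc_mem hxC)
    (h.sc_commute hxC (h.star_mul_self_mem hv)).symm).1

theorem IsAFSystem.isNPi_sc_mul (h : IsAFSystem C E) {v : Matrix (Fin n) (Fin n) B}
    (hv : IsNPi C v) {x : B} (hx : IsStarProjection x) (hxC : x ∈ C) : IsNPi C (sc n x * v) := by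
  have := (h.isNPi_mul_sc hv.star hx hxC).star
  rwa [star_mul, star_star, star_sc, hx.isSelfAdjoint.star_eq] at this

end InitialProjection

/-! ### Regularity under cutting and under normalising unitaries -/

section Regularity

variable {B : Type u} [NonUnitalCStarAlgebra B] {n : ℕ} {C : NonUnitalStarSubalgebra ℂ B}
  {E : ℕ → MatrixUnits B}

/-- `v` is a normalising partial isometry with the same class as its initial projection. -/
def IsRegular (C : NonUnitalStarSubalgebra ℂ B) (v : Matrix (Fin n) (Fin n) B) : Prop :=
  IsNPi C v ∧ gcls C v = gcls C (star v * v)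

theorem isRegular_zero : IsRegular C (0 : Matrix (Fin n) (Fin n) B) :=
  ⟨isNPi_of_projection (.zero _) fun _ _ => zero_mem C, by rw [mul_zero]⟩

/-- The initial projections of the two pieces are orthogonal with sum `v* v`, so both sides of the
desired equality split in the same way. -/
theorem IsAFSystem.isRegular_of_cut (h : IsAFSystem C E) {v p : Matrix (Fin n) (Fin n) B}
    (hv : IsNPi C v) (hp : IsStarProjection p) (hpC : ∀ i j, p i j ∈ C)
    (hc : star v * v * p = p * (star v * v)) (h1 : IsRegular C (v * p))
    (h2 : IsRegular C (v - v * p)) : IsRegular C v := by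
  refine ⟨hv, ?_⟩
  rw [(gcls_cut hv hp hpC hc).2.2, h1.2, h2.2, ← gcls_add_of_orthogonal h1.1.1.1
    (h.star_mul_self_mem h1.1) h2.1.1.1 (h.star_mul_self_mem h2.1)]
  · congr 1
    have hpp : p * p = p := hp.isIdempotentElem
    have hps : star p = p := hp.isSelfAdjoint
    have hcc : p * (star v * v) = star v * (v * p) := by rw [← hc, mul_assoc]
    have hc' : p * (star v * (v * p)) = star v * (v * p) := by
      rw [← mul_assoc (star v), ← mul_assoc, ← hc, mul_assoc, hpp, mul_assoc]
    simp only [star_sub, star_mul, hps, mul_sub, sub_mul, mul_assoc, hcc, hc']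
    abel
  · have hpp : p * p = p := hp.isIdempotentElem
    have h3 : v * p * star (v - v * p) = 0 := by
      rw [star_sub, star_mul, hp.isSelfAdjoint.star_eq, mul_sub, mul_assoc v p (p * star v),
        ← mul_assoc p p, hpp, mul_assoc, sub_self]
    have h4 : v * p * (star (v - v * p) * (v - v * p)) = 0 := by
      rw [← mul_assoc, h3, zero_mul]
    rw [mul_assoc, h4, mul_zero]

theorem MatrixUnits.isStarProjection_sum_dg (E : MatrixUnits B) (t : Finset E.Idx) :
    IsStarProjection (∑ b ∈ t, E.dg b) := by
  classical
  constructor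
  · rw [IsIdempotentElem, Finset.sum_mul_sum]
    refine Finset.sum_congr rfl fun b hb => ?_
    rw [Finset.sum_eq_single b]
    · exact E.dg_mul_self b
    · intro c _ hc
      exact E.dg_mul_ne (Ne.symm hc)
    · intro hb'; exact (hb' hb).elim
  · rw [IsSelfAdjoint, star_sum]
    exact Finset.sum_congr rfl fun b _ => (E.isStarProjection_dg b).isSelfAdjoint

theorem IsAFSystem.isRegular_mul_sum (h : IsAFSystem C E) {v : Matrix (Fin n) (Fin n) B}
    (hv : IsNPi C v) (k : ℕ) (s : Finset (E k).Idx)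
    (hs : ∀ a ∈ s, IsRegular C (v * sc n ((E k).dg a))) :
    IsRegular C (v * sc n (∑ a ∈ s, (E k).dg a)) := by
  classical
  induction s using Finset.induction_on with
  | empty => rw [Finset.sum_empty, sc_zero, mul_zero]; exact isRegular_zero
  | insert a s ha ih =>
    have hort : ∀ t : Finset (E k).Idx, a ∉ t → (∑ b ∈ t, (E k).dg b) * (E k).dg a = 0 := by
      intro t hat
      rw [Finset.sum_mul]
      exact Finset.sum_eq_zero fun b hb => (E k).dg_mul_ne (fun hba => hat (hba ▸ hb))
    have hmem : ∑ b ∈ insert a s, (E k).dg b ∈ C := sum_mem fun b _ => h.dg_mem k b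
    have hN := h.isNPi_mul_sc hv ((E k).isStarProjection_sum_dg (insert a s)) hmem
    have h1 : v * sc n (∑ b ∈ insert a s, (E k).dg b) * sc n ((E k).dg a) =
        v * sc n ((E k).dg a) := by
      rw [mul_assoc, sc_mul_sc, Finset.sum_insert ha, add_mul, (E k).dg_mul_self, hort s ha,
        add_zero]
    have h2 : v * sc n (∑ b ∈ insert a s, (E k).dg b) - v * sc n ((E k).dg a) =
        v * sc n (∑ b ∈ s, (E k).dg b) := by
      rw [Finset.sum_insert ha, sc_add, mul_add, add_sub_cancel_left]
    refine h.isRegular_of_cut hN (isStarProjection_sc ((E k).isStarProjection_dg a))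
      (sc_mem (h.dg_mem k a))
      (h.sc_commute (h.dg_mem k a) (h.star_mul_self_mem hN)).symm ?_ ?_
    · rw [h1]; exact hs a (Finset.mem_insert_self _ _)
    · rw [h1, h2]; exact ih fun b hb => hs b (Finset.mem_insert_of_mem hb)

/-- Cutting on the left. -/
theorem IsAFSystem.isRegular_of_left_cut (h : IsAFSystem C E) {v : Matrix (Fin n) (Fin n) B}
    (hv : IsNPi C v) {x : B} (hx : IsStarProjection x) (hxC : x ∈ C)
    (h1 : IsRegular C (sc n x * v)) (h2 : IsRegular C (v - sc n x * v)) : IsRegular C v := by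
  have hvv : v * star v * v = v := Matrix.mul_star_mul_self hv.1.1
  have hq := isStarProjection_sc (n := n) hx
  have hcomm := h.sc_commute hxC (h.mul_star_self_mem hv)
  have hvp : v * (star v * sc n x * v) = sc n x * v := by
    rw [← mul_assoc, ← mul_assoc, ← hcomm, mul_assoc, hvv]
  have hpv : star v * v * (star v * sc n x * v) = star v * sc n x * v := by
    rw [mul_assoc, hvp, ← mul_assoc]
  have hps : star (star v * sc n x * v) = star v * sc n x * v := by
    rw [star_mul, star_mul, star_star, hq.isSelfAdjoint.star_eq, mul_assoc]
  have hpp : star v * sc n x * v * (star v * sc n x * v) = star v * sc n x * v := by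
    rw [mul_assoc (star v * sc n x), hvp, mul_assoc (star v), ← mul_assoc (sc n x),
      hq.isIdempotentElem.eq, ← mul_assoc]
  -- Cutting by `x` on the left is cutting by `v* x v` on the right, because `x` commutes with `v
  -- v*`.
  refine h.isRegular_of_cut hv (p := star v * sc n x * v) ⟨hpp, hps⟩
    (hv.2.2 _ (sc_mem hxC)) ?_ ?_ ?_
  · have := congrArg star hpv
    rw [star_mul, hps, star_mul, star_star] at this
    rw [hpv, this]
  · rw [hvp]; exact h1
  · rw [hvp]; exact h2

theorem IsAFSystem.isRegular_sum_mul (h : IsAFSystem C E) {v : Matrix (Fin n) (Fin n) B}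
    (hv : IsNPi C v) (k : ℕ) (s : Finset (E k).Idx)
    (hs : ∀ a ∈ s, IsRegular C (sc n ((E k).dg a) * v)) :
    IsRegular C (sc n (∑ a ∈ s, (E k).dg a) * v) := by
  classical
  induction s using Finset.induction_on with
  | empty => rw [Finset.sum_empty, sc_zero, zero_mul]; exact isRegular_zero
  | insert a s ha ih =>
    have hort : ∀ t : Finset (E k).Idx, a ∉ t → (E k).dg a * (∑ b ∈ t, (E k).dg b) = 0 := by
      intro t hat
      rw [Finset.mul_sum]
      exact Finset.sum_eq_zero fun b hb => (E k).dg_mul_ne (fun hba => hat (hba ▸ hb))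
    have hmem : ∑ b ∈ insert a s, (E k).dg b ∈ C := sum_mem fun b _ => h.dg_mem k b
    have hN := h.isNPi_sc_mul hv ((E k).isStarProjection_sum_dg (insert a s)) hmem
    have h1 : sc n ((E k).dg a) * (sc n (∑ b ∈ insert a s, (E k).dg b) * v) =
        sc n ((E k).dg a) * v := by
      rw [← mul_assoc, sc_mul_sc, Finset.sum_insert ha, mul_add, (E k).dg_mul_self, hort s ha,
        add_zero]
    have h2 : sc n (∑ b ∈ insert a s, (E k).dg b) * v - sc n ((E k).dg a) * v =
        sc n (∑ b ∈ s, (E k).dg b) * v := by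
      rw [Finset.sum_insert ha, sc_add, add_mul, add_sub_cancel_left]
    refine h.isRegular_of_left_cut hN ((E k).isStarProjection_dg a) (h.dg_mem k a) ?_ ?_
    · rw [h1]; exact hs a (Finset.mem_insert_self _ _)
    · rw [h1, h2]; exact ih fun b hb => hs b (Finset.mem_insert_of_mem hb)

/-- Regularity is invariant under right multiplication by normalising unitaries. -/
theorem IsAFSystem.isRegular_of_mul_unitary (h : IsAFSystem C E)
    {v w : Matrix (Fin n) (Fin n) B} (hv : IsNPi C v)
    {y : Matrix (Fin n) (Fin n) (Unitization ℂ B)} (hy : IsNormalizingUnitary C y)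
    (hvy : emb v * y = emb w) :
    IsNPi C w ∧ (IsRegular C w → IsRegular C v) := by
  have hy1 : star y * y = 1 := (Unitary.mem_iff.1 hy.1).1
  have hy2 : y * star y = 1 := (Unitary.mem_iff.1 hy.1).2
  have hww : w * star w = v * star v := by
    apply emb_injective
    rw [emb_mul, emb_mul, emb_star, emb_star, ← hvy, star_mul, mul_assoc, ← mul_assoc y, hy2,
      one_mul]
  have hw : emb (star w * w) = star y * emb (star v * v) * y := by
    rw [emb_mul, emb_mul, emb_star, emb_star, ← hvy, star_mul]
    simp only [mul_assoc]
  have hproj : IsStarProjection (star w * w) := by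
    have hvE := isStarProjection_emb hv.1.1
    constructor
    · apply emb_injective
      rw [emb_mul, hw, mul_assoc, ← mul_assoc y, ← mul_assoc y, hy2, one_mul, mul_assoc,
        ← mul_assoc (emb _), hvE.isIdempotentElem.eq, ← mul_assoc]
    · exact .star_mul_self w
  have hwN : IsNPi C w := by
    refine ⟨⟨hproj, by rw [hww]; exact hv.1.2⟩, ?_, ?_⟩
    · intro x hx
      obtain ⟨x', hx', hxx'⟩ := hy.2.1 (emb x) ⟨x, hx, rfl⟩
      have h1 : w * x * star w = v * x' * star v := by
        apply emb_injective
        rw [emb_mul, emb_mul, emb_mul, emb_mul, hxx', emb_star, emb_star, ← hvy, star_mul]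
        simp only [mul_assoc]
      rw [h1]
      exact hv.2.1 x' hx'
    · intro x hx
      obtain ⟨x', hx', hxx'⟩ := hy.2.2 (emb (star v * x * v)) ⟨_, hv.2.2 x hx, rfl⟩
      have h1 : star w * x * w = x' := by
        apply emb_injective
        rw [hxx', emb_mul, emb_mul, emb_mul, emb_mul, emb_star, emb_star, ← hvy, star_mul]
        simp only [mul_assoc]
      rw [h1]
      exact hx'
  refine ⟨hwN, fun hreg => ⟨hv, ?_⟩⟩
  -- One unitary serves twice: `v y = w`, and conjugation by `y*` takes `v* v` to `w* w`.
  have h1 : gcls C v = gcls C w :=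
    gcls_eq_of_unitary hv hwN le_rfl le_rfl isNormalizingUnitary_one hy
      (by rw [pad_self, pad_self, one_mul, hvy])
  have h2 : gcls C (star v * v) = gcls C (star w * w) :=
    gcls_eq_of_unitary (isNPi_of_projection hv.1.1 (h.star_mul_self_mem hv))
      (isNPi_of_projection hproj (h.star_mul_self_mem hwN)) le_rfl le_rfl hy.star hy
      (by rw [pad_self, pad_self, hw])
  rw [h1, h2, hreg.2]

end Regularity

/-! ### The C*-norm on matrices -/

section MatrixNorm

variable {B : Type u} [NonUnitalCStarAlgebra B] {n : ℕ}

/-- The C*-norm of a matrix. -/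
noncomputable def mnorm (v : Matrix (Fin n) (Fin n) B) : ℝ := ‖CStarMatrix.ofMatrix v‖

theorem mnorm_nonneg (v : Matrix (Fin n) (Fin n) B) : 0 ≤ mnorm v := norm_nonneg _

theorem mnorm_mul_le (v w : Matrix (Fin n) (Fin n) B) : mnorm (v * w) ≤ mnorm v * mnorm w :=
  norm_mul_le (CStarMatrix.ofMatrix v) (CStarMatrix.ofMatrix w)

theorem mnorm_sub_le (v w : Matrix (Fin n) (Fin n) B) : mnorm (v - w) ≤ mnorm v + mnorm w :=
  norm_sub_le (CStarMatrix.ofMatrix v) (CStarMatrix.ofMatrix w)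

theorem mnorm_star (v : Matrix (Fin n) (Fin n) B) : mnorm (star v) = mnorm v :=
  norm_star (CStarMatrix.ofMatrix v)

theorem mnorm_star_mul_self (v : Matrix (Fin n) (Fin n) B) :
    mnorm (star v * v) = mnorm v * mnorm v :=
  CStarRing.norm_star_mul_self (x := CStarMatrix.ofMatrix v)

theorem mnorm_eq_zero {v : Matrix (Fin n) (Fin n) B} : mnorm v = 0 ↔ v = 0 :=
  norm_eq_zero (a := CStarMatrix.ofMatrix v)

theorem eq_zero_of_mnorm_lt_one {v : Matrix (Fin n) (Fin n) B}
    (hv : IsStarProjection (star v * v)) (h : mnorm v < 1) : v = 0 :=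
  eq_zero_of_isStarProjection_of_norm_lt_one (x := CStarMatrix.ofMatrix v)
    ⟨hv.isIdempotentElem, hv.isSelfAdjoint⟩ h

theorem mnorm_le_one {v : Matrix (Fin n) (Fin n) B} (hv : IsStarProjection (star v * v)) :
    mnorm v ≤ 1 := by
  have h1 : mnorm (star v * v) ≤ 1 := by
    have h := mnorm_star_mul_self (star v * v)
    rw [hv.isSelfAdjoint.star_eq, hv.isIdempotentElem.eq] at h
    nlinarith [mnorm_nonneg (star v * v)]
  rw [mnorm_star_mul_self] at h1
  nlinarith [mnorm_nonneg v]

theorem mnorm_le_one_of_projection {p : Matrix (Fin n) (Fin n) B} (hp : IsStarProjection p) :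
    mnorm p ≤ 1 := by
  refine mnorm_le_one ?_
  rwa [hp.isSelfAdjoint.star_eq, hp.isIdempotentElem.eq]

theorem mnorm_mul_le_left {v w : Matrix (Fin n) (Fin n) B} (h : mnorm w ≤ 1) :
    mnorm (v * w) ≤ mnorm v :=
  (mnorm_mul_le v w).trans (mul_le_of_le_one_right (mnorm_nonneg v) h)

theorem mnorm_mul_le_right {v w : Matrix (Fin n) (Fin n) B} (h : mnorm v ≤ 1) :
    mnorm (v * w) ≤ mnorm w :=
  (mnorm_mul_le v w).trans (mul_le_of_le_one_left (mnorm_nonneg w) h)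

end MatrixNorm

/-! ### Every normalising partial isometry is regular -/

section Regular

variable {B : Type u} [NonUnitalCStarAlgebra B] {n : ℕ} {C : NonUnitalStarSubalgebra ℂ B}
  {E : ℕ → MatrixUnits B}

/-- The norm gap: `x v (1 - x)` is a normalising partial isometry by two cuts, and since `x w (1 -
x) = 0` its norm is at most `2 ‖v - w‖ < 1`, so it vanishes. This is the source of the constant
`1/2`. -/
theorem IsAFSystem.sc_mul_eq_of_mnorm_sub_lt (h : IsAFSystem C E)
    {v w : Matrix (Fin n) (Fin n) B} (hv : IsNPi C v) (hvw : mnorm (v - w) < 1 / 2) {x : B}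
    (hx : IsStarProjection x) (hxC : x ∈ C) (hw : sc n x * w = w * sc n x) :
    sc n x * v = sc n x * v * sc n x := by
  have hxx : sc n x * sc n x = sc n x := (isStarProjection_sc hx).isIdempotentElem
  have h1 := h.isNPi_sc_mul hv hx hxC
  have h2 := (gcls_cut h1 (isStarProjection_sc hx) (sc_mem hxC)
    (h.sc_commute hxC (h.star_mul_self_mem h1)).symm).2.1
  refine sub_eq_zero.1 (eq_zero_of_mnorm_lt_one h2.1.1 ?_)
  have h3 : sc n x * v - sc n x * v * sc n x =
      sc n x * (v - w) - sc n x * (v - w) * sc n x := by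
    simp only [mul_sub, sub_mul]
    rw [mul_assoc (sc n x) w, ← hw, ← mul_assoc, hxx]
    abel
  rw [h3]
  have hle := mnorm_le_one_of_projection (isStarProjection_sc (n := n) hx)
  have h4 := mnorm_sub_le (sc n x * (v - w)) (sc n x * (v - w) * sc n x)
  have h5 := mnorm_mul_le_right (w := v - w) hle
  have h6 := mnorm_mul_le_left (v := sc n x * (v - w)) hle
  linarith

/-- A normalising partial isometry close to a matrix that commutes with `C` has entries
in `C`. -/
theorem IsAFSystem.mem_of_mnorm_sub_lt (h : IsAFSystem C E) {v w : Matrix (Fin n) (Fin n) B}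
    (hv : IsNPi C v) (hvw : mnorm (v - w) < 1 / 2)
    (hw : ∀ x ∈ C, sc n x * w = w * sc n x) (i j : Fin n) : v i j ∈ C := by
  refine h.mem_of_commute fun x hx => h.commute_of_forall_dg 0 (fun l _ a => ?_) hx
  have hd := (E l).isStarProjection_dg a
  have hds : star (sc n ((E l).dg a)) = sc n ((E l).dg a) :=
    (isStarProjection_sc hd).isSelfAdjoint
  have h1 := h.sc_mul_eq_of_mnorm_sub_lt hv hvw hd (h.dg_mem l a) (hw _ (h.dg_mem l a))
  have h2 := h.sc_mul_eq_of_mnorm_sub_lt hv.star (w := star w)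
    (by rw [← star_sub, mnorm_star]; exact hvw) hd (h.dg_mem l a) (by
      have := congrArg star (hw _ (h.dg_mem l a))
      rw [star_mul, star_mul, hds] at this
      exact this.symm)
  have h3 := congrArg star h2
  simp only [star_mul, star_star, hds] at h3
  -- Applied to `v` and to `v*`, the gap gives `x v = x v x = v x`.
  have h4 : v * sc n ((E l).dg a) = sc n ((E l).dg a) * v := by
    rw [h1, h3, mul_assoc]
  have h5 := congrFun (congrFun h4 i) j
  rwa [mul_sc_apply, sc_mul_apply] at h5

/-- The norm gap again, for the partial isometry `v - v * one`: the approximant is fixed by the unit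
of its level. -/
theorem IsAFSystem.mul_sc_one_of_mnorm_sub_lt (h : IsAFSystem C E)
    {v w : Matrix (Fin n) (Fin n) B} (hv : IsNPi C v) {k : ℕ} (hw : ∀ i j, w i j ∈ (E k).alg)
    (hvw : mnorm (v - w) < 1 / 2) : v * sc n (E k).one = v := by
  have hp := isStarProjection_sc (n := n) (E k).isStarProjection_one
  have h2 := (gcls_cut hv hp (sc_mem (h.one_mem k))
    (h.sc_commute (h.one_mem k) (h.star_mul_self_mem hv)).symm).2.1
  refine (sub_eq_zero.1 (eq_zero_of_mnorm_lt_one h2.1.1 ?_)).symm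
  have hw1 : w * sc n (E k).one = w := Matrix.ext fun i j => by
    rw [mul_sc_apply, (E k).alg_mul_one (hw i j)]
  have h3 : v - v * sc n (E k).one = (v - w) - (v - w) * sc n (E k).one := by
    rw [sub_mul, hw1]; abel
  rw [h3]
  have h4 := mnorm_sub_le (v - w) ((v - w) * sc n (E k).one)
  have h6 := mnorm_mul_le_left (v := v - w) (mnorm_le_one_of_projection hp)
  linarith

theorem MatrixUnits.mnorm_sc_e_le (E : MatrixUnits B) (s : Fin E.r) (i j : Fin (E.d s)) :
    mnorm (sc n (E.e s i j)) ≤ 1 := by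
  refine mnorm_le_one ?_
  rw [star_sc, sc_mul_sc, E.star_e, E.mul_same]
  exact isStarProjection_sc (E.isStarProjection_dg ⟨s, j⟩)

/-- The corners of a normalising partial isometry are regular. -/
theorem IsAFSystem.isRegular_corner (h : IsAFSystem C E) {v w : Matrix (Fin n) (Fin n) B}
    (hv : IsNPi C v) {k : ℕ} (hw : ∀ i j, w i j ∈ (E k).alg) (hvw : mnorm (v - w) < 1 / 2)
    (a b : (E k).Idx) : IsRegular C (sc n ((E k).dg a) * (v * sc n ((E k).dg b))) := by
  have hx := h.isNPi_sc_mul (h.isNPi_mul_sc hv ((E k).isStarProjection_dg b) (h.dg_mem k b))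
    ((E k).isStarProjection_dg a) (h.dg_mem k a)
  have hxw : mnorm (sc n ((E k).dg a) * ((v - w) * sc n ((E k).dg b))) < 1 / 2 :=
    ((mnorm_mul_le_right 
      (mnorm_le_one_of_projection (isStarProjection_sc ((E k).isStarProjection_dg a)))).trans
      (mnorm_mul_le_left 
      (mnorm_le_one_of_projection (isStarProjection_sc ((E k).isStarProjection_dg b))))).trans_lt
      hvw
  obtain ⟨s, i⟩ := a
  obtain ⟨t, j⟩ := b
  by_cases hst : s = t
  swap
  -- Between different blocks the approximant has no corner, so that of `v` is small, hence zero.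
  · have h0 : sc n ((E k).dg ⟨s, i⟩) * (w * sc n ((E k).dg ⟨t, j⟩)) = 0 :=
      Matrix.ext fun a b => by
        rw [sc_mul_apply, mul_sc_apply, ← mul_assoc]
        exact (E k).mul_mul_eq_zero_of_ne (hw a b) hst i i j j
    rw [sub_mul, mul_sub, h0, sub_zero] at hxw
    rw [eq_zero_of_mnorm_lt_one hx.1.1 (hxw.trans (by norm_num))]
    exact isRegular_zero
  subst hst
  set x := sc n ((E k).dg ⟨s, i⟩) * (v * sc n ((E k).dg ⟨s, j⟩)) with hxdef
  have hxj : ∀ a b, x a b * (E k).e s j j = x a b := fun a b => by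
    rw [hxdef, sc_mul_apply, mul_sc_apply, mul_assoc, mul_assoc]
    congr 2
    exact (E k).dg_mul_self ⟨s, j⟩
  -- Within a block, right multiplication by the swap acts on the corner as multiplication by `e s j
  -- i` and moves it to the diagonal position `(i, i)`.
  obtain ⟨y, hy, hxy⟩ : ∃ y, IsNormalizingUnitary C y ∧
      emb x * y = emb (x * sc n ((E k).e s j i)) := by
    by_cases hij : i = j
    · subst hij
      refine ⟨1, isNormalizingUnitary_one, ?_⟩
      rw [mul_one]
      congr 1
      refine Matrix.ext fun a b => ?_
      rw [mul_sc_apply, hxj]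
    · refine ⟨_, h.isNormalizingUnitary_swap s hij, Matrix.ext fun a b => ?_⟩
      rw [Matrix.mul_diagonal]
      change (x a b : Unitization ℂ B) * (E k).swap s i j =
        ((x * sc n ((E k).e s j i)) a b : B)
      have h0 : ∀ l, x a b * (E k).e s i l = 0 := fun l => by
        rw [← hxj, mul_assoc, (E k).mul_index_ne _ _ _ _ _ (Ne.symm hij), mul_zero]
      rw [mul_sc_apply]
      simp only [MatrixUnits.swap, mul_add, mul_sub, mul_one, ← Unitization.inr_mul, h0, hxj,
        Unitization.inr_zero]
      abel
  obtain ⟨hV, hreg⟩ := h.isRegular_of_mul_unitary hx hy hxy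
  refine hreg ⟨hV, gcls_eq_gcls_star_mul_self
    (h.mem_of_mnorm_sub_lt hV (w := sc n ((E k).dg ⟨s, i⟩) * (w * sc n ((E k).dg ⟨s, j⟩)) *
      sc n ((E k).e s j i)) ?_ ?_) hV⟩
  · rw [hxdef, ← sub_mul, ← mul_sub, ← sub_mul]
    exact (mnorm_mul_le_left ((E k).mnorm_sc_e_le s j i)).trans_lt hxw
  -- After the move every entry of the approximant is a scalar multiple of `dg ⟨s, i⟩`, which
  -- commutes with `C`.
  · intro y hy
    refine Matrix.ext fun a b => ?_
    obtain ⟨c, hc⟩ := (E k).exists_smul_of_mem_alg (hw a b) s i j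
    have h1 : (sc n ((E k).dg ⟨s, i⟩) * (w * sc n ((E k).dg ⟨s, j⟩)) *
        sc n ((E k).e s j i)) a b = c • (E k).dg ⟨s, i⟩ := by
      rw [mul_sc_apply, sc_mul_apply, mul_sc_apply, ← mul_assoc]
      change (E k).e s i i * w a b * (E k).e s j j * (E k).e s j i = _
      rw [hc, smul_mul_assoc, (E k).mul_same]
      rfl
    rw [sc_mul_apply, mul_sc_apply y, h1, mul_smul_comm, smul_mul_assoc, h.dg_commute _ hy]

/-- Every normalising partial isometry has the class of its initial projection. -/
theorem IsAFSystem.isRegular (h : IsAFSystem C E) {v : Matrix (Fin n) (Fin n) B}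
    (hv : IsNPi C v) : IsRegular C v := by
  obtain ⟨k, w, hw, hvw⟩ := exists_matrix_approx h.monotone_alg v
    (fun i j => by rw [h.dense]; trivial) (ε := 1 / 2) (by norm_num)
  have h1 : v * sc n (E k).one = v := h.mul_sc_one_of_mnorm_sub_lt hv hw hvw
  have h2 : sc n (E k).one * v = v := by
    have h3 := h.mul_sc_one_of_mnorm_sub_lt hv.star (w := star w)
      (fun i j => star_mem (s := (E k).alg) (hw j i))
      (by rw [← star_sub, mnorm_star]; exact hvw)
    have h4 := congrArg star h3
    rwa [star_mul, star_star, star_sc, (E k).star_one] at h4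
  have h5 : IsRegular C (v * sc n (E k).one) := by
    refine h.isRegular_mul_sum hv k Finset.univ fun b _ => ?_
    have h6 : sc n (E k).one * (v * sc n ((E k).dg b)) = v * sc n ((E k).dg b) := by
      rw [← mul_assoc, h2]
    rw [← h6]
    exact h.isRegular_sum_mul (h.isNPi_mul_sc hv ((E k).isStarProjection_dg b) (h.dg_mem k b)) k
      Finset.univ fun a _ => h.isRegular_corner hv hw hvw a b
  rwa [h1] at h5

end Regular

/-! ### Comparison of block multiplicities -/

section BlockCount

variable {B : Type u} [NonUnitalCStarAlgebra B] {N a a' : ℕ} (E : MatrixUnits B)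

/-- Comparison of the multiplicities of the blocks in the diagonal forms of two projections, one
of which is almost equivalent to a subprojection of the other by a matrix over `E.alg`. -/
theorem MatrixUnits.card_block_le {c : Fin a → E.Idx} {c' : Fin a' → E.Idx}
    {u : Matrix (Fin N) (Fin a) B} {u' : Matrix (Fin N) (Fin a') B}
    (hu : ∀ i t, u i t ∈ E.alg) (hu' : ∀ i t, u' i t ∈ E.alg)
    (huu : u.conjTranspose * u = Matrix.diagonal fun t => E.dg (c t))
    (huc : ∀ i t, u i t * E.dg (c t) = u i t) (huc' : ∀ i t, u' i t * E.dg (c' t) = u' i t)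
    {w x : Matrix (Fin N) (Fin N) B} (hw : star w * w = u * u.conjTranspose)
    (hw' : u' * u'.conjTranspose * w = w) (hf : IsStarProjection (u' * u'.conjTranspose))
    (hx : ∀ i j, x i j ∈ E.alg) (hwx : mnorm (w - x) < 1) (s : Fin E.r) :
    Fintype.card {t // (c t).1 = s} ≤ Fintype.card {t // (c' t).1 = s} := by
  by_contra! hlt
  have hi : ∀ t : {t // (c t).1 = s}, ∃ i, c t = ⟨s, i⟩ := by
    rintro ⟨t, rfl⟩; exact ⟨_, rfl⟩
  have hi' : ∀ t : {t // (c' t).1 = s}, ∃ i, c' t = ⟨s, i⟩ := by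
    rintro ⟨t, rfl⟩; exact ⟨_, rfl⟩
  choose i hi using hi
  choose i' hi' using hi'
  set x' := u'.conjTranspose * (x * u) with hx'
  have hx'mem : ∀ t' t, x' t' t ∈ E.alg :=
    matrix_mul_mem (fun t j => star_mem (hu' j t)) (matrix_mul_mem hx hu)
  have hr : ∀ t' t, x' t' t * E.dg (c t) = x' t' t := fun t' t => by
    rw [hx', ← Matrix.mul_assoc, Matrix.mul_apply, Finset.sum_mul]
    exact Finset.sum_congr rfl fun j _ => by rw [mul_assoc, huc]
  have hl : ∀ t' t, E.dg (c' t') * x' t' t = x' t' t := fun t' t => by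
    rw [hx', Matrix.mul_apply, Finset.mul_sum]
    refine Finset.sum_congr rfl fun j _ => ?_
    rw [← mul_assoc, Matrix.conjTranspose_apply]
    congr 1
    rw [← huc' j t', star_mul, E.star_dg, ← mul_assoc, E.dg_mul_self]
  -- In diagonal coordinates, the part of the compression of `x` in block `s` is a scalar matrix. It
  -- has more columns than rows, so some nonzero `ξ` lies in its kernel.
  have hL : ∀ (t' : {t // (c' t).1 = s}) (t : {t // (c t).1 = s}),
      ∃ z : ℂ, x' t' t = z • E.e s (i' t') (i t) := fun t' t => by
    obtain ⟨z, hz⟩ := E.exists_smul_of_mem_alg (hx'mem t' t) s (i' t') (i t)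
    refine ⟨z, ?_⟩
    rw [← hz]
    have h1 := hl t' t
    have h2 := hr t' t
    rw [hi' t'] at h1
    rw [hi t] at h2
    change E.e s (i' t') (i' t') * _ = _ at h1
    change _ * E.e s (i t) (i t) = _ at h2
    rw [h1, h2]
  choose L hL using hL
  obtain ⟨ξ, hξ0, hξ⟩ : ∃ ξ : {t // (c t).1 = s} → ℂ, ξ ≠ 0 ∧ (Matrix.of L).mulVec ξ = 0 := by
    have h1 : LinearMap.ker (Matrix.mulVecLin (Matrix.of L)) ≠ ⊥ :=
      LinearMap.ker_ne_bot_of_finrank_lt (by simpa using hlt)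
    obtain ⟨ξ, hξ, h0⟩ := Submodule.exists_mem_ne_zero_of_ne_bot h1
    exact ⟨ξ, h0, hξ⟩
  obtain ⟨t₀, ht₀⟩ := Function.ne_iff.1 hξ0
  have hN : Nonempty (Fin N) := by
    by_contra hne
    rw [not_nonempty_iff] at hne
    have h1 := congrFun (congrFun huu t₀) t₀
    rw [Matrix.diagonal_apply_eq, Matrix.mul_apply, Finset.univ_eq_empty,
      Finset.sum_empty] at h1
    exact E.dg_ne_zero _ h1.symm
  obtain ⟨j₀⟩ := hN
  -- All `N` columns repeat the column given by `ξ`, only so that `u * y` is square and `mnorm`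
  -- applies. The index `i t₀` is an arbitrary fixed column of the block.
  set y : Matrix (Fin a) (Fin N) B := Matrix.of fun t _ =>
    if h : (c t).1 = s then ξ ⟨t, h⟩ • E.e s (i ⟨t, h⟩) (i t₀) else 0 with hy
  have hy1 : ∀ (t : {t // (c t).1 = s}) j, y t j = ξ t • E.e s (i t) (i t₀) := fun t j => by
    rw [hy, Matrix.of_apply, dif_pos t.2]
  have hy0 : ∀ t j, (c t).1 ≠ s → y t j = 0 := fun t j h => by
    rw [hy, Matrix.of_apply, dif_neg h]
  have hdy : (Matrix.diagonal fun t => E.dg (c t)) * y = y := Matrix.ext fun t j => by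
    rw [Matrix.diagonal_mul]
    by_cases h : (c t).1 = s
    · rw [hy1 ⟨t, h⟩, hi ⟨t, h⟩, mul_smul_comm]
      congr 1
      exact E.mul_same _ _ _ _
    · rw [hy0 t j h, mul_zero]
  have hZ0 : u * y ≠ 0 := by
    intro h0
    have h1 : y = 0 := by
      rw [← hdy, ← huu, Matrix.mul_assoc, h0, Matrix.mul_zero]
    have h2 := congrFun (congrFun h1 t₀) j₀
    rw [hy1 t₀] at h2
    rcases smul_eq_zero.1 h2 with h3 | h3
    · exact ht₀ h3
    · exact E.ne_zero _ _ _ h3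
  have hxy : x' * y = 0 := by
    refine Matrix.ext fun t' j => ?_
    rw [Matrix.mul_apply, Matrix.zero_apply]
    by_cases ht' : (c' t').1 = s
    · have h1 : ∀ t, (c t).1 ≠ s → x' t' t * y t j = 0 := fun t ht => by
        rw [hy0 t j ht, mul_zero]
      have h2 : ∑ t, x' t' t * y t j = ∑ t : {t // (c t).1 = s}, x' t' t * y t j := by
        rw [← Fintype.sum_subtype_add_sum_subtype (fun t => (c t).1 = s)]
        exact add_eq_left.2 (Finset.sum_eq_zero fun t _ => h1 t t.2)
      have h3 : ∀ t : {t // (c t).1 = s}, x' t' t * y t j =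
          (L ⟨t', ht'⟩ t * ξ t) • E.e s (i' ⟨t', ht'⟩) (i t₀) := fun t => by
        rw [hy1, hL ⟨t', ht'⟩ t, smul_mul_smul_comm, E.mul_same]
      rw [h2, Finset.sum_congr rfl fun t _ => h3 t, ← Finset.sum_smul]
      have h4 : ∑ t, L ⟨t', ht'⟩ t * ξ t = 0 := congrFun hξ ⟨t', ht'⟩
      rw [h4, zero_smul]
    · refine Finset.sum_eq_zero fun t _ => ?_
      by_cases ht : (c t).1 = s
      · rw [hy1 ⟨t, ht⟩, mul_smul_comm, ← hl]
        have h1 := E.mul_mul_eq_zero_of_ne (hx'mem t' t) ht' (c' t').2 (c' t').2 (i ⟨t, ht⟩) (i t₀)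
        change ξ _ • (E.e _ _ _ * _ * _) = 0
        rw [h1, smul_zero]
      · rw [hy0 t j ht, mul_zero]
  have heZ : u * u.conjTranspose * (u * y) = u * y := by
    rw [Matrix.mul_assoc, ← Matrix.mul_assoc u.conjTranspose, huu, hdy]
  have hfxZ : u' * u'.conjTranspose * (x * (u * y)) = 0 := by
    rw [Matrix.mul_assoc, ← Matrix.mul_assoc x, ← Matrix.mul_assoc u'.conjTranspose, hxy,
      Matrix.mul_zero]
  -- For `Z = u y`, `e = u u*` and `f = u' u'*`: `w` is isometric on `Z = e Z`, while `f x Z = 0`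
  -- gives `w Z = f (w - x) Z`. So `‖Z‖ ≤ ‖w - x‖ ‖Z‖ < ‖Z‖`, a contradiction.
  have h1 : mnorm (w * (u * y)) = mnorm (u * y) := by
    have h2 : star (w * (u * y)) * (w * (u * y)) = star (u * y) * (u * y) := by
      rw [star_mul, mul_assoc, ← mul_assoc (star w), hw]
      exact congrArg _ heZ
    have h3 := mnorm_star_mul_self (w * (u * y))
    rw [h2, mnorm_star_mul_self] at h3
    exact ((mul_self_inj (mnorm_nonneg _) (mnorm_nonneg _)).1 h3).symm
  have h2 : w * (u * y) = u' * u'.conjTranspose * ((w - x) * (u * y)) := by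
    rw [sub_mul, mul_sub, hfxZ, sub_zero, ← mul_assoc, hw']
  have h3 : mnorm (w * (u * y)) ≤ mnorm (w - x) * mnorm (u * y) := by
    rw [h2]
    exact (mnorm_mul_le_right (mnorm_le_one_of_projection hf)).trans (mnorm_mul_le _ _)
  have h4 : 0 < mnorm (u * y) :=
    lt_of_le_of_ne (mnorm_nonneg _) fun h => hZ0 (mnorm_eq_zero.1 h.symm)
  rw [h1] at h3
  nlinarith

end BlockCount

/-! ### Projections over `C` that are equivalent over `B` -/

section DiagonalProjections

variable {B : Type u} [NonUnitalCStarAlgebra B] {n m N a : ℕ} {C : NonUnitalStarSubalgebra ℂ B}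
  {E : ℕ → MatrixUnits B}

theorem MatrixUnits.exists_diagonalization_diag (E : MatrixUnits B)
    {e : Matrix (Fin N) (Fin N) B} (he : IsStarProjection e) (heE : ∀ i j, e i j ∈ E.diag.alg) :
    ∃ (a : ℕ) (c : Fin a → E.Idx) (u : Matrix (Fin N) (Fin a) B),
      (∀ i j, u i j ∈ E.diag.alg) ∧ u * u.conjTranspose = e ∧
      u.conjTranspose * u = Matrix.diagonal (fun t => E.dg (c t)) ∧
      ∀ i t, u i t * E.dg (c t) = u i t := by
  obtain ⟨a, c, u, h⟩ := E.diag.exists_diagonalization he heE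
  exact ⟨a, fun t => (Fintype.equivFin E.Idx).symm (c t).1, u, h⟩

/-- The class of a projection over `C` in terms of its diagonal form. -/
theorem gcls_eq_sum {c : Fin a → B} {u : Matrix (Fin N) (Fin a) B} (hu : ∀ i t, u i t ∈ C)
    (huu : u.conjTranspose * u = Matrix.diagonal c) (huc : ∀ i t, u i t * c t = u i t)
    (hc : ∀ t, IsStarProjection (c t)) (hcC : ∀ t, c t ∈ C) :
    gcls C (u * u.conjTranspose) = ∑ t, gcls C (sc 1 (c t)) := by
  -- The columns of `u` split `u u*` into orthogonal projections `y t (y t)*`, each equivalent over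
  -- `C` to the `1 × 1` matrix `c t`.
  set y : Fin a → Matrix (Fin N) (Fin 1) B := fun t => u.submatrix id fun _ => t with hy
  have hyy : ∀ t t', (y t).conjTranspose * y t' =
      Matrix.of fun _ _ : Fin 1 => (Matrix.diagonal c) t t' := fun t t' => by
    rw [← huu]; rfl
  have hyt : ∀ t, (y t).conjTranspose * y t = sc 1 (c t) := fun t => by
    rw [hyy]
    refine Matrix.ext fun i j => ?_
    rw [Matrix.of_apply, Matrix.diagonal_apply_eq, Subsingleton.elim i j, sc,
      Matrix.diagonal_apply_eq]
  have hyo : ∀ t t', t ≠ t' → (y t).conjTranspose * y t' = 0 := fun t t' h => by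
    rw [hyy]
    refine Matrix.ext fun i j => ?_
    rw [Matrix.of_apply, Matrix.diagonal_apply_ne _ h]; rfl
  have hyc : ∀ t, y t * sc 1 (c t) = y t := fun t => by
    refine Matrix.ext fun i j => ?_
    rw [sc, Matrix.mul_diagonal]
    exact huc i t
  have hg : ∀ t, IsStarProjection (y t * (y t).conjTranspose) := fun t => by
    constructor
    · rw [IsIdempotentElem, Matrix.mul_assoc, ← Matrix.mul_assoc _ (y t), hyt, ← Matrix.mul_assoc,
        hyc]
    · rw [IsSelfAdjoint, Matrix.star_eq_conjTranspose, Matrix.conjTranspose_mul,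
        Matrix.conjTranspose_conjTranspose]
  have hgC : ∀ t i j, (y t * (y t).conjTranspose) i j ∈ C := fun t =>
    matrix_mul_mem (fun i _ => hu i t) fun _ i => star_mem (hu i t)
  have hsum : u * u.conjTranspose = ∑ t, y t * (y t).conjTranspose := by
    refine Matrix.ext fun i j => ?_
    rw [Matrix.sum_apply, Matrix.mul_apply]
    refine Finset.sum_congr rfl fun t _ => ?_
    rw [Matrix.mul_apply, Fin.sum_univ_one]
    rfl
  rw [hsum, gcls_sum _ hg hgC]
  · refine Finset.sum_congr rfl fun t _ => ?_
    exact (gcls_eq_of_mvN (isStarProjection_sc (hc t)) (sc_mem (hcC t)) (hg t) (hgC t)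
      ⟨y t, fun i _ => hu i t, hyt t, rfl⟩).symm
  · intro t t' h
    rw [Matrix.mul_assoc, ← Matrix.mul_assoc _ (y t'), hyo t t' h, Matrix.zero_mul,
      Matrix.mul_zero]

/-- The swap conjugates one diagonal unit to the other. For `i ≠ j` it normalises `C` without having
entries in the unitization of `C`. -/
theorem IsAFSystem.gcls_sc_dg_eq (h : IsAFSystem C E) {k : ℕ} (s : Fin (E k).r)
    (i j : Fin ((E k).d s)) :
    gcls C (sc 1 ((E k).dg ⟨s, i⟩)) = gcls C (sc 1 ((E k).dg ⟨s, j⟩)) := by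
  by_cases hij : i = j
  · rw [hij]
  have hN : ∀ a, IsNPi C (sc 1 ((E k).dg a)) := fun a =>
    isNPi_of_projection (isStarProjection_sc ((E k).isStarProjection_dg a)) (sc_mem (h.dg_mem k a))
  have hz := h.isNormalizingUnitary_swap (n := 1) s hij
  refine gcls_eq_of_unitary (hN _) (hN _) le_rfl le_rfl hz hz ?_
  rw [pad_self, pad_self]
  refine Matrix.ext fun a b => ?_
  rw [Matrix.mul_diagonal, Matrix.diagonal_mul]
  have h1 : ∀ l, (sc 1 ((E k).dg ⟨s, l⟩)) a b = (E k).e s l l := fun l => by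
    rw [Subsingleton.elim a b, sc, Matrix.diagonal_apply_eq]; rfl
  change (E k).swap s i j * ((sc 1 ((E k).dg ⟨s, i⟩)) a b : B) * (E k).swap s i j =
    ((sc 1 ((E k).dg ⟨s, j⟩)) a b : B)
  rw [h1, h1]
  have h2 : ∀ a b, (E k).e s a i * (E k).e s j b = 0 :=
    fun a b => (E k).mul_index_ne _ _ _ _ _ hij
  have h3 : ∀ a b, (E k).e s a j * (E k).e s i b = 0 :=
    fun a b => (E k).mul_index_ne _ _ _ _ _ (Ne.symm hij)
  simp only [MatrixUnits.swap, add_mul, sub_mul, mul_add, mul_sub, one_mul, mul_one,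
    ← Unitization.inr_mul, (E k).mul_same, h2, h3, Unitization.inr_zero]
  abel

theorem IsAFSystem.sum_gcls_sc_dg_eq (h : IsAFSystem C E) {k : ℕ} {a a' : ℕ}
    {c : Fin a → (E k).Idx} {c' : Fin a' → (E k).Idx}
    (hcard : ∀ s, Fintype.card {t // (c t).1 = s} = Fintype.card {t // (c' t).1 = s}) :
    ∑ t, gcls C (sc 1 ((E k).dg (c t))) = ∑ t, gcls C (sc 1 ((E k).dg (c' t))) := by
  classical
  -- Terms are grouped by block, with one representative per block. The default `0` serves only
  -- blocks of size zero, whose multiplicity is zero.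
  have key : ∀ {a : ℕ} (c : Fin a → (E k).Idx), ∑ t, gcls C (sc 1 ((E k).dg (c t))) =
      ∑ s, Fintype.card {t // (c t).1 = s} •
        (if hs : Nonempty (Fin ((E k).d s)) then gcls C (sc 1 ((E k).dg ⟨s, hs.some⟩)) else 0) := by
    intro a c
    rw [← Finset.sum_fiberwise _ (fun t => (c t).1)]
    refine Finset.sum_congr rfl fun s _ => ?_
    rw [Fintype.card_subtype, ← Finset.sum_const]
    refine Finset.sum_congr rfl fun t ht => ?_
    obtain rfl := (Finset.mem_filter.1 ht).2
    have hs : Nonempty (Fin ((E k).d (c t).1)) := ⟨(c t).2⟩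
    rw [dif_pos hs]
    exact h.gcls_sc_dg_eq _ _ _
  rw [key, key]
  exact Finset.sum_congr rfl fun s _ => by rw [hcard]

/-- Projections over `C` that are equivalent in the matrices over `B` have the same class. -/
theorem IsAFSystem.gcls_eq_of_mvN_top (h : IsAFSystem C E) {p : Matrix (Fin n) (Fin n) B}
    {q : Matrix (Fin m) (Fin m) B} (hp : IsStarProjection p) (hpC : ∀ i j, p i j ∈ C)
    (hq : IsStarProjection q) (hqC : ∀ i j, q i j ∈ C) (hpq : MvN ⊤ p q) :
    gcls C p = gcls C q := by
  -- Both projections are replaced, by equivalences over `C`, by projections of a common size over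
  -- the diagonal algebra of some level; classes are unchanged.
  have hdiag : ∀ {n : ℕ} {p : Matrix (Fin n) (Fin n) B} (N : ℕ), n ≤ N → IsStarProjection p →
      (∀ i j, p i j ∈ C) → ∃ k, ∃ e : Matrix (Fin N) (Fin N) B, IsStarProjection e ∧
        (∀ i j, e i j ∈ (E k).diag.alg) ∧ MvN ⊤ p e ∧ gcls C p = gcls C e := by
    intro n p N hN hp hpC
    have hP := isStarProjection_pad hp hN
    have hPC : ∀ i j, pad N p i j ∈ C := by
      rw [pad_eq_rpad]; exact rpad_mem (zero_mem C) _ _ hpC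
    obtain ⟨k, e, he, hek, hPe⟩ := exists_mvN_of_closure h.monotone_alg_diag
      (fun k => (E k).diag.isClosed_alg) h.coe_eq hP hPC
    have hpe : MvN C p e := (mvN_pad hp hpC hN).trans hp.isIdempotentElem he.isIdempotentElem hPe
    exact ⟨k, e, he, hek, hpe.mono le_top,
      gcls_eq_of_mvN hp hpC he (fun i j => h.alg_diag_le k (hek i j)) hpe⟩
  obtain ⟨k₁, e, he, hek, hpe, hpe'⟩ := hdiag (max n m) (le_max_left _ _) hp hpC
  obtain ⟨k₂, f, hf, hfk, hqf, hqf'⟩ := hdiag (max n m) (le_max_right _ _) hq hqC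
  obtain ⟨w, -, hwe, hwf⟩ := (hpe.symm.trans he.isIdempotentElem hq.isIdempotentElem hpq).trans
    he.isIdempotentElem hf.isIdempotentElem hqf
  obtain ⟨k₃, x, hxk, hwx⟩ := exists_matrix_approx h.monotone_alg w
    (fun i j => by rw [h.dense]; trivial) (ε := 1) one_pos
  set l := max k₁ (max k₂ k₃)
  have hek' : ∀ i j, e i j ∈ (E l).diag.alg := fun i j =>
    h.monotone_alg_diag (le_max_left _ _) (hek i j)
  have hfk' : ∀ i j, f i j ∈ (E l).diag.alg := fun i j =>
    h.monotone_alg_diag ((le_max_left _ _).trans (le_max_right _ _)) (hfk i j)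
  have hx : ∀ i j, x i j ∈ (E l).alg := fun i j =>
    h.monotone_alg ((le_max_right _ _).trans (le_max_right _ _)) (hxk i j)
  obtain ⟨a, c, u, hu, hue, huu, huc⟩ := (E l).exists_diagonalization_diag he hek'
  obtain ⟨a', c', u', hu', hue', huu', huc'⟩ := (E l).exists_diagonalization_diag hf hfk'
  rw [← Matrix.star_eq_conjTranspose] at hwe hwf
  have hfw : f * w = w := by
    rw [← hwf]
    exact Matrix.mul_star_mul_self (by rw [hwe]; exact he)
  have hew : e * star w = star w := by
    have h1 := congrArg star (Matrix.mul_star_mul_self (v := w) (by rw [hwe]; exact he))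
    rw [star_mul, star_mul, star_star] at h1
    rw [← hwe, mul_assoc]
    exact h1
  have hdu : ∀ i t, u i t ∈ (E l).alg := fun i t => (E l).alg_diag_le (hu i t)
  have hdu' : ∀ i t, u' i t ∈ (E l).alg := fun i t => (E l).alg_diag_le (hu' i t)
  -- The comparison for `w` gives one inequality and that for `w*` the other.
  have hcard : ∀ s, Fintype.card {t // (c t).1 = s} = Fintype.card {t // (c' t).1 = s} := by
    intro s
    refine le_antisymm ?_ ?_
    · exact (E l).card_block_le hdu hdu' huu huc huc' (by rw [hwe, hue]) (by rw [hue', hfw])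
        (by rw [hue']; exact hf) hx hwx s
    · exact (E l).card_block_le hdu' hdu huu' huc' huc (w := star w) (x := star x)
        (by rw [star_star, hwf, hue']) (by rw [hue, hew]) (by rw [hue]; exact he)
        (fun i j => star_mem (hx j i)) (by rw [← star_sub, mnorm_star]; exact hwx) s
  rw [hpe', hqf', ← hue, ← hue', gcls_eq_sum (fun i t => h.alg_diag_le l (hu i t)) huu huc
    (fun t => (E l).isStarProjection_dg _) (fun t => h.dg_mem l _),
    gcls_eq_sum (fun i t => h.alg_diag_le l (hu' i t)) huu' huc'
    (fun t => (E l).isStarProjection_dg _) (fun t => h.dg_mem l _)]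
  exact h.sum_gcls_sc_dg_eq hcard

end DiagonalProjections

/-! ### The homomorphism to `K₀(B)` and its inverse -/

section Isomorphism

variable {B : Type u} [NonUnitalCStarAlgebra B] {n m : ℕ} {C : NonUnitalStarSubalgebra ℂ B}
  {E : ℕ → MatrixUnits B}

theorem K0.mk_eq_of_mvN {p q : Pr B} (h : MvN ⊤ p.1.2 q.1.2) : K0.mk p = K0.mk q := by
  obtain ⟨N, hn, hm, z, hz, -, hzp⟩ := h.exists_unitary p.2
  exact Gr.mk_eq_of_rel ⟨N, hn, hm, z, hz, hzp⟩

/-- Every projection over `B` is equivalent to one over `C`. -/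
theorem IsAFSystem.exists_mvN_diagonal (h : IsAFSystem C E) {p : Matrix (Fin n) (Fin n) B}
    (hp : IsStarProjection p) :
    ∃ (a : ℕ) (q : Matrix (Fin a) (Fin a) B), IsStarProjection q ∧ (∀ i j, q i j ∈ C) ∧
      MvN ⊤ p q := by
  obtain ⟨k, e, he, hek, hpe⟩ := exists_mvN_of_dense h.monotone_alg
    (fun k => (E k).isClosed_alg) h.dense hp
  obtain ⟨a, c, u, hu, hue, huu, -⟩ := (E k).exists_diagonalization he hek
  have hq : IsStarProjection (Matrix.diagonal fun t => (E k).dg (c t)) := by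
    constructor
    · rw [IsIdempotentElem, Matrix.diagonal_mul_diagonal]
      simp only [(E k).dg_mul_self]
    · rw [IsSelfAdjoint, Matrix.star_eq_conjTranspose, Matrix.diagonal_conjTranspose]
      congr 1
      funext t
      exact (E k).star_dg (c t)
  refine ⟨a, _, hq, fun i j => ?_, hpe.trans hp.isIdempotentElem hq.isIdempotentElem
    ⟨u.conjTranspose, fun _ _ => trivial, ?_, ?_⟩⟩
  · rw [Matrix.diagonal_apply]
    split_ifs
    · exact h.dg_mem k _
    · exact zero_mem C
  · rw [Matrix.conjTranspose_conjTranspose, hue]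
  · rw [Matrix.conjTranspose_conjTranspose, huu]

theorem mvN_initial_final (v : NPi C) : MvN ⊤ v.initial.1.2 v.final.1.2 :=
  ⟨v.1.2, fun _ _ => trivial, rfl, rfl⟩

/-- The homomorphism `G(B; C) → K₀(B)`, `[v] ↦ [v* v]`. -/
noncomputable def toK0 (C : NonUnitalStarSubalgebra ℂ B) : G C →+ K0 B :=
  Gr.lift (fun v => K0.mk v.initial)
    (by
      rintro v w ⟨N, hn, hm, z, y, hz, hy, h⟩
      refine Gr.mk_eq_of_rel ⟨N, hn, hm, star y, Unitary.star_mem hy.1, ?_⟩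
      have hz1 : star z * z = 1 := (Unitary.mem_iff.1 hz.1).1
      change star y * emb (pad N (star v.1.2 * v.1.2)) * star (star y) =
        emb (pad N (star w.1.2 * w.1.2))
      rw [← pad_mul hn, ← pad_mul hm, emb_mul, emb_mul, ← star_pad, ← star_pad, emb_star, emb_star,
        ← h, star_mul, star_mul, star_star]
      simp only [mul_assoc]
      rw [← mul_assoc (star z), hz1, one_mul])
    (by
      rintro ⟨⟨nv, v⟩, hv⟩ ⟨⟨nw, w⟩, hw⟩ ⟨t, ht⟩ h
      obtain rfl : t = ⟨nv + nw, dsumMat v w⟩ := h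
      refine Gr.mk_eq_add ?_
      change (⟨nv + nw, star (dsumMat v w) * dsumMat v w⟩ : MInf B) =
        ⟨nv + nw, dsumMat (star v * v) (star w * w)⟩
      rw [Matrix.star_eq_conjTranspose, conjTranspose_dsumMat, dsumMat_mul]
      rfl)

theorem toK0_mk (v : NPi C) : toK0 C (G.mk C v) = K0.mk v.initial := Gr.lift_mk _ _ _ v

theorem toK0_gcls {p : Matrix (Fin n) (Fin n) B} (hp : IsStarProjection p)
    (hpC : ∀ i j, p i j ∈ C) : toK0 C (gcls C p) = K0.mk ⟨⟨n, p⟩, hp⟩ := by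
  rw [gcls_eq (isNPi_of_projection hp hpC), toK0_mk]
  have h1 : star p * p = p := by rw [hp.isSelfAdjoint.star_eq, hp.isIdempotentElem.eq]
  congr 1
  refine Subtype.ext ?_
  change (⟨n, star p * p⟩ : MInf B) = ⟨n, p⟩
  rw [h1]

/-- The inverse homomorphism maps the class of a projection `p` to the class of any projection
over `C` that is equivalent to `p`. -/
theorem IsAFSystem.exists_ofK0 (h : IsAFSystem C E) :
    ∃ ψ : K0 B →+ G C, ∀ {n a : ℕ} {p : Matrix (Fin n) (Fin n) B} {q : Matrix (Fin a) (Fin a) B}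
      (hp : IsStarProjection p), IsStarProjection q → (∀ i j, q i j ∈ C) → MvN ⊤ p q →
        ψ (K0.mk ⟨⟨n, p⟩, hp⟩) = gcls C q := by
  have hex : ∀ p : Pr B, ∃ (a : ℕ) (q : Matrix (Fin a) (Fin a) B), IsStarProjection q ∧
      (∀ i j, q i j ∈ C) ∧ MvN ⊤ p.1.2 q := fun p => h.exists_mvN_diagonal p.2
  choose a q hq hqC hpq using hex
  -- Independence of the chosen representative over `C`; it also yields invariance under unitary
  -- equivalence and additivity.
  have huniq : ∀ (p : Pr B) {b : ℕ} {r : Matrix (Fin b) (Fin b) B}, IsStarProjection r →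
      (∀ i j, r i j ∈ C) → MvN ⊤ p.1.2 r → gcls C (q p) = gcls C r := by
    intro p b r hr hrC hpr
    exact h.gcls_eq_of_mvN_top (hq p) (hqC p) hr hrC
      ((hpq p).symm.trans (hq p).isIdempotentElem hr.isIdempotentElem hpr)
  refine ⟨Gr.lift (fun p => gcls C (q p)) ?_ ?_, ?_⟩
  · rintro p p' ⟨N, hn, hm, z, hz, hzp⟩
    exact huniq p (hq p') (hqC p') ((mvN_of_unitary p.2 p'.2 hn hm hz hzp).trans
      p.2.isIdempotentElem (hq p').isIdempotentElem (hpq p'))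
  · rintro p p' ⟨t, ht⟩ hsum
    obtain rfl : t = dsum p.1 p'.1 := hsum
    have h1 := isStarProjection_dsumMat (hq p) (hq p')
    have h2 := dsumMat_mem (hqC p) (hqC p')
    rw [← gcls_dsumMat (isNPi_of_projection (hq p) (hqC p)) (isNPi_of_projection (hq p') (hqC p'))
      (isNPi_of_projection h1 h2)]
    exact huniq _ h1 h2 ((hpq p).dsum (hpq p'))
  · intro n b p r hp hr hrC hpr
    exact (Gr.lift_mk _ _ _ _).trans (huniq ⟨⟨n, p⟩, hp⟩ hr hrC hpr)

end Isomorphism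

end DimDist

theorem mainTheorem8 {B : Type u} [NonUnitalCStarAlgebra B] (C : NonUnitalStarSubalgebra ℂ B)
    (hC : DimDist.IsStandardAFDiagonal C) :
    ∃ φ : DimDist.G C ≃+ DimDist.K0 B, ∀ v : DimDist.NPi C,
      φ (DimDist.G.mk C v) = DimDist.K0.mk v.initial ∧
      φ (DimDist.G.mk C v) = DimDist.K0.mk v.final := by
  obtain ⟨E, h⟩ := hC.exists_isAFSystem
  obtain ⟨ψ, hψ⟩ := h.exists_ofK0
  have h1 : ψ.comp (DimDist.toK0 C) = AddMonoidHom.id _ := by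
    refine DimDist.Gr.hom_ext fun v => ?_
    change ψ (DimDist.toK0 C (DimDist.G.mk C v)) = DimDist.G.mk C v
    have hv : DimDist.IsNPi C v.1.2 := v.2
    have hmem := h.star_mul_self_mem hv
    rw [DimDist.toK0_mk]
    -- The initial projection already lies over `C`, so it represents itself; regularity of `v`
    -- identifies its class with `[v]`.
    refine (hψ hv.1.1 hv.1.1 hmem (DimDist.mvN_refl hv.1.1 fun _ _ => trivial)).trans ?_
    rw [← (h.isRegular hv).2, DimDist.gcls_eq hv]
  have h2 : (DimDist.toK0 C).comp ψ = AddMonoidHom.id _ := by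
    refine DimDist.Gr.hom_ext fun p => ?_
    change DimDist.toK0 C (ψ (DimDist.K0.mk p)) = DimDist.K0.mk p
    obtain ⟨a, q, hq, hqC, hpq⟩ := h.exists_mvN_diagonal p.2
    rw [hψ p.2 hq hqC hpq, DimDist.toK0_gcls hq hqC]
    exact (DimDist.K0.mk_eq_of_mvN hpq).symm
  refine ⟨(DimDist.toK0 C).toAddEquiv ψ h1 h2, fun v => ?_⟩
  have h3 : (DimDist.toK0 C).toAddEquiv ψ h1 h2 (DimDist.G.mk C v) = DimDist.K0.mk v.initial :=
    DimDist.toK0_mk v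
  exact ⟨h3, h3.trans (DimDist.K0.mk_eq_of_mvN (DimDist.mvN_initial_final v))⟩
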